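/- All matrices are semi-infinite, indexed by $m,n\in\mathbb N_0$, with complex entries; for a tridiagonal $J$ the products $HJ$ and $JH$ are defined entrywise by finite sums. A matrix $H$ is Hankel if $H_{m,n}=h_{m+n}$ for some sequence $(h_k)$; its rank is the dimension of the span of its columns. For real $t>0$ let $\mathcal H_t$ be the generalized Hilbert matrix with entries $\frac1{m+n+t}$, let $\tilde{\mathcal H}_t$ be the Hankel matrix with entries $\frac{(-1)^{m+n}}{m+n+t}$, and let $U=\mathrm{diag}(1,-1,1,-1,\dots)$. By a (Hermitian non-decomposable) Jacobi matrix from the Askey scheme we mean a matrix $J$ with $J_{n,n}=\beta_n$, $J_{n,n+1}=J_{n+1,n}=\alpha_n$ and $J_{m,n}=0$ for $|m-n|>1$, where $(\alpha_n),(\beta_n)$ are one of the following. (If a factor of a numerator and a factor of a denominator vanish together at $n=0$ they are cancelled, and $C_0=0$.) 1. Wilson: $\alpha_n=\sqrt{A_nC_{n+1}}$, $\beta_n=A_n+C_n-a^2$ with $s=a+b+c+d$, $A_n=\frac{(n+a+b)(n+a+c)(n+a+d)(n+s-1)}{(2n+s-1)(2n+s)}$, $C_n=\frac{n(n+b+c-1)(n+b+d-1)(n+c+d-1)}{(2n+s-2)(2n+s-1)}$;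 non-real parameters among $a,b,c,d\in\mathbb C$ occur in complex conjugate pairs, and either all four have positive real part or, up to a permutation, $a$ is real, $a\le 0$, and $a+b,a+c,a+d$ have positive real parts. 2. Continuous dual Hahn: $\alpha_n=\sqrt{A_nC_{n+1}}$, $\beta_n=A_n+C_n-a^2$ with $A_n=(n+a+b)(n+a+c)$, $C_n=n(n+b+c-1)$; non-real parameters among $a,b,c\in\mathbb C$ occur in complex conjugate pairs, and either all three have positive real part or, up to a permutation, $a$ is real, $a\le0$, and $a+b,a+c$ have positive real parts. 3. Continuous Hahn: $\alpha_n=\sqrt{-A_nC_{n+1}}$, $\beta_n=\mathrm i(A_n+C_n+a)$ with $s=a+b+c+d$, $A_n=-\frac{(n+s-1)(n+a+c)(n+a+d)}{(2n+s-1)(2n+s)}$, $C_n=\frac{n(n+b+c-1)(n+b+d-1)}{(2n+s-2)(2n+s-1)}$; $c=\bar a$, $d=\bar b$, $\Re a>0$, $\Re b>0$. 4. Jacobi ($\alpha,\beta>-1$): $\alpha_n=\sqrt{\frac{4(n+1)(n+\alpha+1)(n+\beta+1)(n+\alpha+\beta+1)}{(2n+\alpha+\beta+1)(2n+\alpha+\beta+2)^2(2n+\alpha+\beta+3)}}$,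 $\beta_n=\frac{\beta^2-\alpha^2}{(2n+\alpha+\beta)(2n+\alpha+\beta+2)}$. 5. Meixner–Pollaczek ($\lambda>0$, $0<\phi<\pi$): $\alpha_n=\frac{\sqrt{(n+1)(n+2\lambda)}}{2\sin\phi}$, $\beta_n=-(n+\lambda)\cot\phi$. 6. Meixner ($\beta>0$, $0<c<1$): $\alpha_n=\frac{\sqrt{c(n+1)(n+\beta)}}{1-c}$, $\beta_n=\frac{n+(n+\beta)c}{1-c}$. 7. Laguerre ($\alpha>-1$): $\alpha_n=\sqrt{(n+1)(n+\alpha+1)}$, $\beta_n=2n+\alpha+1$. 8. Charlier ($a>0$): $\alpha_n=\sqrt{a(n+1)}$, $\beta_n=n+a$. 9. Hermite: $\alpha_n=\sqrt{(n+1)/2}$, $\beta_n=0$. **Theorem.** (i) Let $H$ be a Hankel matrix with square-summable columns and $\operatorname{rank}H>1$, and let $J$ be any Hermitian non-decomposable Jacobi matrix from the Askey scheme. If $HJ=JH$, then $H=\kappa\,\tilde{\mathcal H}_t$ for some $t>0$ and some scalar $\kappa$. (ii) Hence the generalized Hilbert matrix is the only infinite-rank Hankel matrix to which the commutator method with these Jacobi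 matrices applies: a matrix $H$ is a Hankel matrix of infinite rank with square-summable columns that commutes with some Jacobi matrix from the Askey scheme if and only if $UHU=\kappa\,\mathcal H_t$ for some $t>0$ and some scalar $\kappa\neq0$. -/

import Mathlib

noncomputable section

namespace AskeyHankel

/-! ### Semi-infinite matrices, indexed by `ℕ`, with complex entries -/

/-- The entrywise product `(A B)_{m,n} = ∑_k A_{m,k} B_{k,n}`. It is used only when one of the
factors is tridiagonal, and then only finitely many terms of each sum are nonzero. -/
def mul (A B : Matrix ℕ ℕ ℂ) : Matrix ℕ ℕ ℂ :=
  Matrix.of fun m n => ∑ᶠ k, A m k * B k n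

/-- A Hankel matrix: the entry at `(m, n)` depends only on `m + n`. -/
def IsHankel (H : Matrix ℕ ℕ ℂ) : Prop :=
  ∃ h : ℕ → ℂ, ∀ m n, H m n = h (m + n)

/-- All columns are square summable. -/
def HasL2Columns (H : Matrix ℕ ℕ ℂ) : Prop :=
  ∀ n, Summable fun m => ‖H m n‖ ^ 2

/-- The Jacobi matrix with diagonal `β` and off-diagonal `α`. -/
def jacobiMatrix (α β : ℕ → ℝ) : Matrix ℕ ℕ ℂ :=
  Matrix.of fun m n =>
    if m = n then (β n : ℂ)
    else if m = n + 1 then (α n : ℂ)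
    else if n = m + 1 then (α m : ℂ)
    else 0

/-- The generalized Hilbert matrix, with entries `1 / (m + n + t)`. -/
def hilbertMatrix (t : ℝ) : Matrix ℕ ℕ ℂ :=
  Matrix.of fun m n => 1 / ((m : ℂ) + n + t)

/-- The transformed Hilbert matrix, with entries `(-1) ^ (m + n) / (m + n + t)`. -/
def transformedHilbert (t : ℝ) : Matrix ℕ ℕ ℂ :=
  Matrix.of fun m n => (-1) ^ (m + n) / ((m : ℂ) + n + t)

/-- `U H U` for the unitary diagonal matrix `U = diag (1, -1, 1, -1, …)`. -/
def signConj (H : Matrix ℕ ℕ ℂ) : Matrix ℕ ℕ ℂ :=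
  Matrix.of fun m n => (-1) ^ m * H m n * (-1) ^ n

/-! ### The nine families

Where a factor of a numerator and of a denominator vanish together at `n = 0`, the value at `n = 0`
is the one obtained after cancelling the common factor, and `C₀ = 0`. -/

/-- The non-real members of the multiset occur in complex conjugate pairs. -/
def ConjPaired (s : Multiset ℂ) : Prop := s.map star = s

/-! #### Wilson -/

def wilsonA (a b c d : ℂ) : ℕ → ℂ
  | 0 => (a + b) * (a + c) * (a + d) / (a + b + c + d)
  | n@(_ + 1) =>
    (n + a + b) * (n + a + c) * (n + a + d) * (n + a + b + c + d - 1) /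
      ((2 * n + a + b + c + d - 1) * (2 * n + a + b + c + d))

def wilsonC (a b c d : ℂ) : ℕ → ℂ
  | 0 => 0
  | n@(_ + 1) =>
    n * (n + b + c - 1) * (n + b + d - 1) * (n + c + d - 1) /
      ((2 * n + a + b + c + d - 2) * (2 * n + a + b + c + d - 1))

/-- For admissible parameters the number under the real part is real and positive. -/
def wilsonα (a b c d : ℂ) (n : ℕ) : ℝ :=
  √(wilsonA a b c d n * wilsonC a b c d (n + 1)).re

/-- For admissible parameters the number under the real part is real. -/
def wilsonβ (a b c d : ℂ) (n : ℕ) : ℝ :=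
  (wilsonA a b c d n + wilsonC a b c d n - a ^ 2).re

/-- Non-real parameters come in conjugate pairs, and either all real parts are positive, or, up to
a permutation, `a` is real and nonpositive and `a + b`, `a + c`, `a + d` have positive real parts
(they are then positive, or one is positive and the other two are conjugate). -/
def WilsonAdmissible (a b c d : ℂ) : Prop :=
  ConjPaired {a, b, c, d} ∧
    ((0 < a.re ∧ 0 < b.re ∧ 0 < c.re ∧ 0 < d.re) ∨
      ∃ a' b' c' d' : ℂ, ({a', b', c', d'} : Multiset ℂ) = {a, b, c, d} ∧
        a'.im = 0 ∧ a'.re ≤ 0 ∧ 0 < (a' + b').re ∧ 0 < (a' + c').re ∧ 0 < (a' + d').re)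

/-! #### Continuous dual Hahn -/

def contDualHahnA (a b c : ℂ) (n : ℕ) : ℂ := (n + a + b) * (n + a + c)

def contDualHahnC (_a b c : ℂ) (n : ℕ) : ℂ := n * (n + b + c - 1)

/-- For admissible parameters the number under the real part is real and positive. -/
def contDualHahnα (a b c : ℂ) (n : ℕ) : ℝ :=
  √(contDualHahnA a b c n * contDualHahnC a b c (n + 1)).re

/-- For admissible parameters the number under the real part is real. -/
def contDualHahnβ (a b c : ℂ) (n : ℕ) : ℝ :=
  (contDualHahnA a b c n + contDualHahnC a b c n - a ^ 2).re

def ContDualHahnAdmissible (a b c : ℂ) : Prop :=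
  ConjPaired {a, b, c} ∧
    ((0 < a.re ∧ 0 < b.re ∧ 0 < c.re) ∨
      ∃ a' b' c' : ℂ, ({a', b', c'} : Multiset ℂ) = {a, b, c} ∧
        a'.im = 0 ∧ a'.re ≤ 0 ∧ 0 < (a' + b').re ∧ 0 < (a' + c').re)

/-! #### Continuous Hahn -/

def contHahnA (a b c d : ℂ) : ℕ → ℂ
  | 0 => -((a + c) * (a + d) / (a + b + c + d))
  | n@(_ + 1) =>
    -((n + a + b + c + d - 1) * (n + a + c) * (n + a + d) /
      ((2 * n + a + b + c + d - 1) * (2 * n + a + b + c + d)))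

def contHahnC (a b c d : ℂ) : ℕ → ℂ
  | 0 => 0
  | n@(_ + 1) =>
    n * (n + b + c - 1) * (n + b + d - 1) /
      ((2 * n + a + b + c + d - 2) * (2 * n + a + b + c + d - 1))

/-- For admissible parameters the number under the real part is real and positive. -/
def contHahnα (a b c d : ℂ) (n : ℕ) : ℝ :=
  √(-(contHahnA a b c d n * contHahnC a b c d (n + 1))).re

/-- For admissible parameters the number under the real part is real. -/
def contHahnβ (a b c d : ℂ) (n : ℕ) : ℝ :=
  (Complex.I * (contHahnA a b c d n + contHahnC a b c d n + a)).re

def ContHahnAdmissible (a b c d : ℂ) : Prop :=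
  c = star a ∧ d = star b ∧ 0 < a.re ∧ 0 < b.re

/-! #### Jacobi -/

def jacobiα (p q : ℝ) : ℕ → ℝ
  | 0 => √(4 * (p + 1) * (q + 1) / ((p + q + 2) ^ 2 * (p + q + 3)))
  | n@(_ + 1) =>
    √(4 * (n + 1) * (n + p + 1) * (n + q + 1) * (n + p + q + 1) /
      ((2 * n + p + q + 1) * (2 * n + p + q + 2) ^ 2 * (2 * n + p + q + 3)))

def jacobiβ (p q : ℝ) : ℕ → ℝ
  | 0 => (q - p) / (p + q + 2)
  | n@(_ + 1) => (q ^ 2 - p ^ 2) / ((2 * n + p + q) * (2 * n + p + q + 2))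

/-! #### Meixner–Pollaczek, Meixner, Laguerre, Charlier, Hermite -/

def meixnerPollaczekα (l φ : ℝ) (n : ℕ) : ℝ := √((n + 1) * (n + 2 * l)) / (2 * Real.sin φ)

def meixnerPollaczekβ (l φ : ℝ) (n : ℕ) : ℝ := -((n + l) * Real.cos φ / Real.sin φ)

def meixnerα (c b : ℝ) (n : ℕ) : ℝ := √(c * (n + 1) * (n + b)) / (1 - c)

def meixnerβ (c b : ℝ) (n : ℕ) : ℝ := (n + (n + b) * c) / (1 - c)

def laguerreα (p : ℝ) (n : ℕ) : ℝ := √((n + 1) * (n + p + 1))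

def laguerreβ (p : ℝ) (n : ℕ) : ℝ := 2 * n + p + 1

def charlierα (a : ℝ) (n : ℕ) : ℝ := √(a * (n + 1))

def charlierβ (a : ℝ) (n : ℕ) : ℝ := n + a

def hermiteα (n : ℕ) : ℝ := √((n + 1) / 2)

def hermiteβ (_n : ℕ) : ℝ := 0

/-- The Hermitian non-decomposable Jacobi matrices from the Askey scheme. -/
inductive IsAskeyJacobi : Matrix ℕ ℕ ℂ → Prop
  | wilson (a b c d : ℂ) (h : WilsonAdmissible a b c d) :
      IsAskeyJacobi (jacobiMatrix (wilsonα a b c d) (wilsonβ a b c d))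
  | contDualHahn (a b c : ℂ) (h : ContDualHahnAdmissible a b c) :
      IsAskeyJacobi (jacobiMatrix (contDualHahnα a b c) (contDualHahnβ a b c))
  | contHahn (a b c d : ℂ) (h : ContHahnAdmissible a b c d) :
      IsAskeyJacobi (jacobiMatrix (contHahnα a b c d) (contHahnβ a b c d))
  | jacobi (p q : ℝ) (hp : -1 < p) (hq : -1 < q) :
      IsAskeyJacobi (jacobiMatrix (jacobiα p q) (jacobiβ p q))
  | meixnerPollaczek (l φ : ℝ) (hl : 0 < l) (h0 : 0 < φ) (hπ : φ < Real.pi) :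
      IsAskeyJacobi (jacobiMatrix (meixnerPollaczekα l φ) (meixnerPollaczekβ l φ))
  | meixner (c b : ℝ) (h0 : 0 < c) (h1 : c < 1) (hb : 0 < b) :
      IsAskeyJacobi (jacobiMatrix (meixnerα c b) (meixnerβ c b))
  | laguerre (p : ℝ) (hp : -1 < p) :
      IsAskeyJacobi (jacobiMatrix (laguerreα p) (laguerreβ p))
  | charlier (a : ℝ) (ha : 0 < a) :
      IsAskeyJacobi (jacobiMatrix (charlierα a) (charlierβ a))
  | hermite : IsAskeyJacobi (jacobiMatrix hermiteα hermiteβ)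

end AskeyHankel

end

noncomputable section

namespace AskeyHankel

open Filter Topology Polynomial

/-! ### The commutation relation, entry by entry -/

/-! Both `H` and `J` are symmetric, so `HJ = JH` says that `HJ` is symmetric. This is a family of
linear relations (`HankelRows`): for all m, n the differences of α and β between the indices n and m
annihilate the vector (h_N, h_{N+1}, h_{N+2}) with N = m + n + 1. Normalise these vectors and let N
→ ∞ along a subsequence on which they converge, to (x, y, z) ≠ 0. The sequences α and β of the
scheme have convergent second differences, so a second difference along the antidiagonal m + n = N −
1 loses its dependence on n in the limit. What remains says that x α_m + y β_{m+1} + z α_{m+1} is a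
quadratic polynomial in m (`HankelRows.exists_relation`). Comparing growth, and dropping the β term
when β is constant from n = 1 on, rules out x = z = 0. Since β is rational and α is the square root
of a rational function R, solving the relation for the root shows that α is itself rational. Hence R
is a square (`isSquare_of_relation`), and its zeros and poles, listed together before cancellation,
have even multiplicities (`HankelRows.exists_half`).

The theorem thus becomes a finite question about parameters. For Wilson, continuous Hahn and Jacobi
the list of zeros and poles is symmetric about a centre, and parity is read off the squared
distances to it (`even_count_sq`). Charlier and Hermite have a single simple zero and are excluded.
Jacobi leaves α and β constant for n ≥ 1, where h is geometric. Meixner–Pollaczek, Meixner and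
Laguerre leave α_n = γ(n + 1) with β affine: h obeys a recurrence whose two characteristic roots
have product 1, and decay then makes the rank at most one. Continuous Hahn leaves α affine and β
constant, whence h_{k+2} = −h_k eventually and h = 0. For Wilson and continuous dual Hahn, α and β
become quadratic polynomials, and the relations say that (−1)^k (k + t) h_k has vanishing second
difference; it is affine, and decay of h makes it constant (`exists_alternating`,
`HankelRows.exists_of_quadratic`).

Conversely, the continuous dual Hahn matrix with parameters 1/2, 1/2, t − 1/2 commutes with the
transformed Hilbert matrix (`hankelRows_contDualHahn`), whose columns are independent by a Cauchy
matrix argument (`linearIndependent_col_transformedHilbert`). -/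

/-- The entries of `HJ = JH` for the Hankel matrix of `h` and the Jacobi matrix of `α`, `β`. -/
structure HankelRows (α β : ℕ → ℝ) (h : ℕ → ℂ) : Prop where
  row_zero : ∀ n, (α n : ℂ) * h n + ((β (n + 1) : ℂ) - β 0) * h (n + 1) +
    ((α (n + 1) : ℂ) - α 0) * h (n + 2) = 0
  row_succ : ∀ m n, ((α n : ℂ) - α m) * h (m + n + 1) +
    ((β (n + 1) : ℂ) - β (m + 1)) * h (m + n + 2) +
    ((α (n + 1) : ℂ) - α (m + 1)) * h (m + n + 3) = 0

lemma mul_jacobiMatrix_zero (H : Matrix ℕ ℕ ℂ) (α β : ℕ → ℝ) (m : ℕ) :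
    mul H (jacobiMatrix α β) m 0 = H m 0 * β 0 + H m 1 * α 0 := by
  simp only [mul, Matrix.of_apply]
  rw [finsum_eq_sum_of_support_subset (s := Finset.range 2)]
  · simp [Finset.sum_range_succ, jacobiMatrix]
  · intro k hk
    rw [Function.mem_support] at hk
    by_contra hc
    simp only [Finset.coe_range, Set.mem_Iio, not_lt] at hc
    apply hk
    simp [jacobiMatrix, show k ≠ 0 by omega, show k ≠ 1 by omega]

lemma mul_jacobiMatrix_succ (H : Matrix ℕ ℕ ℂ) (α β : ℕ → ℝ) (m n : ℕ) :
    mul H (jacobiMatrix α β) m (n + 1) =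
      H m n * α n + H m (n + 1) * β (n + 1) + H m (n + 2) * α (n + 1) := by
  simp only [mul, Matrix.of_apply]
  rw [finsum_eq_sum_of_support_subset (s := {n, n + 1, n + 2})]
  · rw [Finset.sum_insert (by simp), Finset.sum_insert (by simp), Finset.sum_singleton]
    simp [jacobiMatrix, show n ≠ n + 2 by omega]
    ring
  · intro k hk
    rw [Function.mem_support] at hk
    by_contra hc
    simp only [Finset.coe_insert, Finset.coe_singleton, Set.mem_insert_iff,
      Set.mem_singleton_iff, not_or] at hc
    apply hk
    simp [jacobiMatrix, show k ≠ n + 1 by omega, show k ≠ n + 2 by omega, show n ≠ k by omega]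

lemma jacobiMatrix_comm (α β : ℕ → ℝ) (m n : ℕ) :
    jacobiMatrix α β m n = jacobiMatrix α β n m := by
  simp only [jacobiMatrix, Matrix.of_apply]
  split_ifs <;> first | omega | simp_all

lemma jacobiMatrix_mul_eq {H : Matrix ℕ ℕ ℂ} {h : ℕ → ℂ} (hH : ∀ m n, H m n = h (m + n))
    (α β : ℕ → ℝ) (m n : ℕ) :
    mul (jacobiMatrix α β) H m n = mul H (jacobiMatrix α β) n m := by
  simp only [mul, Matrix.of_apply]
  refine finsum_congr fun k => ?_
  rw [jacobiMatrix_comm α β m k, hH, hH, add_comm k n, mul_comm]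

/-- By symmetry `JH` is the transpose of `HJ`, so only the entries (m, n) and (n, m) of `HJ` are
compared. Index 0 gives a separate family because column 0 of `J` has only two nonzero entries. -/
theorem mul_comm_iff_hankelRows {H : Matrix ℕ ℕ ℂ} {h : ℕ → ℂ} (hH : ∀ m n, H m n = h (m + n))
    (α β : ℕ → ℝ) :
    mul H (jacobiMatrix α β) = mul (jacobiMatrix α β) H ↔ HankelRows α β h := by
  have key : mul H (jacobiMatrix α β) = mul (jacobiMatrix α β) H ↔
      ∀ m n, mul H (jacobiMatrix α β) m n = mul H (jacobiMatrix α β) n m := by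
    rw [← Matrix.ext_iff]
    simp only [jacobiMatrix_mul_eq hH]
  rw [key]
  constructor
  · intro hc
    constructor
    · intro n
      have := hc 0 (n + 1)
      rw [mul_jacobiMatrix_zero, mul_jacobiMatrix_succ] at this
      simp only [hH] at this
      ring_nf at this ⊢
      linear_combination this
    · intro m n
      have := hc (m + 1) (n + 1)
      rw [mul_jacobiMatrix_succ, mul_jacobiMatrix_succ] at this
      simp only [hH] at this
      ring_nf at this ⊢
      linear_combination this
  · rintro ⟨h0, h1⟩ m n
    rcases m with _ | m <;> rcases n with _ | n
    · rfl
    · have := h0 n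
      rw [mul_jacobiMatrix_zero, mul_jacobiMatrix_succ]
      simp only [hH]
      ring_nf at this ⊢
      linear_combination this
    · have := h0 m
      rw [mul_jacobiMatrix_zero, mul_jacobiMatrix_succ]
      simp only [hH]
      ring_nf at this ⊢
      linear_combination -this
    · have := h1 m n
      rw [mul_jacobiMatrix_succ, mul_jacobiMatrix_succ]
      simp only [hH]
      ring_nf at this ⊢
      linear_combination this

lemma tendsto_zero_of_hasL2Columns {H : Matrix ℕ ℕ ℂ} {h : ℕ → ℂ}
    (hH : ∀ m n, H m n = h (m + n)) (hL : HasL2Columns H) : Tendsto h atTop (𝓝 0) := by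
  have h1 := (hL 0).tendsto_atTop_zero
  simp only [hH, add_zero] at h1
  rw [tendsto_zero_iff_norm_tendsto_zero]
  have h2 := h1.sqrt
  simpa using h2

/-! ### Rank -/

/-- The Hankel matrix of a geometric sequence has rank at most one. -/
lemma eRank_le_one_of_geometric {H : Matrix ℕ ℕ ℂ} {h : ℕ → ℂ}
    (hH : ∀ m n, H m n = h (m + n)) {r : ℂ} (hr : ∀ k, h (k + 1) = r * h k) : H.eRank ≤ 1 := by
  have hpow : ∀ n m, h (m + n) = r ^ n * h m := by
    intro n
    induction n with
    | zero => simp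
    | succ n ih => intro m; rw [← add_assoc, hr, ih]; ring
  have hsub : Submodule.span ℂ (Set.range H.col) ≤ Submodule.span ℂ {h} := by
    rw [Submodule.span_le]
    rintro _ ⟨n, rfl⟩
    rw [SetLike.mem_coe, Submodule.mem_span_singleton]
    refine ⟨r ^ n, ?_⟩
    ext m
    simp [hH, hpow]
  have h1 : H.cRank ≤ 1 := by
    rw [Matrix.cRank]
    refine (Submodule.rank_mono hsub).trans ?_
    exact (rank_span_le _).trans (by simp)
  simpa [Matrix.eRank] using OrderHom.mono (β := ℕ∞) Cardinal.toENat h1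

lemma eRank_le_one_of_eq_zero {H : Matrix ℕ ℕ ℂ} {h : ℕ → ℂ}
    (hH : ∀ m n, H m n = h (m + n)) (h0 : ∀ k, h k = 0) : H.eRank ≤ 1 :=
  eRank_le_one_of_geometric hH (r := 0) (by simp [h0])

/-- A Hankel matrix whose sequence tends to zero and satisfies `h_{k+2} + b h_{k+1} + h_k = 0`
has rank at most one, because the two roots of the recurrence have product one. -/
lemma eRank_le_one_of_recurrence {H : Matrix ℕ ℕ ℂ} {h : ℕ → ℂ}
    (hH : ∀ m n, H m n = h (m + n)) (hlim : Tendsto h atTop (𝓝 0)) {b : ℂ}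
    (hb : ∀ k, h k + b * h (k + 1) + h (k + 2) = 0) : H.eRank ≤ 1 := by
  -- This Casorati-type determinant is multiplied at each step by the product of the characteristic
  -- roots, which is 1. Being constant and tending to zero, it vanishes, and h is geometric.
  have hconst : ∀ k, h k * h (k + 2) - h (k + 1) ^ 2 = h 0 * h 2 - h 1 ^ 2 := by
    intro k
    induction k with
    | zero => rfl
    | succ k ih =>
      rw [← ih]
      have e1 := hb k
      have e2 := hb (k + 1)
      linear_combination h (k + 1) * e2 - h (k + 2) * e1
  have hdet : ∀ k, h k * h (k + 2) = h (k + 1) ^ 2 := by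
    have hl : Tendsto (fun k => h k * h (k + 2) - h (k + 1) ^ 2) atTop (𝓝 0) := by
      have h1 := (tendsto_add_atTop_iff_nat 1).2 hlim
      have h2 := (tendsto_add_atTop_iff_nat 2).2 hlim
      simpa using (hlim.mul h2).sub (h1.pow 2)
    have h0 : h 0 * h 2 - h 1 ^ 2 = 0 := by
      refine tendsto_nhds_unique ?_ hl
      simp only [hconst]
      exact tendsto_const_nhds
    intro k
    exact sub_eq_zero.1 ((hconst k).trans h0)
  by_cases hz : h 0 = 0
  · have h1 : h 1 = 0 := by
      have := hdet 0
      simpa [hz] using this.symm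
    have : ∀ k, h k = 0 ∧ h (k + 1) = 0 := by
      intro k
      induction k with
      | zero => exact ⟨hz, h1⟩
      | succ k ih =>
        refine ⟨ih.2, ?_⟩
        have := hb k
        simpa [ih.1, ih.2] using this
    exact eRank_le_one_of_eq_zero hH fun k => (this k).1
  · refine eRank_le_one_of_geometric hH (r := h 1 / h 0) fun k => ?_
    induction k with
    | zero => field_simp
    | succ k ih =>
      by_cases hk : h k = 0
      · have h1 : h (k + 1) = 0 := by rw [ih, hk, mul_zero]
        have := hb k
        rw [hk, h1] at this
        rw [h1, mul_zero]
        simpa using this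
      · apply mul_left_cancel₀ hk
        rw [show k + 1 + 1 = k + 2 from rfl, hdet, sq]
        nth_rewrite 1 [ih]
        ring

/-! ### Zeros of `h` -/

namespace HankelRows

variable {α β : ℕ → ℝ} {h : ℕ → ℂ}

/-- The relation `row_zero` has leading coefficient α_n ≠ 0, so two consecutive zeros propagate
downwards. -/
lemma eq_zero_of_two_zeros (hr : HankelRows α β h) (hα : ∀ n, α n ≠ 0) {N : ℕ}
    (h0 : h N = 0) (h1 : h (N + 1) = 0) : ∀ k ≤ N + 1, h k = 0 := by
  induction N with
  | zero =>
    intro k hk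
    interval_cases k <;> assumption
  | succ N ih =>
    have hN : h N = 0 := by
      have := hr.row_zero N
      rw [show N + 2 = N + 1 + 1 from rfl, h0, h1] at this
      simpa [hα N] using this
    intro k hk
    rcases Nat.lt_or_ge k (N + 2) with hlt | hge
    · exact ih hN h0 k (by omega)
    · rwa [show k = N + 1 + 1 by omega]

lemma eq_zero_of_eventually (hr : HankelRows α β h) (hα : ∀ n, α n ≠ 0) {N : ℕ}
    (hN : ∀ k ≥ N, h k = 0) : ∀ k, h k = 0 := by
  intro k
  exact hr.eq_zero_of_two_zeros hα (hN (N + k) (by omega)) (hN (N + k + 1) (by omega)) k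
    (by omega)

end HankelRows

/-! ### A linear relation with polynomial right-hand side -/

/-- The second forward difference. -/
def secondDiff (f : ℕ → ℂ) (n : ℕ) : ℂ := f (n + 2) - 2 * f (n + 1) + f n

lemma eq_affine_of_secondDiff_eq_zero {f : ℕ → ℂ} {k₀ : ℕ} (hf : ∀ n ≥ k₀, secondDiff f n = 0) :
    ∀ n ≥ k₀, f n = f k₀ + (n - k₀) * (f (k₀ + 1) - f k₀) := by
  have key : ∀ j, f (k₀ + j) = f k₀ + j * (f (k₀ + 1) - f k₀) ∧
      f (k₀ + j + 1) = f k₀ + (j + 1) * (f (k₀ + 1) - f k₀) := by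
    intro j
    induction j with
    | zero => simp
    | succ j ih =>
      have := hf (k₀ + j) (by omega)
      rw [secondDiff] at this
      refine ⟨by rw [← add_assoc, ih.2]; push_cast; ring, ?_⟩
      rw [show k₀ + (j + 1) + 1 = k₀ + j + 2 by ring]
      push_cast
      linear_combination this + 2 * ih.2 - ih.1
  intro n hn
  obtain ⟨j, rfl⟩ := Nat.exists_eq_add_of_le hn
  rw [(key j).1]
  push_cast
  ring

/-- Compactness of the unit sphere. The vectors may decay at an uncontrolled rate and turn in
direction, so only a rescaled subsequence converges; a nonzero limit is all that is needed. -/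
lemma exists_normalized_limit {v : ℕ → ℂ × ℂ × ℂ} (hv : ∃ᶠ N in atTop, v N ≠ 0) :
    ∃ (φ : ℕ → ℕ) (c : ℕ → ℂ) (u : ℂ × ℂ × ℂ), Tendsto φ atTop atTop ∧ u ≠ 0 ∧
      Tendsto (fun k => c k • v (φ k)) atTop (𝓝 u) := by
  obtain ⟨φ, hφ, hne⟩ := extraction_of_frequently_atTop hv
  have hmem : ∀ k, (((‖v (φ k)‖⁻¹ : ℝ) : ℂ) • v (φ k)) ∈ Metric.sphere (0 : ℂ × ℂ × ℂ) 1 := by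
    intro k
    rw [mem_sphere_zero_iff_norm, norm_smul]
    have : ‖v (φ k)‖ ≠ 0 := norm_ne_zero_iff.2 (hne k)
    simp [this]
  obtain ⟨u, hu, ψ, hψ, hlim⟩ := (isCompact_sphere (0 : ℂ × ℂ × ℂ) 1).tendsto_subseq hmem
  refine ⟨φ ∘ ψ, fun k => ((‖v (φ (ψ k))‖⁻¹ : ℝ) : ℂ), u, (hφ.comp hψ).tendsto_atTop, ?_, hlim⟩
  rintro rfl
  simp at hu

/-- Second differences of the relations in the row index survive in the limit. -/
lemma exists_relation_of_rows {a b : ℕ → ℂ} {A B : ℂ} (ha : Tendsto (secondDiff a) atTop (𝓝 A))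
    (hb : Tendsto (secondDiff b) atTop (𝓝 B)) {v : ℕ → ℂ × ℂ × ℂ} {φ : ℕ → ℕ} {c : ℕ → ℂ}
    {u : ℂ × ℂ × ℂ} (hφ : Tendsto φ atTop atTop)
    (hu : Tendsto (fun k => c k • v (φ k)) atTop (𝓝 u))
    (hrow : ∀ m n, (a n - a m) * (v (m + n + 1)).1 + (b (n + 1) - b (m + 1)) * (v (m + n + 1)).2.1 +
      (a (n + 1) - a (m + 1)) * (v (m + n + 1)).2.2 = 0) :
    ∃ q₂ q₁ q₀ : ℂ, ∀ m : ℕ, u.1 * a m + u.2.1 * b (m + 1) + u.2.2 * a (m + 1) =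
      q₂ * m ^ 2 + q₁ * m + q₀ := by
  have h1 : Tendsto (fun k => c k * (v (φ k)).1) atTop (𝓝 u.1) :=
    (continuous_fst.tendsto _).comp hu
  have h2 : Tendsto (fun k => c k * (v (φ k)).2.1) atTop (𝓝 u.2.1) :=
    ((continuous_fst.comp continuous_snd).tendsto _).comp hu
  have h3 : Tendsto (fun k => c k * (v (φ k)).2.2) atTop (𝓝 u.2.2) :=
    ((continuous_snd.comp continuous_snd).tendsto _).comp hu
  have hlim : ∀ m, u.1 * secondDiff a m + u.2.1 * secondDiff b (m + 1) +
      u.2.2 * secondDiff a (m + 1) = u.1 * A + u.2.1 * B + u.2.2 * A := by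
    intro m
    have hn : Tendsto (fun k => φ k - (m + 3)) atTop atTop :=
      (tendsto_sub_atTop_nat (m + 3)).comp hφ
    have hn1 : Tendsto (fun k => φ k - (m + 3) + 1) atTop atTop :=
      (tendsto_add_atTop_nat 1).comp hn
    have ht := ((h1.mul ((ha.comp hn).sub_const (secondDiff a m))).add
      (h2.mul ((hb.comp hn1).sub_const (secondDiff b (m + 1))))).add
      (h3.mul ((ha.comp hn1).sub_const (secondDiff a (m + 1))))
    have hz := tendsto_nhds_unique (ht.congr' (f₂ := fun _ => (0 : ℂ)) ?_) tendsto_const_nhds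
    · linear_combination -hz
    · filter_upwards [hφ.eventually_ge_atTop (m + 3)] with k hk
      obtain ⟨n, hn⟩ := Nat.exists_eq_add_of_le hk
      -- The three rows have the same index sum, hence the same vector v. The combination 1, −2, 1
      -- produces the second difference at n minus the one at m.
      have e0 := hrow m (n + 2)
      have e1 := hrow (m + 1) (n + 1)
      have e2 := hrow (m + 2) n
      rw [show m + (n + 2) + 1 = φ k by omega] at e0
      rw [show m + 1 + (n + 1) + 1 = φ k by omega] at e1
      rw [show m + 2 + n + 1 = φ k by omega] at e2
      simp only [Function.comp, secondDiff, show φ k - (m + 3) = n by omega]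
      linear_combination c k * e0 - 2 * c k * e1 + c k * e2
  -- The sequence E m² / 2 has constant second difference E, so subtracting it leaves an affine
  -- sequence.
  set E : ℂ := u.1 * A + u.2.1 * B + u.2.2 * A
  have haff := eq_affine_of_secondDiff_eq_zero (k₀ := 0)
    (f := fun m : ℕ => u.1 * a m + u.2.1 * b (m + 1) + u.2.2 * a (m + 1) - E / 2 * m ^ 2) (by
      intro m _
      have := hlim m
      simp only [secondDiff] at this ⊢
      push_cast
      linear_combination this)
  simp only [Nat.cast_zero, sub_zero] at haff
  generalize (u.1 * a (0 + 1) + u.2.1 * b (0 + 1 + 1) + u.2.2 * a (0 + 1 + 1) -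
    E / 2 * ((0 + 1 : ℕ) : ℂ) ^ 2 -
    (u.1 * a 0 + u.2.1 * b (0 + 1) + u.2.2 * a (0 + 1) - E / 2 * 0 ^ 2)) = d at haff
  refine ⟨E / 2, d, u.1 * a 0 + u.2.1 * b (0 + 1) + u.2.2 * a (0 + 1) - E / 2 * 0 ^ 2,
    fun m => ?_⟩
  linear_combination haff m (Nat.zero_le m)

/-- The leading growth of the relations survives in the limit. -/
lemma leading_relation_of_rows {a b g : ℕ → ℂ} {l b₀ : ℂ}
    (hg : Tendsto (fun n => (g n)⁻¹) atTop (𝓝 0))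
    (ha : Tendsto (fun n => (g n)⁻¹ * a n) atTop (𝓝 l))
    (ha' : Tendsto (fun n => (g n)⁻¹ * a (n + 1)) atTop (𝓝 l))
    (hb : Tendsto (fun n => (g n)⁻¹ * b (n + 1)) atTop (𝓝 b₀))
    {v : ℕ → ℂ × ℂ × ℂ} {φ : ℕ → ℕ} {c : ℕ → ℂ}
    {u : ℂ × ℂ × ℂ} (hφ : Tendsto φ atTop atTop)
    (hu : Tendsto (fun k => c k • v (φ k)) atTop (𝓝 u))
    (hrow : ∀ m n, (a n - a m) * (v (m + n + 1)).1 + (b (n + 1) - b (m + 1)) * (v (m + n + 1)).2.1 +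
      (a (n + 1) - a (m + 1)) * (v (m + n + 1)).2.2 = 0) :
    l * u.1 + b₀ * u.2.1 + l * u.2.2 = 0 := by
  have h1 : Tendsto (fun k => c k * (v (φ k)).1) atTop (𝓝 u.1) :=
    (continuous_fst.tendsto _).comp hu
  have h2 : Tendsto (fun k => c k * (v (φ k)).2.1) atTop (𝓝 u.2.1) :=
    ((continuous_fst.comp continuous_snd).tendsto _).comp hu
  have h3 : Tendsto (fun k => c k * (v (φ k)).2.2) atTop (𝓝 u.2.2) :=
    ((continuous_snd.comp continuous_snd).tendsto _).comp hu
  have hn : Tendsto (fun k => φ k - 1) atTop atTop := (tendsto_sub_atTop_nat 1).comp hφ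
  have hgn := hg.comp hn
  have ht := ((h1.mul ((ha.comp hn).sub (hgn.mul_const (a 0)))).add
      (h2.mul ((hb.comp hn).sub (hgn.mul_const (b 1))))).add
      (h3.mul ((ha'.comp hn).sub (hgn.mul_const (a 1))))
  have hz := tendsto_nhds_unique (ht.congr' (f₂ := fun _ => (0 : ℂ)) ?_) tendsto_const_nhds
  · linear_combination hz
  · filter_upwards [hφ.eventually_ge_atTop 1] with k hk
    obtain ⟨n, hn⟩ := Nat.exists_eq_add_of_le hk
    -- Row 0 suffices: after division by g the fixed terms at index 0 disappear and only the leading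
    -- coefficients remain.
    have e0 := hrow 0 n
    rw [show 0 + n + 1 = φ k by omega] at e0
    simp only [Function.comp, show φ k - 1 = n by omega]
    linear_combination c k * (g n)⁻¹ * e0

/-! ### Squares -/

lemma eq_of_eval_natCast_eq {P Q : ℂ[X]} (n₀ : ℕ)
    (h : ∀ n : ℕ, n₀ ≤ n → P.eval (n : ℂ) = Q.eval (n : ℂ)) : P = Q := by
  refine Polynomial.eq_of_infinite_eval_eq P Q ?_
  refine ((Set.Ici_infinite n₀).image (Nat.cast_injective (R := ℂ)).injOn).mono ?_
  rintro _ ⟨n, hn, rfl⟩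
  exact h n hn

/-- Here U² divides (QT)², so U divides QT by unique factorisation, and PQ is the square of the
quotient. -/
lemma isSquare_mul_of_mul_sq_eq {P Q U T : ℂ[X]} (hU : U ≠ 0) (h : P * U ^ 2 = Q * T ^ 2) :
    IsSquare (P * Q) := by
  have h1 : U ^ 2 ∣ (Q * T) ^ 2 := ⟨P * Q, by linear_combination -Q * h⟩
  obtain ⟨g, hg⟩ := (UniqueFactorizationMonoid.pow_dvd_pow_iff_dvd two_ne_zero).1 h1
  refine ⟨g, mul_right_cancel₀ (pow_ne_zero 2 hU) ?_⟩
  linear_combination Q * h + (Q * T + U * g) * hg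

/-- If a² = P/Q and a = T/U at all large integers, then PU² = QT² there, hence as polynomials. -/
lemma isSquare_of_eval_eq {a : ℕ → ℂ} {P Q T U : ℂ[X]} (n₀ : ℕ) (hU : U ≠ 0)
    (ha : ∀ n : ℕ, n₀ ≤ n → a n ^ 2 * Q.eval (n : ℂ) = P.eval (n : ℂ))
    (haT : ∀ n : ℕ, n₀ ≤ n → a n * U.eval (n : ℂ) = T.eval (n : ℂ)) : IsSquare (P * Q) := by
  refine isSquare_mul_of_mul_sq_eq (U := U) (T := T) hU (eq_of_eval_natCast_eq n₀ fun n hn => ?_)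
  simp only [eval_mul, eval_pow]
  rw [← ha n hn, ← haT n hn]
  ring

/-- If `x √R(m) + z √R(m+1)` is a rational function of `m`, then `R = P / Q` is a square. -/
theorem isSquare_of_relation {a : ℕ → ℂ} {P Q V W : ℂ[X]} {x z : ℂ} (hP : P ≠ 0) (hQ : Q ≠ 0)
    (hW : W ≠ 0) (hxz : x ≠ 0 ∨ z ≠ 0)
    (ha : ∀ n : ℕ, 1 ≤ n → a n ^ 2 * Q.eval (n : ℂ) = P.eval (n : ℂ))
    (hQn : ∀ n : ℕ, 1 ≤ n → Q.eval (n : ℂ) ≠ 0)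
    (hrel : ∀ n : ℕ, 1 ≤ n →
      (x * a n + z * a (n + 1)) * W.eval (n : ℂ) = V.eval (n : ℂ)) : IsSquare (P * Q) := by
  have ha1 : ∀ n : ℕ, 1 ≤ n →
      a (n + 1) ^ 2 * (taylor 1 Q).eval (n : ℂ) = (taylor 1 P).eval (n : ℂ) := by
    intro n hn
    have := ha (n + 1) (by omega)
    simp only [taylor_eval]
    exact_mod_cast this
  by_cases hx : x = 0
  · subst hx
    have hz : z ≠ 0 := by simpa using hxz
    -- The relation involves only a(n + 1), so it is shifted back by one; this is why the start is
    -- 2.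
    refine isSquare_of_eval_eq (a := a) (U := C z * taylor (-1) W) (T := taylor (-1) V) 2 ?_
      (fun n hn => ha n (by omega)) fun n hn => ?_
    · refine mul_ne_zero (by simpa using hz) ?_
      rw [← leadingCoeff_ne_zero, leadingCoeff_taylor, leadingCoeff_ne_zero]
      exact hW
    · obtain ⟨k, rfl⟩ := Nat.exists_eq_add_of_le hn
      have := hrel (k + 1) (by omega)
      simp only [taylor_eval, eval_mul, eval_C]
      rw [show ((2 + k : ℕ) : ℂ) + -1 = ((k + 1 : ℕ) : ℂ) by push_cast; ring, ← this,
        show 2 + k = k + 1 + 1 by ring]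
      ring
  by_cases hV : V = 0
  -- In the degenerate case V = 0 the relation is x² R(n) = z² R(n + 1). Leading coefficients force
  -- x² = z², so R is 1-periodic on the integers and therefore constant.
  · have hWn : ∀ᶠ n : ℕ in atTop, W.eval (n : ℂ) ≠ 0 := by
      have hfin : {n : ℕ | W.eval (n : ℂ) = 0}.Finite := by
        refine Set.Finite.of_finite_image (f := fun n : ℕ => (n : ℂ)) ?_
          (Nat.cast_injective (R := ℂ)).injOn
        refine (W.rootSet_finite ℂ).subset ?_
        rintro _ ⟨n, hn, rfl⟩
        simpa [mem_rootSet, hW] using hn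
      rw [← Nat.cofinite_eq_atTop]
      exact hfin.eventually_cofinite_notMem
    obtain ⟨n₁, hn₁⟩ := eventually_atTop.1 hWn
    have hlin : ∀ n : ℕ, n₁ + 1 ≤ n → x * a n = - (z * a (n + 1)) := by
      intro n hn
      have := hrel n (by omega)
      rw [hV, eval_zero] at this
      rcases mul_eq_zero.1 this with h | h
      · linear_combination h
      · exact absurd h (hn₁ n (by omega))
    have hpoly : C (x ^ 2) * P * taylor 1 Q = C (z ^ 2) * taylor 1 P * Q := by
      refine eq_of_eval_natCast_eq (n₁ + 1) fun n hn => ?_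
      simp only [eval_mul, eval_C]
      rw [← ha n (by omega), ← ha1 n (by omega)]
      have := hlin n hn
      linear_combination (x * a n - z * a (n + 1)) * eval (n : ℂ) Q * eval (n : ℂ) (taylor 1 Q) * this
    have hsq : x ^ 2 = z ^ 2 := by
      have := congrArg leadingCoeff hpoly
      simp only [leadingCoeff_mul, leadingCoeff_C, leadingCoeff_taylor] at this
      have hne : P.leadingCoeff * Q.leadingCoeff ≠ 0 :=
        mul_ne_zero (leadingCoeff_ne_zero.2 hP) (leadingCoeff_ne_zero.2 hQ)
      apply mul_right_cancel₀ hne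
      linear_combination this
    have hpoly' : P * taylor 1 Q = taylor 1 P * Q := by
      rw [← hsq, mul_assoc, mul_assoc] at hpoly
      exact mul_left_cancel₀ (by simpa using hx) hpoly
    have hconst : ∀ n : ℕ, 1 ≤ n → a n ^ 2 = a 1 ^ 2 := by
      intro n hn
      induction n, hn using Nat.le_induction with
      | base => rfl
      | succ n hn ih =>
        rw [← ih]
        have h1 := congrArg (eval (n : ℂ)) hpoly'
        simp only [eval_mul] at h1
        rw [← ha n hn, ← ha1 n hn] at h1
        have q1 := hQn n hn
        have q2 : eval (n : ℂ) (taylor 1 Q) ≠ 0 := by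
          have := hQn (n + 1) (by omega)
          simp only [taylor_eval]
          exact_mod_cast this
        apply mul_right_cancel₀ (mul_ne_zero q1 q2)
        linear_combination -h1
    have hPQ : P = C (a 1 ^ 2) * Q := by
      refine eq_of_eval_natCast_eq 1 fun n hn => ?_
      rw [eval_mul, eval_C, ← ha n hn, hconst n hn]
    refine ⟨C (a 1) * Q, ?_⟩
    rw [hPQ, C_pow]
    ring
  · have hQ1 : taylor 1 Q ≠ 0 := by
      rwa [← leadingCoeff_ne_zero, leadingCoeff_taylor, leadingCoeff_ne_zero]
    -- Isolating z a(n + 1) and squaring gives 2x V W a(n) = V² + x² W² R(n) − z² W² R(n + 1), which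
    -- exhibits a(n) as rational. The factors Q and its shift clear the denominators of R.
    refine isSquare_of_eval_eq (a := a) (U := C (2 * x) * V * W * Q * taylor 1 Q)
      (T := V ^ 2 * Q * taylor 1 Q + C (x ^ 2) * W ^ 2 * P * taylor 1 Q -
        C (z ^ 2) * W ^ 2 * taylor 1 P * Q) 1 ?_ ha fun n hn => ?_
    · have : C (2 * x) ≠ 0 := by simpa using hx
      exact mul_ne_zero (mul_ne_zero (mul_ne_zero (mul_ne_zero this hV) hW) hQ) hQ1
    · simp only [eval_mul, eval_add, eval_sub, eval_pow, eval_C]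
      rw [← hrel n hn, ← ha n hn, ← ha1 n hn]
      ring

/-- A relation `y (c₂ n² + c₁ n + c₀ + K / ((2n+s)(2n+s+2))) = quadratic` forces `y K = 0`. -/
lemma eq_zero_of_inv_eq_quadratic {κ s q₂ q₁ q₀ : ℂ}
    (hs : ∀ n : ℕ, 1 ≤ n → (2 * (n : ℂ) + s) * (2 * n + s + 2) ≠ 0)
    (h : ∀ n : ℕ, 1 ≤ n → κ / ((2 * (n : ℂ) + s) * (2 * n + s + 2)) =
      q₂ * n ^ 2 + q₁ * n + q₀) : κ = 0 := by
  have hpoly : (C κ : ℂ[X]) =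
      (C q₂ * X ^ 2 + C q₁ * X + C q₀) * ((2 * X + C s) * (2 * X + C s + 2)) := by
    refine eq_of_eval_natCast_eq 1 fun n hn => ?_
    have := h n hn
    rw [div_eq_iff (hs n hn)] at this
    simpa using this
  -- At this pole of the left-hand side the right-hand polynomial vanishes.
  have := congrArg (eval (-s / 2)) hpoly
  simp only [eval_mul, eval_add, eval_C, eval_X, eval_pow, eval_ofNat] at this
  rw [this]
  ring

/-! ### Growth of square roots of rational functions -/

/-- The linear part is killed exactly, and the convergent remainder contributes L − 2L + L = 0 in
the limit. -/
lemma tendsto_secondDiff_of_quadratic {f e : ℕ → ℂ} {q₂ q₁ L : ℂ}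
    (hf : ∀ᶠ n in atTop, f n = q₂ * n ^ 2 + q₁ * n + e n) (he : Tendsto e atTop (𝓝 L)) :
    Tendsto (secondDiff f) atTop (𝓝 (2 * q₂)) := by
  have h1 := he.comp (tendsto_add_atTop_nat 1)
  have h2 := he.comp (tendsto_add_atTop_nat 2)
  have h3 : Tendsto (fun n => 2 * q₂ + (e (n + 2) - 2 * e (n + 1) + e n)) atTop
      (𝓝 (2 * q₂ + (L - 2 * L + L))) :=
    tendsto_const_nhds.add ((h2.sub (h1.const_mul 2)).add he)
  rw [show 2 * q₂ + (L - 2 * L + L) = 2 * q₂ by ring] at h3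
  refine h3.congr' ?_
  filter_upwards [hf, (tendsto_add_atTop_nat 1).eventually hf,
    (tendsto_add_atTop_nat 2).eventually hf] with n e0 e1 e2
  simp only [secondDiff, e0, e1, e2]
  push_cast
  ring

lemma exists_analytic_quotient {G : ℂ → ℂ} (hG : AnalyticAt ℂ G 0) :
    ∃ G₁ : ℂ → ℂ, AnalyticAt ℂ G₁ 0 ∧ ∀ u, G u = G 0 + u * G₁ u := by
  obtain ⟨p, hp⟩ := hG
  refine ⟨dslope G 0, hp.has_fpower_series_dslope_fslope.analyticAt, fun u => ?_⟩
  have := sub_smul_dslope G 0 u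
  rw [sub_zero, smul_eq_mul] at this
  rw [this]
  ring

lemma tendsto_comp_inv {G : ℂ → ℂ} (hG : AnalyticAt ℂ G 0) :
    Tendsto (fun n : ℕ => G ((n : ℂ)⁻¹)) atTop (𝓝 (G 0)) :=
  hG.continuousAt.tendsto.comp tendsto_inv_atTop_nhds_zero_nat

/-- Expanding G to second order writes n² G(1/n) as a quadratic polynomial whose constant term is
replaced by a convergent sequence. -/
lemma tendsto_secondDiff_of_analytic {f : ℕ → ℂ} {G : ℂ → ℂ} (hG : AnalyticAt ℂ G 0)
    (hf : ∀ᶠ n : ℕ in atTop, f n = n ^ 2 * G ((n : ℂ)⁻¹)) :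
    Tendsto (secondDiff f) atTop (𝓝 (2 * G 0)) := by
  obtain ⟨G₁, hG₁, h1⟩ := exists_analytic_quotient hG
  obtain ⟨G₂, hG₂, h2⟩ := exists_analytic_quotient hG₁
  refine tendsto_secondDiff_of_quadratic (q₁ := G₁ 0) ?_ (tendsto_comp_inv hG₂)
  filter_upwards [hf, eventually_ne_atTop 0] with n hn h0
  have : (n : ℂ) ≠ 0 := Nat.cast_ne_zero.2 h0
  rw [hn, h1, h2]
  field_simp
  ring

lemma prod_map_add_eq {x : ℂ} (hx : x ≠ 0) (S : Multiset ℂ) :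
    (S.map fun r => x + r).prod = x ^ S.card * (S.map fun r => 1 + r * x⁻¹).prod := by
  induction S using Multiset.induction_on with
  | empty => simp
  | cons r S ih =>
    rw [Multiset.map_cons, Multiset.prod_cons, ih, Multiset.map_cons, Multiset.prod_cons,
      Multiset.card_cons, pow_succ]
    field_simp

lemma analyticAt_prod_map (S : Multiset ℂ) :
    AnalyticAt ℂ (fun u : ℂ => (S.map fun r => 1 + r * u).prod) 0 := by
  induction S using Multiset.induction_on with
  | empty => simpa using analyticAt_const
  | cons r S ih =>
    simp only [Multiset.map_cons, Multiset.prod_cons]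
    exact (by fun_prop : AnalyticAt ℂ (fun u : ℂ => 1 + r * u) 0).mul ih

/-- A positive square root of a rational function of even degree `2j` is `n ^ j` times an analytic
function of `1 / n`. -/
theorem exists_analytic_of_sq_eq {α : ℕ → ℝ} (hα : ∀ n, 0 < α n) {S T : Multiset ℂ} {k : ℝ}
    (hk : 0 < k) {j : ℕ} (hc : S.card = T.card + 2 * j)
    (hsq : ∀ n : ℕ, 1 ≤ n → (α n : ℂ) ^ 2 * (T.map fun r => (n : ℂ) + r).prod =
      k * (S.map fun r => (n : ℂ) + r).prod)
    (hT : ∀ n : ℕ, 1 ≤ n → (T.map fun r => (n : ℂ) + r).prod ≠ 0) :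
    ∃ G : ℂ → ℂ, AnalyticAt ℂ G 0 ∧ ∀ n : ℕ, 1 ≤ n → (α n : ℂ) = n ^ j * G ((n : ℂ)⁻¹) := by
  set F : ℂ → ℂ := fun u => k * (S.map fun r => 1 + r * u).prod / (T.map fun r => 1 + r * u).prod
    with hF
  have h0 : ∀ S : Multiset ℂ, (S.map fun r => 1 + r * 0).prod = 1 := by
    intro S
    simp
  have hF0 : F 0 = k := by simp only [hF, h0]; simp
  have hFa : AnalyticAt ℂ F 0 := by
    refine (analyticAt_const.mul (analyticAt_prod_map S)).div (analyticAt_prod_map T) ?_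
    rw [h0]
    exact one_ne_zero
  -- The principal branch is analytic near F(0) = k > 0. Positivity of α_n ensures that it returns
  -- α_n / n^j at u = 1/n and not its negative.
  refine ⟨fun u => F u ^ (2⁻¹ : ℂ), hFa.cpow analyticAt_const ?_, fun n hn => ?_⟩
  · rw [hF0]
    exact Complex.ofReal_mem_slitPlane.2 hk
  · have hn0 : (n : ℂ) ≠ 0 := Nat.cast_ne_zero.2 (by omega)
    have hnr : (0 : ℝ) < n := Nat.cast_pos.2 (by omega)
    have h1 := hsq n hn
    have h2 := hT n hn
    rw [prod_map_add_eq hn0] at h2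
    have h2' := right_ne_zero_of_mul h2
    rw [prod_map_add_eq hn0, prod_map_add_eq hn0 S, hc, pow_add, pow_mul'] at h1
    have hval : F ((n : ℂ)⁻¹) = ((α n / (n : ℝ) ^ j : ℝ) : ℂ) ^ 2 := by
      simp only [hF]
      push_cast
      rw [div_eq_iff h2', div_pow, div_mul_eq_mul_div, eq_div_iff (by positivity)]
      apply mul_left_cancel₀ (pow_ne_zero T.card hn0)
      linear_combination -h1
    simp only [hval]
    rw [Complex.sq_cpow_two_inv]
    · push_cast
      field_simp
    · rw [Complex.ofReal_re]
      exact div_pos (hα n) (by positivity)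

theorem tendsto_secondDiff_of_sq_eq {α : ℕ → ℝ} {j : ℕ} (hj : j ≤ 2) {G : ℂ → ℂ}
    (hG : AnalyticAt ℂ G 0) (hα : ∀ n : ℕ, 1 ≤ n → (α n : ℂ) = n ^ j * G ((n : ℂ)⁻¹)) :
    ∃ A : ℂ, Tendsto (secondDiff fun n => (α n : ℂ)) atTop (𝓝 A) := by
  -- The factor u^(2 − j) compensates for growth n^j instead of n².
  refine ⟨_, tendsto_secondDiff_of_analytic (G := fun u => u ^ (2 - j) * G u) (by fun_prop) ?_⟩
  filter_upwards [eventually_ge_atTop 1] with n hn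
  have hn0 : (n : ℂ) ≠ 0 := Nat.cast_ne_zero.2 (by omega)
  rw [hα n hn]
  have : (n : ℂ) ^ 2 = n ^ (2 - j) * n ^ j := by rw [← pow_add]; congr 1; omega
  rw [this, inv_pow]
  field_simp

lemma tendsto_inv_mul_of_analytic {f : ℕ → ℂ} {G : ℂ → ℂ} {j : ℕ} (hG : AnalyticAt ℂ G 0)
    (hf : ∀ n : ℕ, 1 ≤ n → f n = n ^ j * G ((n : ℂ)⁻¹)) :
    Tendsto (fun n : ℕ => ((n : ℂ) ^ j)⁻¹ * f n) atTop (𝓝 (G 0)) := by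
  refine (tendsto_comp_inv hG).congr' ?_
  filter_upwards [eventually_ge_atTop 1] with n hn
  have hn0 : (n : ℂ) ≠ 0 := Nat.cast_ne_zero.2 (by omega)
  rw [hf n hn, inv_mul_cancel_left₀ (pow_ne_zero _ hn0)]

lemma tendsto_inv_mul_succ {f : ℕ → ℂ} {j : ℕ} {l : ℂ}
    (hf : Tendsto (fun n : ℕ => ((n : ℂ) ^ j)⁻¹ * f n) atTop (𝓝 l)) :
    Tendsto (fun n : ℕ => ((n : ℂ) ^ j)⁻¹ * f (n + 1)) atTop (𝓝 l) := by
  have h1 := hf.comp (tendsto_add_atTop_nat 1)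
  have h2 : Tendsto (fun n : ℕ => (1 + (n : ℂ)⁻¹) ^ j) atTop (𝓝 1) := by
    have := (tendsto_const_nhds (x := (1 : ℂ))).add (tendsto_inv_atTop_nhds_zero_nat (𝕜 := ℂ))
    simpa using this.pow j
  have h3 := h2.mul h1
  rw [one_mul] at h3
  refine h3.congr' ?_
  filter_upwards [eventually_ge_atTop 1] with n hn
  have hn0 : (n : ℂ) ≠ 0 := Nat.cast_ne_zero.2 (by omega)
  have hn1 : (n : ℂ) + 1 ≠ 0 := Nat.cast_add_one_ne_zero n
  simp only [Function.comp]
  push_cast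
  rw [show (1 : ℂ) + (n : ℂ)⁻¹ = (n + 1) / n by field_simp, div_pow]
  field_simp

/-! ### The diagonal -/

/-- The common shape of the diagonals of all Askey scheme Jacobi matrices, for `n ≥ 1`. -/
def diagForm (c₂ c₁ c₀ K s : ℝ) (n : ℕ) : ℝ :=
  c₂ * n ^ 2 + c₁ * n + c₀ + K / ((2 * n + s - 2) * (2 * n + s))

lemma tendsto_diagForm_tail (c₀ K s : ℝ) :
    Tendsto (fun n : ℕ => (c₀ : ℂ) + (K : ℂ) / ((2 * n + s - 2) * (2 * n + s))) atTop
      (𝓝 (c₀ : ℂ)) := by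
  have h1 : Tendsto (fun n : ℕ => (2 * (n : ℝ) + s - 2)) atTop atTop := by
    have : Tendsto (fun n : ℕ => (2 * (n : ℝ) + (s - 2))) atTop atTop :=
      tendsto_atTop_add_const_right _ _
        ((tendsto_natCast_atTop_atTop (R := ℝ)).const_mul_atTop two_pos)
    simpa [add_sub_assoc] using this
  have h2 : Tendsto (fun n : ℕ => (2 * (n : ℝ) + s)) atTop atTop :=
    tendsto_atTop_add_const_right _ _
        ((tendsto_natCast_atTop_atTop (R := ℝ)).const_mul_atTop two_pos)
  have h3 : Tendsto (fun n : ℕ => c₀ + K / ((2 * (n : ℝ) + s - 2) * (2 * n + s))) atTop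
      (𝓝 (c₀ + 0)) :=
    tendsto_const_nhds.add ((h1.atTop_mul_atTop₀ h2).const_div_atTop K)
  rw [add_zero] at h3
  have h4 := (Complex.continuous_ofReal.tendsto c₀).comp h3
  refine h4.congr fun n => ?_
  simp [Function.comp]

lemma tendsto_secondDiff_diagForm {β : ℕ → ℝ} {c₂ c₁ c₀ K s : ℝ}
    (hβ : ∀ n : ℕ, 1 ≤ n → β n = diagForm c₂ c₁ c₀ K s n) :
    Tendsto (secondDiff fun n => (β n : ℂ)) atTop (𝓝 (2 * (c₂ : ℂ))) := by
  refine tendsto_secondDiff_of_quadratic (q₁ := c₁) ?_ (tendsto_diagForm_tail c₀ K s)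
  filter_upwards [eventually_ge_atTop 1] with n hn
  rw [hβ n hn, diagForm]
  push_cast
  ring

lemma tendsto_inv_sq_mul_diagForm {β : ℕ → ℝ} {c₂ c₁ c₀ K s : ℝ}
    (hβ : ∀ n : ℕ, 1 ≤ n → β n = diagForm c₂ c₁ c₀ K s n) :
    Tendsto (fun n : ℕ => ((n : ℂ) ^ 2)⁻¹ * (β n : ℂ)) atTop (𝓝 (c₂ : ℂ)) := by
  have h1 := tendsto_inv_atTop_nhds_zero_nat (𝕜 := ℂ)
  have h2 := ((tendsto_const_nhds (x := (c₂ : ℂ))).add (h1.const_mul (c₁ : ℂ))).add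
    ((h1.pow 2).mul (tendsto_diagForm_tail c₀ K s))
  simp only [mul_zero, add_zero, ne_eq, OfNat.ofNat_ne_zero, not_false_eq_true, zero_pow,
    zero_mul] at h2
  refine h2.congr' ?_
  filter_upwards [eventually_ge_atTop 1] with n hn
  have hn0 : (n : ℂ) ≠ 0 := Nat.cast_ne_zero.2 (by omega)
  rw [hβ n hn, diagForm]
  push_cast
  generalize (K : ℂ) / ((2 * n + s - 2) * (2 * n + s)) = e
  field_simp
  ring

lemma tendsto_inv_mul_diagForm {β : ℕ → ℝ} {c₁ c₀ K s : ℝ}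
    (hβ : ∀ n : ℕ, 1 ≤ n → β n = diagForm 0 c₁ c₀ K s n) :
    Tendsto (fun n : ℕ => ((n : ℂ) ^ 1)⁻¹ * (β n : ℂ)) atTop (𝓝 (c₁ : ℂ)) := by
  have h1 := tendsto_inv_atTop_nhds_zero_nat (𝕜 := ℂ)
  have h2 := (tendsto_const_nhds (x := (c₁ : ℂ))).add
    (h1.mul (tendsto_diagForm_tail c₀ K s))
  simp only [add_zero, zero_mul] at h2
  refine h2.congr' ?_
  filter_upwards [eventually_ge_atTop 1] with n hn
  have hn0 : (n : ℂ) ≠ 0 := Nat.cast_ne_zero.2 (by omega)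
  rw [hβ n hn, diagForm]
  push_cast
  generalize (K : ℂ) / ((2 * n + s - 2) * (2 * n + s)) = e
  field_simp
  ring

/-! ### Even multiplicities -/

/-- The roots of g² are the roots of g taken twice; the sign change passes from the shifts r to the
roots −r. -/
lemma exists_half_of_isSquare {k : ℂ} (hk : k ≠ 0) {S T : Multiset ℂ}
    (h : IsSquare (C k * (S.map fun r => X + C r).prod * (T.map fun r => X + C r).prod)) :
    ∃ M : Multiset ℂ, S + T = 2 • M := by
  obtain ⟨g, hg⟩ := h
  have hprod : C k * (S.map fun r => X + C r).prod * (T.map fun r => X + C r).prod =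
      C k * ((((S + T).map Neg.neg).map fun a => X - C a).prod) := by
    rw [mul_assoc, ← Multiset.prod_add, ← Multiset.map_add, Multiset.map_map]
    simp
  rw [hprod] at hg
  have hroots := congrArg Polynomial.roots hg
  rw [roots_C_mul _ hk, roots_multiset_prod_X_sub_C, roots_mul] at hroots
  · refine ⟨g.roots.map Neg.neg, ?_⟩
    have := congrArg (Multiset.map Neg.neg) hroots
    rw [Multiset.map_map, Multiset.map_add] at this
    simpa [two_nsmul] using this
  · rw [← hg]
    refine mul_ne_zero (C_ne_zero.2 hk) ?_
    exact (monic_multiset_prod_of_monic _ _ fun a _ => monic_X_sub_C a).ne_zero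

lemma prod_X_add_C_ne_zero (S : Multiset ℂ) : (S.map fun r => X + C r).prod ≠ 0 :=
  (monic_multiset_prod_of_monic _ _ fun a _ => monic_X_add_C a).ne_zero

lemma eval_prod_X_add_C (S : Multiset ℂ) (x : ℂ) :
    (S.map fun r => X + C r).prod.eval x = (S.map fun r => x + r).prod := by
  rw [eval_multiset_prod, Multiset.map_map]
  simp

/-! ### The limit argument and the square criterion -/

/-- The growth of the coefficients that the limit argument needs. -/
def GrowthCondition (α : ℕ → ℝ) (c₂ c₁ : ℝ) : Prop :=
  (c₂ ≠ 0 ∧ ∃ l : ℂ, Tendsto (fun n : ℕ => ((n : ℂ) ^ 2)⁻¹ * (α n : ℂ)) atTop (𝓝 l)) ∨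
  (c₂ = 0 ∧ c₁ ≠ 0 ∧ ∃ l : ℂ, Tendsto (fun n : ℕ => ((n : ℂ) ^ 1)⁻¹ * (α n : ℂ)) atTop (𝓝 l)) ∨
  (c₂ = 0 ∧ c₁ = 0)

/-- The limit argument: the entries of a Jacobi matrix that commutes with a nonzero Hankel matrix
satisfy a linear relation whose right-hand side is a quadratic polynomial. -/
theorem HankelRows.exists_relation {α β : ℕ → ℝ} {h : ℕ → ℂ} (hr : HankelRows α β h)
    (hne : ∃ k, h k ≠ 0) (hα : ∀ n, 0 < α n) {c₂ c₁ c₀ K s : ℝ} (hs : 0 < s)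
    (hβ : ∀ n : ℕ, 1 ≤ n → β n = diagForm c₂ c₁ c₀ K s n)
    (hΔ : ∃ A : ℂ, Tendsto (secondDiff fun n => (α n : ℂ)) atTop (𝓝 A))
    (hgrow : GrowthCondition α c₂ c₁) :
    ∃ x y z q₂ q₁ q₀ : ℂ, (x ≠ 0 ∨ z ≠ 0) ∧
      ∀ m : ℕ, x * α m + y * β (m + 1) + z * α (m + 1) = q₂ * m ^ 2 + q₁ * m + q₀ := by
  obtain ⟨A, hA⟩ := hΔ
  have hB := tendsto_secondDiff_diagForm hβ
  have hfreq : ∀ v : ℕ → ℂ × ℂ × ℂ, (∀ N, (v N).1 = h N) → ∃ᶠ N in atTop, v N ≠ 0 := by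
    intro v hv
    by_contra hcon
    rw [not_frequently] at hcon
    obtain ⟨N, hN⟩ := eventually_atTop.1 hcon
    obtain ⟨k, hk⟩ := hne
    refine hk (hr.eq_zero_of_eventually (fun n => (hα n).ne') (N := N) (fun j hj => ?_) k)
    rw [← hv j, not_not.1 (hN j hj)]
    rfl
  -- When β is constant for n ≥ 1 its differences vanish in the rows used, and the limit vector
  -- could point along the useless middle axis. The middle component is therefore replaced by zero
  -- before normalising.
  by_cases hconst : c₂ = 0 ∧ c₁ = 0 ∧ K = 0
  · obtain ⟨rfl, rfl, rfl⟩ := hconst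
    have hβc : ∀ n, β (n + 1) = c₀ := by
      intro n
      rw [hβ (n + 1) (by omega)]
      simp [diagForm]
    obtain ⟨v, hv⟩ : ∃ v : ℕ → ℂ × ℂ × ℂ, ∀ N, v N = (h N, 0, h (N + 2)) := ⟨_, fun _ => rfl⟩
    obtain ⟨φ, c, u, hφ, hu, hlim⟩ := exists_normalized_limit (hfreq v fun N => by rw [hv])
    have hy : u.2.1 = 0 := by
      have h2 : Tendsto (fun k => (c k • v (φ k)).2.1) atTop (𝓝 u.2.1) :=
        ((continuous_fst.comp continuous_snd).tendsto _).comp hlim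
      simp only [hv, Prod.smul_mk, smul_zero] at h2
      exact tendsto_nhds_unique h2 tendsto_const_nhds
    have hrow : ∀ m n, ((α n : ℂ) - α m) * (v (m + n + 1)).1 +
        ((β (n + 1) : ℂ) - β (m + 1)) * (v (m + n + 1)).2.1 +
        ((α (n + 1) : ℂ) - α (m + 1)) * (v (m + n + 1)).2.2 = 0 := by
      intro m n
      have := hr.row_succ m n
      rw [hβc, hβc] at this ⊢
      rw [hv]
      linear_combination this
    obtain ⟨q₂, q₁, q₀, hq⟩ := exists_relation_of_rows hA hB hφ hlim hrow
    refine ⟨u.1, u.2.1, u.2.2, q₂, q₁, q₀, ?_, hq⟩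
    by_contra hcon
    push Not at hcon
    exact hu (Prod.ext hcon.1 (Prod.ext hy hcon.2))
  · obtain ⟨v, hv⟩ : ∃ v : ℕ → ℂ × ℂ × ℂ, ∀ N, v N = (h N, h (N + 1), h (N + 2)) :=
      ⟨_, fun _ => rfl⟩
    obtain ⟨φ, c, u, hφ, hu, hlim⟩ := exists_normalized_limit (hfreq v fun N => by rw [hv])
    have hrow : ∀ m n, ((α n : ℂ) - α m) * (v (m + n + 1)).1 +
        ((β (n + 1) : ℂ) - β (m + 1)) * (v (m + n + 1)).2.1 +
        ((α (n + 1) : ℂ) - α (m + 1)) * (v (m + n + 1)).2.2 = 0 := by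
      intro m n
      rw [hv]
      exact hr.row_succ m n
    obtain ⟨q₂, q₁, q₀, hq⟩ := exists_relation_of_rows hA hB hφ hlim hrow
    refine ⟨u.1, u.2.1, u.2.2, q₂, q₁, q₀, ?_, hq⟩
    by_contra hcon
    push Not at hcon
    obtain ⟨hx, hz⟩ := hcon
    have hy : u.2.1 ≠ 0 := fun hy => hu (Prod.ext hx (Prod.ext hy hz))
    have hginv : ∀ j : ℕ, j ≠ 0 → Tendsto (fun n : ℕ => ((n : ℂ) ^ j)⁻¹) atTop (𝓝 0) := by
      intro j hj
      have := (tendsto_inv_atTop_nhds_zero_nat (𝕜 := ℂ)).pow j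
      simpa [hj] using this
    -- With x = z = 0 and y ≠ 0, leading growth gives y c₂ = 0 or y c₁ = 0; if both coefficients
    -- vanish, then K ≠ 0 and the pole of β contradicts the quadratic right-hand side.
    rcases hgrow with ⟨h2, l, hl⟩ | ⟨rfl, h1, l, hl⟩ | ⟨rfl, rfl⟩
    · have := leading_relation_of_rows (a := fun n => (α n : ℂ)) (b := fun n => (β n : ℂ))
        (hginv 2 two_ne_zero) hl (tendsto_inv_mul_succ hl)
        (tendsto_inv_mul_succ (tendsto_inv_sq_mul_diagForm hβ)) hφ hlim hrow
      simp [hx, hz, hy, h2] at this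
    · have := leading_relation_of_rows (a := fun n => (α n : ℂ)) (b := fun n => (β n : ℂ))
        (hginv 1 one_ne_zero) hl (tendsto_inv_mul_succ hl)
        (tendsto_inv_mul_succ (tendsto_inv_mul_diagForm hβ)) hφ hlim hrow
      simp [hx, hz, hy, h1] at this
    · have hK : K ≠ 0 := by simpa using hconst
      have := eq_zero_of_inv_eq_quadratic (κ := u.2.1 * K) (s := s) (q₂ := q₂) (q₁ := q₁)
        (q₀ := q₀ - u.2.1 * c₀) ?_ ?_
      · simp [hy, hK] at this
      · intro n _
        have : (2 * (n : ℝ) + s) * (2 * n + s + 2) ≠ 0 := by positivity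
        exact_mod_cast this
      · intro n _
        have := hq n
        rw [hx, hz, hβ (n + 1) (by omega), diagForm] at this
        push_cast at this
        rw [show (2 * ((n : ℂ) + 1) + s - 2) * (2 * ((n : ℂ) + 1) + s) =
          (2 * n + s) * (2 * n + s + 2) by ring] at this
        linear_combination this

/-- If a Jacobi matrix commutes with a nonzero Hankel matrix, then the squares of its off-diagonal
entries are values of a rational function that is itself a square. -/
theorem HankelRows.exists_half {α β : ℕ → ℝ} {h : ℕ → ℂ} (hr : HankelRows α β h)
    (hne : ∃ k, h k ≠ 0) (hα : ∀ n, 0 < α n) {c₂ c₁ c₀ K s : ℝ} (hs : 0 < s)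
    (hβ : ∀ n : ℕ, 1 ≤ n → β n = diagForm c₂ c₁ c₀ K s n)
    (hΔ : ∃ A : ℂ, Tendsto (secondDiff fun n => (α n : ℂ)) atTop (𝓝 A))
    (hgrow : GrowthCondition α c₂ c₁) {S T : Multiset ℂ} {k : ℝ} (hk : 0 < k)
    (hsq : ∀ n : ℕ, 1 ≤ n → (α n : ℂ) ^ 2 * (T.map fun r => (n : ℂ) + r).prod =
      k * (S.map fun r => (n : ℂ) + r).prod)
    (hT : ∀ n : ℕ, 1 ≤ n → (T.map fun r => (n : ℂ) + r).prod ≠ 0) :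
    ∃ M : Multiset ℂ, S + T = 2 • M := by
  obtain ⟨x, y, z, q₂, q₁, q₀, hxz, hrel⟩ := hr.exists_relation hne hα hs hβ hΔ hgrow
  have hk0 : (k : ℂ) ≠ 0 := Complex.ofReal_ne_zero.2 hk.ne'
  have hC : (C (k : ℂ) : ℂ[X]) ≠ 0 := C_ne_zero.2 hk0
  have hpos : ∀ n : ℕ, (2 * (n : ℂ) + s) * (2 * n + s + 2) ≠ 0 := by
    intro n
    have : (2 * (n : ℝ) + s) * (2 * n + s + 2) ≠ 0 := by positivity
    exact_mod_cast this
  refine exists_half_of_isSquare hk0 (isSquare_of_relation (a := fun n => (α n : ℂ)) (x := x)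
    (z := z) (W := (2 * X + C (s : ℂ)) * (2 * X + C (s : ℂ) + 2))
    (V := (C q₂ * X ^ 2 + C q₁ * X + C q₀ - C y * (C (c₂ : ℂ) * (X + 1) ^ 2 +
      C (c₁ : ℂ) * (X + 1) + C (c₀ : ℂ))) * ((2 * X + C (s : ℂ)) * (2 * X + C (s : ℂ) + 2)) -
      C (y * K)) (mul_ne_zero hC (prod_X_add_C_ne_zero S)) (prod_X_add_C_ne_zero T) ?_ hxz ?_ ?_ ?_)
  · intro h0
    have := congrArg (eval ((1 : ℕ) : ℂ)) h0
    simp only [eval_mul, eval_add, eval_C, eval_X, eval_ofNat, eval_zero] at this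
    exact hpos 1 this
  · intro n hn
    rw [eval_mul, eval_C, eval_prod_X_add_C, eval_prod_X_add_C]
    exact hsq n hn
  · intro n hn
    rw [eval_prod_X_add_C]
    exact hT n hn
  · intro n _
    have h1 := hrel n
    rw [hβ (n + 1) (by omega), diagForm] at h1
    push_cast at h1
    rw [show (2 * ((n : ℂ) + 1) + s - 2) * (2 * ((n : ℂ) + 1) + s) =
      (2 * n + s) * (2 * n + s + 2) by ring] at h1
    simp only [eval_mul, eval_add, eval_sub, eval_pow, eval_C, eval_X, eval_ofNat, eval_one]
    have h2 := div_mul_cancel₀ (K : ℂ) (hpos n)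
    linear_combination (2 * (n : ℂ) + s) * (2 * n + s + 2) * h1 - y * h2

/-- The even-degree case of `HankelRows.exists_half`, with the growth of `α` deduced. -/
theorem HankelRows.exists_half_of_card {α β : ℕ → ℝ} {h : ℕ → ℂ} (hr : HankelRows α β h)
    (hne : ∃ k, h k ≠ 0) (hα : ∀ n, 0 < α n) {c₂ c₁ c₀ K s : ℝ} (hs : 0 < s)
    (hβ : ∀ n : ℕ, 1 ≤ n → β n = diagForm c₂ c₁ c₀ K s n) {S T : Multiset ℂ} {k : ℝ} (hk : 0 < k)
    {j : ℕ} (hc : S.card = T.card + 2 * j)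
    (hj : (j = 2 ∧ c₂ ≠ 0) ∨ (j = 1 ∧ c₂ = 0) ∨ (j = 0 ∧ c₂ = 0 ∧ c₁ = 0))
    (hsq : ∀ n : ℕ, 1 ≤ n → (α n : ℂ) ^ 2 * (T.map fun r => (n : ℂ) + r).prod =
      k * (S.map fun r => (n : ℂ) + r).prod)
    (hT : ∀ n : ℕ, 1 ≤ n → (T.map fun r => (n : ℂ) + r).prod ≠ 0) :
    ∃ M : Multiset ℂ, S + T = 2 • M := by
  obtain ⟨G, hG, hαG⟩ := exists_analytic_of_sq_eq hα hk hc hsq hT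
  refine hr.exists_half hne hα hs hβ (tendsto_secondDiff_of_sq_eq (j := j) (by omega) hG hαG) ?_
    hk hsq hT
  have hl := tendsto_inv_mul_of_analytic hG hαG
  rcases hj with ⟨rfl, h2⟩ | ⟨rfl, h2⟩ | ⟨rfl, h2, h1⟩
  · exact Or.inl ⟨h2, _, hl⟩
  · by_cases h1 : c₁ = 0
    · exact Or.inr (Or.inr ⟨h2, h1⟩)
    · exact Or.inr (Or.inl ⟨h2, h1, _, hl⟩)
  · exact Or.inr (Or.inr ⟨h2, h1⟩)

/-! ### Solving for `h` once the Jacobi matrix is known -/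

/-- The recurrence is exactly the vanishing of the second difference of e_k = (−1)^k (k + t) h_k. So
e is affine, and since e_k / k → 0 by decay of h, its slope is zero. -/
lemma exists_alternating {h : ℕ → ℂ} (hlim : Tendsto h atTop (𝓝 0)) {t : ℝ} {k₀ : ℕ}
    (ht : ∀ k : ℕ, k₀ ≤ k → (k : ℂ) + t ≠ 0)
    (hrec : ∀ k : ℕ, k₀ ≤ k → ((k : ℂ) + t) * h k + 2 * (k + 1 + t) * h (k + 1) +
      (k + 2 + t) * h (k + 2) = 0) :
    ∃ κ : ℂ, ∀ k : ℕ, k₀ ≤ k → h k = κ * ((-1) ^ k / (k + t)) := by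
  set e : ℕ → ℂ := fun k => (-1) ^ k * ((k + t) * h k) with he
  have haff := eq_affine_of_secondDiff_eq_zero (f := e) (k₀ := k₀) (by
    intro k hk
    simp only [secondDiff, he]
    push_cast
    rw [pow_add, pow_succ]
    linear_combination (-1) ^ k * hrec k hk)
  set d := e (k₀ + 1) - e k₀
  have hinv := tendsto_inv_atTop_nhds_zero_nat (𝕜 := ℂ)
  have hd : d = 0 := by
    have h1 : Tendsto (fun n : ℕ => (n : ℂ)⁻¹ * e k₀ + (1 - (n : ℂ)⁻¹ * k₀) * d) atTop (𝓝 d) := by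
      have := (hinv.mul_const (e k₀)).add
        (((tendsto_const_nhds (x := (1 : ℂ))).sub (hinv.mul_const (k₀ : ℂ))).mul_const d)
      simpa using this
    have h2 : Tendsto (fun n : ℕ => (1 + (n : ℂ)⁻¹ * t) * ((-1) ^ n * h n)) atTop (𝓝 0) := by
      have h3 : Tendsto (fun n : ℕ => (-1 : ℂ) ^ n * h n) atTop (𝓝 0) := by
        rw [tendsto_zero_iff_norm_tendsto_zero] at hlim ⊢
        simpa using hlim
      have := ((tendsto_const_nhds (x := (1 : ℂ))).add (hinv.mul_const (t : ℂ))).mul h3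
      simpa using this
    refine tendsto_nhds_unique h1 (h2.congr' ?_)
    filter_upwards [eventually_ge_atTop (k₀ + 1)] with n hn
    have hn0 : (n : ℂ) ≠ 0 := Nat.cast_ne_zero.2 (by omega)
    have := haff n (by omega)
    simp only [he] at this ⊢
    field_simp
    linear_combination this
  refine ⟨e k₀, fun k hk => ?_⟩
  have h1 := haff k hk
  rw [hd, mul_zero, add_zero] at h1
  rw [← h1]
  simp only [he]
  have := ht k hk
  field_simp
  rw [← pow_mul, mul_comm k 2, pow_mul]
  simp

namespace HankelRows

variable {α β : ℕ → ℝ} {h : ℕ → ℂ}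

/-- If `α_n = γ (n + p) (n + q)` and `β` is the matching quadratic polynomial for `n ≥ 1`, then
the formulas hold at `n = 0` too, `p = 1` or `q = 1`, and `h` is the alternating Hilbert
sequence. -/
theorem exists_of_quadratic (hr : HankelRows α β h) (hα : ∀ n, 0 < α n)
    (hlim : Tendsto h atTop (𝓝 0)) (hne : ∃ k, h k ≠ 0) {γ s c₀ : ℝ} (hγ : 0 < γ) (hs : 0 < s)
    {p q : ℂ} (hpq : p + q = s) (hαf : ∀ n : ℕ, 1 ≤ n → (α n : ℂ) = γ * ((n + p) * (n + q)))
    (hβf : ∀ n : ℕ, 1 ≤ n → β n = 2 * γ * n ^ 2 + 2 * γ * (s - 1) * n + c₀) :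
    ∃ t : ℝ, 0 < t ∧ ∃ κ : ℂ, ∀ k : ℕ, h k = κ * ((-1) ^ k / (k + t)) := by
  have hγ0 : (γ : ℂ) ≠ 0 := Complex.ofReal_ne_zero.2 hγ.ne'
  have hαs : ∀ n : ℕ, 1 ≤ n → (α n : ℂ) = γ * (n ^ 2 + s * n + p * q) := by
    intro n hn
    rw [hαf n hn, ← hpq]
    ring
  have hβs : ∀ n : ℕ, 1 ≤ n → (β n : ℂ) = 2 * γ * n ^ 2 + 2 * γ * (s - 1) * n + c₀ := by
    intro n hn
    rw [hβf n hn]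
    push_cast
    ring
  have hpos : ∀ k : ℕ, 1 ≤ k → (k : ℂ) + ((s - 1 : ℝ) : ℂ) ≠ 0 := by
    intro k hk
    have h1 : (1 : ℝ) ≤ k := by exact_mod_cast hk
    have : (k : ℝ) + (s - 1) ≠ 0 := by linarith
    exact_mod_cast this
  -- The formulas are known only from index 1, so row m = 1 is used. Its difference n − m = j + 1
  -- factors out and must be nonzero, which makes h_4 the first term reached.
  have hrec : ∀ k : ℕ, 4 ≤ k → ((k : ℂ) + ((s - 1 : ℝ) : ℂ)) * h k +
      2 * (k + 1 + ((s - 1 : ℝ) : ℂ)) * h (k + 1) +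
      (k + 2 + ((s - 1 : ℝ) : ℂ)) * h (k + 2) = 0 := by
    intro k hk
    obtain ⟨j, rfl⟩ := Nat.exists_eq_add_of_le hk
    have := hr.row_succ 1 (j + 2)
    rw [hαs _ (by omega), hαs 1 le_rfl, hαs _ (by omega), hαs _ (by omega), hβs _ (by omega),
      hβs _ (by omega), show 1 + (j + 2) + 1 = 4 + j by ring,
      show 1 + (j + 2) + 2 = 4 + j + 1 by ring, show 1 + (j + 2) + 3 = 4 + j + 2 by ring] at this
    have hj : (γ : ℂ) * ((j : ℂ) + 1) ≠ 0 := mul_ne_zero hγ0 (Nat.cast_add_one_ne_zero j)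
    apply mul_left_cancel₀ hj
    push_cast at this ⊢
    linear_combination this
  obtain ⟨κ, hκ⟩ := exists_alternating hlim (t := s - 1) (k₀ := 4)
    (fun k hk => hpos k (by omega)) hrec
  have hκ0 : κ ≠ 0 := by
    rintro rfl
    obtain ⟨k, hk⟩ := hne
    exact hk (hr.eq_zero_of_eventually (fun n => (hα n).ne') (N := 4)
      (fun j hj => by rw [hκ j hj, zero_mul]) k)
  have hh0 : ∀ k : ℕ, 4 ≤ k → h k ≠ 0 := by
    intro k hk
    rw [hκ k hk]
    exact mul_ne_zero hκ0 (div_ne_zero (pow_ne_zero _ (by norm_num)) (hpos k (by omega)))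
  have hstep : ∀ k : ℕ, 4 ≤ k → ((k : ℂ) + 1 + ((s - 1 : ℝ) : ℂ)) * h (k + 1) =
      -(((k : ℂ) + ((s - 1 : ℝ) : ℂ)) * h k) := by
    intro k hk
    have e1 := hpos k (by omega)
    have e2 := hpos (k + 1) (by omega)
    push_cast at e1 e2
    rw [hκ k hk, hκ (k + 1) (by omega)]
    push_cast
    field_simp
    ring
  have hα0 : (α 0 : ℂ) = γ * (p * q) := by
    -- In this row α_0 is the only unknown coefficient, and h_4 ≠ 0 determines it.
    have e1 := hr.row_succ 0 3
    have e2 := hrec 4 le_rfl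
    rw [hαs 3 (by omega), hαs (3 + 1) (by omega), hαs (0 + 1) (by omega),
      hβs (3 + 1) (by omega), hβs (0 + 1) (by omega)] at e1
    norm_num at e1 e2
    have key : (γ * (p * q) - α 0) * h 4 = 0 := by
      linear_combination e1 - 3 * γ * e2
    linear_combination -(mul_eq_zero.1 key).resolve_right (hh0 4 le_rfl)
  have hαs' : ∀ n : ℕ, (α n : ℂ) = γ * (n ^ 2 + s * n + p * q) := by
    intro n
    rcases Nat.eq_zero_or_pos n with rfl | hn
    · rw [hα0]; simp
    · exact hαs n hn
  -- The row with index zero forces `α (-1) = 0` and the formula for `β 0`.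
  obtain ⟨h1s, hβ0⟩ : (p * q : ℂ) = s - 1 ∧ (β 0 : ℂ) = c₀ := by
    have hrow : ∀ n : ℕ, 4 ≤ n → γ * (1 - s + p * q) * h n = (β 0 - c₀) * h (n + 1) := by
      intro n hn
      have e1 := hr.row_zero n
      have e2 := hrec n hn
      rw [hαs', hαs', hαs', hβs _ (by omega)] at e1
      push_cast at e1 e2
      linear_combination e1 - (n + 1) * γ * e2
    -- An expression affine in n: its vanishing at n = 4 and n = 5 kills both coefficients.
    have hred : ∀ n : ℕ, 4 ≤ n → γ * (1 - s + p * q) * ((n : ℂ) + s) +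
        (β 0 - c₀) * ((n : ℂ) + s - 1) = 0 := by
      intro n hn
      apply mul_right_cancel₀ (hh0 n hn)
      have e1 := hrow n hn
      have e2 := hstep n hn
      push_cast at e2
      linear_combination (n + s) * e1 + (β 0 - c₀) * e2
    have e4 := hred 4 le_rfl
    have e5 := hred 5 (by omega)
    push_cast at e4 e5
    have hsum : γ * (1 - s + p * q) + (β 0 - c₀) = 0 := by linear_combination e5 - e4
    have hz : γ * (1 - s + p * q) = 0 := by linear_combination e4 - (3 + s) * hsum
    constructor
    · linear_combination (mul_eq_zero.1 hz).resolve_left hγ0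
    · linear_combination hsum - hz
  -- Positivity of t is forced by α_0 = γ p q = γ(s − 1).
  have ht : 0 < s - 1 := by
    have h1 : α 0 = γ * (s - 1) := by
      rw [h1s] at hα0
      exact_mod_cast hα0
    have h2 := hα 0
    rw [h1] at h2
    exact pos_of_mul_pos_right h2 hγ.le
  have hβs' : ∀ n : ℕ, (β n : ℂ) = 2 * γ * n ^ 2 + 2 * γ * (s - 1) * n + c₀ := by
    intro n
    rcases Nat.eq_zero_or_pos n with rfl | hn
    · rw [hβ0]; simp
    · exact hβs n hn
  -- With the formulas now valid at index 0, `row_zero` gives the recurrence from the start; the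
  -- condition pq = s − 1 makes its coefficients divisible by n + 1.
  obtain ⟨κ', hκ'⟩ := exists_alternating hlim (t := s - 1) (k₀ := 0)
    (fun k _ => by
      have : (k : ℝ) + (s - 1) ≠ 0 := by positivity
      exact_mod_cast this) (fun k _ => by
      have e1 := hr.row_zero k
      rw [hαs', hαs', hαs', hβs', hβs', h1s] at e1
      have hj : (γ : ℂ) * ((k : ℂ) + 1) ≠ 0 := mul_ne_zero hγ0 (Nat.cast_add_one_ne_zero k)
      apply mul_left_cancel₀ hj
      push_cast at e1 ⊢
      linear_combination e1)
  exact ⟨s - 1, ht, κ', fun k => hκ' k (Nat.zero_le k)⟩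

/-- If `α` is affine and `β` is constant for `n ≥ 1`, then `h = 0`. -/
theorem eq_zero_of_affine_of_const (hr : HankelRows α β h) (hα : ∀ n, 0 < α n)
    (hlim : Tendsto h atTop (𝓝 0)) {γ p c₀ : ℝ} (hγ : 0 < γ)
    (hαf : ∀ n : ℕ, 1 ≤ n → α n = γ * (n + p)) (hβf : ∀ n : ℕ, 1 ≤ n → β n = c₀) :
    ∀ k, h k = 0 := by
  have hrec : ∀ k : ℕ, 4 ≤ k → h (k + 2) = -h k := by
    intro k hk
    obtain ⟨j, rfl⟩ := Nat.exists_eq_add_of_le hk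
    have := hr.row_succ 1 (j + 2)
    rw [hαf _ (by omega), hαf 1 le_rfl, hαf _ (by omega), hαf _ (by omega), hβf _ (by omega),
      hβf _ (by omega), show 1 + (j + 2) + 1 = 4 + j by ring,
      show 1 + (j + 2) + 2 = 4 + j + 1 by ring, show 1 + (j + 2) + 3 = 4 + j + 2 by ring] at this
    have hj : (γ : ℂ) * ((j : ℂ) + 1) ≠ 0 :=
      mul_ne_zero (Complex.ofReal_ne_zero.2 hγ.ne') (Nat.cast_add_one_ne_zero j)
    apply mul_left_cancel₀ hj
    push_cast at this ⊢
    linear_combination this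
  refine hr.eq_zero_of_eventually (fun n => (hα n).ne') (N := 4) fun k hk => ?_
  have hnorm : ∀ j, ‖h (k + 2 * j)‖ = ‖h k‖ := by
    intro j
    induction j with
    | zero => rfl
    | succ j ih => rw [← ih, mul_add, ← add_assoc, hrec _ (by omega), norm_neg]
  have hsub : Tendsto (fun j => k + 2 * j) atTop atTop :=
    tendsto_atTop_mono (fun j => by simp only [id]; omega) tendsto_id
  have h1 := (hlim.comp hsub).norm
  simp only [Function.comp, hnorm, norm_zero] at h1
  exact norm_eq_zero.1 (tendsto_nhds_unique tendsto_const_nhds h1)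

/-- If `α` and `β` are constant for `n ≥ 1`, then `h` is geometric. -/
theorem geometric_of_const (hr : HankelRows α β h) (hα : ∀ n, 0 < α n) {γ c₀ : ℝ}
    (hαf : ∀ n : ℕ, 1 ≤ n → α n = γ) (hβf : ∀ n : ℕ, 1 ≤ n → β n = c₀) :
    ∃ r : ℂ, ∀ k, h (k + 1) = r * h k := by
  have hzero : (∀ k, 2 ≤ k → h k = 0) → ∃ r : ℂ, ∀ k, h (k + 1) = r * h k := by
    intro hz
    have := hr.eq_zero_of_eventually (fun n => (hα n).ne') hz
    exact ⟨0, fun k => by simp [this]⟩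
  by_cases h0 : α 0 = γ
  · have hαc : ∀ n, α n = γ := by
      intro n
      rcases Nat.eq_zero_or_pos n with rfl | hn
      · exact h0
      · exact hαf n hn
    have hrow : ∀ n, (γ : ℂ) * h n + (c₀ - β 0) * h (n + 1) = 0 := by
      intro n
      have := hr.row_zero n
      rw [hαc, hαc, hαc, hβf _ (by omega)] at this
      linear_combination this
    have hγ : (γ : ℂ) ≠ 0 := by
      rw [← h0]
      exact Complex.ofReal_ne_zero.2 (hα 0).ne'
    by_cases hc : (c₀ : ℂ) - β 0 = 0
    · refine hzero fun k _ => ?_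
      have := hrow k
      rw [hc, zero_mul, add_zero] at this
      exact (mul_eq_zero.1 this).resolve_left hγ
    · refine ⟨-γ / (c₀ - β 0), fun k => ?_⟩
      have := hrow k
      field_simp
      linear_combination this
  · refine hzero fun k hk => ?_
    obtain ⟨n, rfl⟩ := Nat.exists_eq_add_of_le hk
    -- Every difference here vanishes except γ − α_0, so h is zero from index 2 on.
    have := hr.row_succ 0 (n + 1)
    rw [hαf (n + 1) (by omega), hαf (n + 1 + 1) (by omega), hαf (0 + 1) (by omega),
      hβf (n + 1 + 1) (by omega), hβf (0 + 1) (by omega),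
      show 0 + (n + 1) + 1 = 2 + n by ring] at this
    have hne : (γ : ℂ) - α 0 ≠ 0 := sub_ne_zero.2 fun h => h0 (by exact_mod_cast h.symm)
    apply mul_left_cancel₀ hne
    linear_combination this

/-- If `α_n = γ (n + 1)` and `β` is affine, then `h` satisfies a recurrence with constant
coefficients. -/
theorem recurrence_of_affine (hr : HankelRows α β h) {γ c₁ c₀ : ℝ} (hγ : γ ≠ 0)
    (hαf : ∀ n : ℕ, α n = γ * (n + 1)) (hβf : ∀ n : ℕ, β n = c₁ * n + c₀) (k : ℕ) :
    h k + c₁ / γ * h (k + 1) + h (k + 2) = 0 := by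
  have e1 := hr.row_zero k
  rw [hαf, hαf, hαf, hβf, hβf] at e1
  have hγ0 : (γ : ℂ) ≠ 0 := Complex.ofReal_ne_zero.2 hγ
  have hj : (γ : ℂ) * ((k : ℂ) + 1) ≠ 0 := mul_ne_zero hγ0 (Nat.cast_add_one_ne_zero k)
  apply mul_left_cancel₀ hj
  push_cast at e1
  have e3 : (γ : ℂ) * (c₁ / γ) = c₁ := by field_simp
  linear_combination e1 + (k + 1) * h (k + 1) * e3

end HankelRows

/-! ### Multisets with even multiplicities -/

lemma even_count_of_eq_two_nsmul {L M : Multiset ℂ} (h : L = 2 • M) (ρ : ℂ) :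
    Even (L.count ρ) := by
  rw [h, Multiset.count_nsmul]
  exact even_two_mul _

lemma pairing_of_half {u v w : ℂ} (h : ∃ M : Multiset ℂ, ({1, u, v, w} : Multiset ℂ) = 2 • M) :
    (u = 1 ∧ v = w) ∨ (v = 1 ∧ u = w) ∨ (w = 1 ∧ u = v) := by
  obtain ⟨M, hM⟩ := h
  have h1 := even_count_of_eq_two_nsmul hM 1
  have hu := even_count_of_eq_two_nsmul hM u
  have hv := even_count_of_eq_two_nsmul hM v
  have hw := even_count_of_eq_two_nsmul hM w
  simp only [Multiset.insert_eq_cons, Multiset.count_cons, Multiset.count_singleton] at h1 hu hv hw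
  grind

/-- Of the two reflected copies of D about c, the point c + ρ meets e = ρ in one and e = −ρ in the
other. At ρ = 0 the element e = 0 would be met twice. -/
lemma count_map_symm (D : Multiset ℂ) (c ρ : ℂ) (hρ : ρ ≠ 0) :
    (D.map fun e => c + e).count (c + ρ) + (D.map fun e => c - e).count (c + ρ) =
      (D.map fun e => e ^ 2).count (ρ ^ 2) := by
  induction D using Multiset.induction_on with
  | empty => simp
  | cons e D ih =>
    simp only [Multiset.map_cons, Multiset.count_cons]
    rw [← ih]
    have h1 : (c + ρ = c + e) ↔ ρ = e := by simp
    have h2 : (c + ρ = c - e) ↔ ρ = -e := by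
      rw [sub_eq_add_neg, add_right_inj]
    have h3 : (ρ ^ 2 = e ^ 2) ↔ ρ = e ∨ ρ = -e := sq_eq_sq_iff_eq_or_eq_neg
    simp only [h1, h2, h3]
    by_cases ha : ρ = e
    · have hb : ¬ρ = -e := by
        intro hb
        apply hρ
        linear_combination (ha + hb) / 2
      rw [if_pos ha, if_neg hb, if_pos (Or.inl ha)]
      ring
    · by_cases hb : ρ = -e
      · rw [if_neg ha, if_pos hb, if_pos (Or.inr hb)]
        ring
      · rw [if_neg ha, if_neg hb, if_neg (not_or.2 ⟨ha, hb⟩)]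
        ring

/-- For zeros and poles symmetric about c, this moves the parity condition to the squared distances
from c, at the cost of all information about the value 0. -/
lemma even_count_sq {D M : Multiset ℂ} {c : ℂ}
    (h : (D.map fun e => c + e) + (D.map fun e => c - e) = 2 • M) (W : ℂ) (hW : W ≠ 0) :
    Even ((D.map fun e => e ^ 2).count W) := by
  obtain ⟨ρ, rfl⟩ := IsAlgClosed.exists_pow_nat_eq W two_pos
  have hρ : ρ ≠ 0 := by
    rintro rfl
    simp at hW
  rw [← count_map_symm D c ρ hρ, ← Multiset.count_add]
  exact even_count_of_eq_two_nsmul h _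

lemma zero_and_eq_of_even_count {X Y Z : ℂ}
    (h : ∀ W : ℂ, W ≠ 0 → Even (({X, Y, Z} : Multiset ℂ).count W)) :
    (X = 0 ∧ Y = Z) ∨ (Y = 0 ∧ X = Z) ∨ (Z = 0 ∧ X = Y) := by
  have h1 := h X
  have h2 := h Y
  have h3 := h Z
  simp only [Multiset.insert_eq_cons, Multiset.count_cons, Multiset.count_singleton] at h1 h2 h3
  grind

lemma even_count_of_cons_pair {S : Multiset ℂ} {q : ℂ}
    (h : ∀ W : ℂ, W ≠ 0 → Even ((q ::ₘ q ::ₘ 0 ::ₘ S).count W)) (W : ℂ) (hW : W ≠ 0) :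
    Even (S.count W) := by
  have := h W hW
  rw [Multiset.count_cons, Multiset.count_cons, Multiset.count_cons_of_ne hW, add_assoc] at this
  exact (Nat.even_add.1 this).2 ⟨_, rfl⟩

/-- The entry 1/4 needs a partner among the E_i. Of the remaining three values one must be 0 and the
other two equal. Since two indices share the common value E, it can be taken with index 1, 2 or 3,
where it belongs to a pair of parameter sums with positive real parts. -/
lemma wilson_factors {E₀ E₁ E₂ E₃ : ℂ}
    (h : ∀ W : ℂ, W ≠ 0 → Even (({E₀, E₁, E₂, E₃, 1 / 4, 0} : Multiset ℂ).count W)) :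
    ∃ E : ℂ, (E = E₁ ∨ E = E₂ ∨ E = E₃) ∧
      ∀ w, (w - E₀) * (w - E₁) * (w - E₂) * (w - E₃) = w * (w - 1 / 4) * (w - E) ^ 2 := by
  have h4 : E₀ = 1 / 4 ∨ E₁ = 1 / 4 ∨ E₂ = 1 / 4 ∨ E₃ = 1 / 4 := by
    by_contra! hcon
    have := h (1 / 4) (by norm_num)
    simp only [Multiset.insert_eq_cons] at this
    rw [Multiset.count_cons_of_ne hcon.1.symm, Multiset.count_cons_of_ne hcon.2.1.symm,
      Multiset.count_cons_of_ne hcon.2.2.1.symm, Multiset.count_cons_of_ne hcon.2.2.2.symm,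
      Multiset.count_cons_self, Multiset.count_singleton, if_neg (by norm_num)] at this
    simp at this
  have key : ∀ X Y Z : ℂ, (∀ W : ℂ, W ≠ 0 →
      Even (((1 / 4) ::ₘ (1 / 4) ::ₘ 0 ::ₘ {X, Y, Z} : Multiset ℂ).count W)) →
      (X = 0 ∧ Y = Z) ∨ (Y = 0 ∧ X = Z) ∨ (Z = 0 ∧ X = Y) :=
    fun X Y Z h => zero_and_eq_of_even_count (even_count_of_cons_pair h)
  have hperm : ∀ X Y Z : ℂ, ({E₀, E₁, E₂, E₃, 1 / 4, 0} : Multiset ℂ) =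
      (1 / 4) ::ₘ (1 / 4) ::ₘ 0 ::ₘ {X, Y, Z} →
      (X = 0 ∧ Y = Z) ∨ (Y = 0 ∧ X = Z) ∨ (Z = 0 ∧ X = Y) :=
    fun X Y Z e => key X Y Z (by rw [← e]; exact h)
  rcases h4 with e | e | e | e
  · rcases hperm E₁ E₂ E₃ (by
      simp only [e, Multiset.insert_eq_cons, ← Multiset.singleton_add]; abel) with
      ⟨f, g⟩ | ⟨f, g⟩ | ⟨f, g⟩
    · exact ⟨E₂, by simp, fun w => by rw [e, f, g]; ring⟩
    · exact ⟨E₁, by simp, fun w => by rw [e, f, g]; ring⟩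
    · exact ⟨E₁, by simp, fun w => by rw [e, f, g]; ring⟩
  · rcases hperm E₂ E₃ E₀ (by
      simp only [e, Multiset.insert_eq_cons, ← Multiset.singleton_add]; abel) with
      ⟨f, g⟩ | ⟨f, g⟩ | ⟨f, g⟩
    · exact ⟨E₃, by simp, fun w => by rw [e, f, g]; ring⟩
    · exact ⟨E₂, by simp, fun w => by rw [e, f, g]; ring⟩
    · exact ⟨E₂, by simp, fun w => by rw [e, f, g]; ring⟩
  · rcases hperm E₁ E₃ E₀ (by
      simp only [e, Multiset.insert_eq_cons, ← Multiset.singleton_add]; abel) with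
      ⟨f, g⟩ | ⟨f, g⟩ | ⟨f, g⟩
    · exact ⟨E₃, by simp, fun w => by rw [e, f, g]; ring⟩
    · exact ⟨E₁, by simp, fun w => by rw [e, f, g]; ring⟩
    · exact ⟨E₁, by simp, fun w => by rw [e, f, g]; ring⟩
  · rcases hperm E₁ E₂ E₀ (by
      simp only [e, Multiset.insert_eq_cons, ← Multiset.singleton_add]; abel) with
      ⟨f, g⟩ | ⟨f, g⟩ | ⟨f, g⟩
    · exact ⟨E₂, by simp, fun w => by rw [e, f, g]; ring⟩
    · exact ⟨E₁, by simp, fun w => by rw [e, f, g]; ring⟩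
    · exact ⟨E₁, by simp, fun w => by rw [e, f, g]; ring⟩

lemma jacobi_factors {E₀ E₁ : ℂ}
    (h : ∀ W : ℂ, W ≠ 0 → Even (({E₀, E₁, 1 / 4, 0} : Multiset ℂ).count W)) :
    (E₀ = 1 / 4 ∧ E₁ = 0) ∨ (E₀ = 0 ∧ E₁ = 1 / 4) := by
  have h4 := h (1 / 4) (by norm_num)
  have h0 := h E₀
  have h1 := h E₁
  norm_num [Multiset.insert_eq_cons, Multiset.count_cons, Multiset.count_singleton] at h4 h0 h1
  grind

lemma contHahn_factors {E₀ E₁ E₂ : ℂ}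
    (h : ∀ W : ℂ, W ≠ 0 → Even (({E₀, E₁, E₂, 1 / 4, 0} : Multiset ℂ).count W)) :
    (E₀ = 1 / 4 ∧ E₁ = E₂) ∨ (E₁ = 1 / 4 ∧ E₀ = E₂) ∨ (E₂ = 1 / 4 ∧ E₀ = E₁) := by
  have h4 := h (1 / 4) (by norm_num)
  have h0 := h E₀
  have h1 := h E₁
  have h2 := h E₂
  norm_num [Multiset.insert_eq_cons, Multiset.count_cons, Multiset.count_singleton] at h4 h0 h1 h2
  grind

/-! ### Positivity of products over conjugation-invariant multisets -/

/-- Remove either a real member, which is positive, or a conjugate pair, which contributes |r|², and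
induct on the cardinality. -/
lemma prod_pos_of_conjPaired (S : Multiset ℂ) (hS : S.map star = S) (hre : ∀ r ∈ S, 0 < r.re) :
    ∃ x : ℝ, 0 < x ∧ S.prod = x := by
  induction hn : S.card using Nat.strong_induction_on generalizing S with
  | _ n ih =>
    rcases S.empty_or_exists_mem with rfl | ⟨r, hr⟩
    · exact ⟨1, one_pos, by simp⟩
    obtain ⟨S', rfl⟩ := Multiset.exists_cons_of_mem hr
    have hr0 := hre r hr
    by_cases hreal : star r = r
    · have hS' : S'.map star = S' := by
        rw [Multiset.map_cons, hreal] at hS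
        exact (Multiset.cons_inj_right r).1 hS
      obtain ⟨x, hx, hprod⟩ := ih S'.card (by rw [← hn, Multiset.card_cons]; omega) S' hS'
        (fun q hq => hre q (Multiset.mem_cons_of_mem hq)) rfl
      refine ⟨r.re * x, mul_pos hr0 hx, ?_⟩
      rw [Multiset.prod_cons, hprod, Complex.ofReal_mul, Complex.conj_eq_iff_re.1 hreal]
    · have hmem : star r ∈ S' := by
        have : star r ∈ r ::ₘ S' := by
          rw [← hS]
          exact Multiset.mem_map_of_mem _ hr
        exact (Multiset.mem_cons.1 this).resolve_left hreal
      obtain ⟨S'', rfl⟩ := Multiset.exists_cons_of_mem hmem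
      have hS'' : S''.map star = S'' := by
        rw [Multiset.map_cons, Multiset.map_cons, star_star, Multiset.cons_swap] at hS
        exact (Multiset.cons_inj_right _).1 ((Multiset.cons_inj_right _).1 hS)
      obtain ⟨x, hx, hprod⟩ := ih S''.card (by rw [← hn]; simp) S'' hS''
        (fun q hq => hre q (Multiset.mem_cons_of_mem (Multiset.mem_cons_of_mem hq))) rfl
      refine ⟨Complex.normSq r * x, mul_pos (Complex.normSq_pos.2 ?_) hx, ?_⟩
      · rintro rfl
        simp at hr0
      · rw [Multiset.prod_cons, Multiset.prod_cons, hprod, Complex.ofReal_mul,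
          Complex.normSq_eq_conj_mul_self, ← mul_assoc]
        congr 1
        rw [mul_comm]
        rfl

/-- The sums of two members of a multiset. -/
def pairSums (s : Multiset ℂ) : Multiset ℂ := (s.powersetCard 2).map Multiset.sum

lemma sum_map_star (s : Multiset ℂ) : (s.map star).sum = star s.sum :=
  (map_multiset_sum (starAddEquiv (R := ℂ)) s).symm

lemma pairSums_map_star {s : Multiset ℂ} (hs : s.map star = s) :
    (pairSums s).map star = pairSums s := by
  conv_rhs => rw [← hs]
  rw [pairSums, pairSums, Multiset.powersetCard_map, Multiset.map_map, Multiset.map_map]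
  refine Multiset.map_congr rfl fun t _ => ?_
  exact (sum_map_star t).symm

lemma pairSums_three (a b c : ℂ) : pairSums {a, b, c} = {a + b, a + c, b + c} := by
  simp only [pairSums, Multiset.insert_eq_cons, ← Multiset.cons_zero,
    Multiset.powersetCard_cons, Multiset.powersetCard_zero_left]
  simp only [Multiset.powersetCard_zero_right, Multiset.map_add, Multiset.map_zero,
    Multiset.map_singleton, Multiset.sum_add, Multiset.sum_singleton, add_zero, zero_add,
    ← Multiset.singleton_add]
  rw [add_comm ({b + c} : Multiset ℂ), add_comm ({a + c} : Multiset ℂ), add_assoc]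

lemma pairSums_four (a b c d : ℂ) :
    pairSums {a, b, c, d} = {a + b, a + c, a + d, b + c, b + d, c + d} := by
  simp only [pairSums, Multiset.insert_eq_cons, ← Multiset.cons_zero,
    Multiset.powersetCard_cons, Multiset.powersetCard_zero_left]
  simp only [Multiset.powersetCard_zero_right, Multiset.map_add, Multiset.map_zero,
    Multiset.map_singleton, Multiset.sum_add, Multiset.sum_singleton, add_zero, zero_add,
    ← Multiset.singleton_add]
  generalize a + b = p, a + c = q, a + d = r, b + c = u, b + d = v, c + d = w
  abel

lemma prod_map_natCast_add_pos {S : Multiset ℂ} (hS : S.map star = S) (hre : ∀ r ∈ S, 0 < r.re)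
    (n : ℕ) : ∃ x : ℝ, 0 < x ∧ (S.map fun r => (n : ℂ) + r).prod = x := by
  refine prod_pos_of_conjPaired _ ?_ ?_
  · conv_rhs => rw [← hS]
    rw [Multiset.map_map, Multiset.map_map]
    refine Multiset.map_congr rfl fun r _ => ?_
    simp
  · intro r hr
    obtain ⟨q, hq, rfl⟩ := Multiset.mem_map.1 hr
    have := hre q hq
    simp only [Complex.add_re, Complex.natCast_re]
    positivity

/-! ### The families with affine diagonal -/

namespace HankelRows

variable {α β : ℕ → ℝ} {h : ℕ → ℂ}

/-- For `α_n = γ √((n+1)(n+δ))` and affine `β`, a nonzero commuting Hankel matrix forces `δ = 1`. -/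
theorem eq_one_of_sqrt_mul (hr : HankelRows α β h) (hne : ∃ k, h k ≠ 0) {γ δ c₁ c₀ : ℝ}
    (hγ : 0 < γ) (hδ : 0 < δ) (hα : ∀ n : ℕ, α n = γ * √((n + 1) * (n + δ)))
    (hβ : ∀ n : ℕ, β n = c₁ * n + c₀) : δ = 1 := by
  have hpos : ∀ n, 0 < α n := by
    intro n
    rw [hα]
    positivity
  -- There is no pole term, so K = 0 and s is an arbitrary positive number. The zeros are −1 and −δ,
  -- and parity makes them coincide.
  have hhalf := hr.exists_half_of_card hne hpos (c₂ := 0) (c₁ := c₁) (c₀ := c₀) (K := 0) (s := 1)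
    one_pos (fun n _ => by rw [hβ, diagForm]; ring) (S := {1, (δ : ℂ)}) (T := 0) (k := γ ^ 2)
    (by positivity) (j := 1) (by simp) (Or.inr (Or.inl ⟨rfl, rfl⟩)) (fun n _ => by
      have : α n ^ 2 = γ ^ 2 * ((n + 1) * (n + δ)) := by
        rw [hα, mul_pow, Real.sq_sqrt (by positivity)]
      have h2 : (α n : ℂ) ^ 2 = γ ^ 2 * ((n + 1) * (n + δ)) := by exact_mod_cast this
      simpa using h2) (fun n _ => by simp)
  obtain ⟨M, hM⟩ := hhalf
  have h1 := even_count_of_eq_two_nsmul hM 1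
  by_contra hne1
  have hne1' : (1 : ℂ) ≠ δ := fun h => hne1 (by exact_mod_cast h.symm)
  simp [Multiset.insert_eq_cons, hne1'] at h1

theorem eRank_le_one_of_sqrt_mul {H : Matrix ℕ ℕ ℂ} (hH : ∀ m n, H m n = h (m + n))
    (hr : HankelRows α β h) (hlim : Tendsto h atTop (𝓝 0)) {γ δ c₁ c₀ : ℝ}
    (hγ : 0 < γ) (hδ : 0 < δ) (hα : ∀ n : ℕ, α n = γ * √((n + 1) * (n + δ)))
    (hβ : ∀ n : ℕ, β n = c₁ * n + c₀) : H.eRank ≤ 1 := by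
  by_cases hne : ∃ k, h k ≠ 0
  · obtain rfl := hr.eq_one_of_sqrt_mul hne hγ hδ hα hβ
    refine eRank_le_one_of_recurrence hH hlim (b := c₁ / γ) fun k => ?_
    refine hr.recurrence_of_affine hγ.ne' (fun n => ?_) hβ k
    rw [hα, Real.sqrt_mul_self (by positivity)]
  · push Not at hne
    exact eRank_le_one_of_eq_zero hH hne

/-- For `α_n = γ √(n+1)` and affine `β`, no nonzero Hankel matrix commutes. -/
theorem eq_zero_of_sqrt (hr : HankelRows α β h) {γ c₁ c₀ : ℝ}
    (hγ : 0 < γ) (hα : ∀ n : ℕ, α n = γ * √(n + 1))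
    (hβ : ∀ n : ℕ, β n = c₁ * n + c₀) : ∀ k, h k = 0 := by
  by_contra! hne
  have hpos : ∀ n, 0 < α n := by
    intro n
    rw [hα]
    positivity
  -- The radicand has odd degree, so α is not an integral power of n times an analytic function of
  -- 1/n. Its growth is checked directly: first differences tend to zero, and α_n = o(n).
  have hsqrt : Tendsto (fun n : ℕ => √((n : ℝ) + 1)) atTop atTop :=
    Real.tendsto_sqrt_atTop.comp
      (tendsto_atTop_add_const_right _ _ (tendsto_natCast_atTop_atTop (R := ℝ)))
  have hdiff : Tendsto (fun n : ℕ => √((n : ℝ) + 1 + 1) - √((n : ℝ) + 1)) atTop (𝓝 0) := by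
    have hsum : Tendsto (fun n : ℕ => √((n : ℝ) + 1 + 1) + √((n : ℝ) + 1)) atTop atTop :=
      tendsto_atTop_mono (fun n => le_add_of_nonneg_left (Real.sqrt_nonneg _)) hsqrt
    refine hsum.inv_tendsto_atTop.congr fun n => ?_
    have e1 : √((n : ℝ) + 1 + 1) ^ 2 = n + 1 + 1 := Real.sq_sqrt (by positivity)
    have e2 : √((n : ℝ) + 1) ^ 2 = n + 1 := Real.sq_sqrt (by positivity)
    rw [Pi.inv_apply]
    refine inv_eq_of_mul_eq_one_right ?_
    linear_combination e1 - e2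
  have hΔ : Tendsto (secondDiff fun n => (α n : ℂ)) atTop (𝓝 0) := by
    have h1 := ((hdiff.comp (tendsto_add_atTop_nat 1)).sub hdiff).const_mul γ
    have h2 := (Complex.continuous_ofReal.tendsto _).comp h1
    simp only [sub_self, mul_zero, Complex.ofReal_zero] at h2
    refine h2.congr fun n => ?_
    simp only [Function.comp, secondDiff, hα]
    push_cast
    rw [show (n : ℝ) + 2 + 1 = n + 1 + 1 + 1 by ring]
    ring
  have hgrow : Tendsto (fun n : ℕ => ((n : ℂ) ^ 1)⁻¹ * (α n : ℂ)) atTop (𝓝 0) := by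
    have hinv := tendsto_inv_atTop_nhds_zero_nat (𝕜 := ℝ)
    have h1 : Tendsto (fun n : ℕ => γ * √((n : ℝ)⁻¹ + (n : ℝ)⁻¹ * (n : ℝ)⁻¹)) atTop (𝓝 0) := by
      simpa using (hinv.add (hinv.mul hinv)).sqrt.const_mul γ
    have h2 := (Complex.continuous_ofReal.tendsto _).comp h1
    simp only [Complex.ofReal_zero] at h2
    refine h2.congr' ?_
    filter_upwards [eventually_ge_atTop 1] with n hn
    have hn0 : (0 : ℝ) < n := Nat.cast_pos.2 (by omega)
    have : √((n : ℝ)⁻¹ + (n : ℝ)⁻¹ * (n : ℝ)⁻¹) = (n : ℝ)⁻¹ * √(n + 1) := by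
      rw [show (n : ℝ)⁻¹ + (n : ℝ)⁻¹ * (n : ℝ)⁻¹ = ((n : ℝ)⁻¹) ^ 2 * (n + 1) by
        field_simp; try ring, Real.sqrt_mul (by positivity), Real.sqrt_sq (by positivity)]
    simp only [Function.comp, this, hα]
    push_cast
    ring
  obtain ⟨M, hM⟩ := hr.exists_half hne hpos (c₂ := 0) (c₁ := c₁) (c₀ := c₀) (K := 0) (s := 1)
    one_pos (fun n _ => by rw [hβ, diagForm]; ring) ⟨0, hΔ⟩ (by
      by_cases h1 : c₁ = 0
      · exact Or.inr (Or.inr ⟨rfl, h1⟩)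
      · exact Or.inr (Or.inl ⟨rfl, h1, 0, hgrow⟩)) (S := {1}) (T := 0) (k := γ ^ 2)
    (by positivity) (fun n _ => by
      have : α n ^ 2 = γ ^ 2 * (n + 1) := by
        rw [hα, mul_pow, Real.sq_sqrt (by positivity)]
      have h2 : (α n : ℂ) ^ 2 = γ ^ 2 * (n + 1) := by exact_mod_cast this
      simpa using h2) (fun n _ => by simp)
  have := even_count_of_eq_two_nsmul hM 1
  simp at this

end HankelRows

section Families

variable {H : Matrix ℕ ℕ ℂ} {h : ℕ → ℂ}

theorem eRank_le_one_meixnerPollaczek (hH : ∀ m n, H m n = h (m + n))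
    (hlim : Tendsto h atTop (𝓝 0)) {l φ : ℝ} (hl : 0 < l) (h0 : 0 < φ) (hπ : φ < Real.pi)
    (hr : HankelRows (meixnerPollaczekα l φ) (meixnerPollaczekβ l φ) h) : H.eRank ≤ 1 := by
  have hsin := Real.sin_pos_of_pos_of_lt_pi h0 hπ
  refine hr.eRank_le_one_of_sqrt_mul hH hlim (γ := 1 / (2 * Real.sin φ)) (δ := 2 * l)
    (c₁ := -(Real.cos φ / Real.sin φ)) (c₀ := -(l * Real.cos φ / Real.sin φ)) (by positivity)
    (by positivity) (fun n => ?_) fun n => ?_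
  · rw [meixnerPollaczekα]
    ring
  · rw [meixnerPollaczekβ]
    ring

theorem eRank_le_one_meixner (hH : ∀ m n, H m n = h (m + n))
    (hlim : Tendsto h atTop (𝓝 0)) {c b : ℝ} (h0 : 0 < c) (h1 : c < 1) (hb : 0 < b)
    (hr : HankelRows (meixnerα c b) (meixnerβ c b) h) : H.eRank ≤ 1 := by
  have hc : 0 < 1 - c := by linarith
  refine hr.eRank_le_one_of_sqrt_mul hH hlim (γ := √c / (1 - c)) (δ := b)
    (c₁ := (1 + c) / (1 - c)) (c₀ := b * c / (1 - c)) (by positivity) hb (fun n => ?_) fun n => ?_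
  · rw [meixnerα, mul_assoc, Real.sqrt_mul h0.le]
    ring
  · rw [meixnerβ]
    ring

theorem eRank_le_one_laguerre (hH : ∀ m n, H m n = h (m + n))
    (hlim : Tendsto h atTop (𝓝 0)) {p : ℝ} (hp : -1 < p)
    (hr : HankelRows (laguerreα p) (laguerreβ p) h) : H.eRank ≤ 1 := by
  refine hr.eRank_le_one_of_sqrt_mul hH hlim (γ := 1) (δ := p + 1) (c₁ := 2) (c₀ := p + 1)
    one_pos (by linarith) (fun n => ?_) fun n => ?_
  · rw [laguerreα, one_mul, add_assoc (n : ℝ) p 1]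
  · rw [laguerreβ]
    ring

theorem eq_zero_charlier {a : ℝ} (ha : 0 < a)
    (hr : HankelRows (charlierα a) (charlierβ a) h) : ∀ k, h k = 0 := by
  refine hr.eq_zero_of_sqrt (γ := √a) (c₁ := 1) (c₀ := a) (by positivity) (fun n => ?_) fun n => ?_
  · rw [charlierα, Real.sqrt_mul ha.le]
  · rw [charlierβ, one_mul]

theorem eq_zero_hermite (hr : HankelRows hermiteα hermiteβ h) : ∀ k, h k = 0 := by
  refine hr.eq_zero_of_sqrt (γ := √(1 / 2)) (c₁ := 0) (c₀ := 0) (by positivity) (fun n => ?_)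
    fun n => ?_
  · rw [hermiteα, ← Real.sqrt_mul (by norm_num)]
    congr 1
    ring
  · simp [hermiteβ]

end Families

/-! ### Square roots of positive complex numbers -/

lemma sqrt_re_pos {z : ℂ} {x : ℝ} (hx : 0 < x) (hz : z = x) : 0 < √z.re := by
  rw [hz, Complex.ofReal_re]
  exact Real.sqrt_pos.2 hx

lemma sq_sqrt_re {z : ℂ} {x : ℝ} (hx : 0 < x) (hz : z = x) : ((√z.re : ℝ) : ℂ) ^ 2 = z := by
  rw [hz, Complex.ofReal_re, ← Complex.ofReal_pow, Real.sq_sqrt hx.le]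

lemma ofReal_eq_of_sq_eq {r : ℝ} (hr : 0 < r) {z : ℂ} (hz : 0 < z.re) (h : (r : ℂ) ^ 2 = z ^ 2) :
    (r : ℂ) = z := by
  rcases sq_eq_sq_iff_eq_or_eq_neg.1 h with h | h
  · exact h
  · have := congrArg Complex.re h
    simp only [Complex.ofReal_re, Complex.neg_re] at this
    linarith

/-- The imaginary parts are opposite, so the real part of the product is the product of the real
parts plus a square. -/
lemma mul_re_pos {z w : ℂ} (hz : 0 < z.re) (hw : 0 < w.re) (h : (z + w).im = 0) :
    0 < (z * w).re := by
  rw [Complex.add_im] at h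
  have : w.im = -z.im := by linarith
  rw [Complex.mul_re, this]
  nlinarith [mul_pos hz hw, sq_nonneg z.im]

lemma sum_im_eq_zero {s : Multiset ℂ} (hs : s.map star = s) : s.sum.im = 0 := by
  have h1 := sum_map_star s
  rw [hs] at h1
  exact Complex.conj_eq_iff_im.1 h1.symm

/-! ### Continuous dual Hahn -/

/-- In the second case a' has nonpositive real part, so b' and c' have positive real parts, and b' +
c' does too. -/
lemma ContDualHahnAdmissible.re_pos {a b c : ℂ} (h : ContDualHahnAdmissible a b c) :
    ∀ r ∈ pairSums {a, b, c}, 0 < r.re := by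
  rcases h.2 with ⟨ha, hb, hc⟩ | ⟨a', b', c', he, -, ha, hb, hc⟩
  · intro r hr
    rw [pairSums_three] at hr
    simp only [Multiset.insert_eq_cons, Multiset.mem_cons, Multiset.mem_singleton] at hr
    rcases hr with rfl | rfl | rfl <;> rw [Complex.add_re] <;> linarith
  · intro r hr
    rw [← he, pairSums_three] at hr
    rw [Complex.add_re] at hb hc
    simp only [Multiset.insert_eq_cons, Multiset.mem_cons, Multiset.mem_singleton] at hr
    rcases hr with rfl | rfl | rfl <;> rw [Complex.add_re] <;> linarith

lemma contDualHahn_prod_pos {a b c : ℂ} (h : ContDualHahnAdmissible a b c) (n : ℕ) :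
    ∃ x : ℝ, 0 < x ∧ contDualHahnA a b c n * contDualHahnC a b c (n + 1) = x := by
  obtain ⟨x, hx, hprod⟩ := prod_map_natCast_add_pos (pairSums_map_star h.1) h.re_pos n
  refine ⟨(n + 1) * x, by positivity, ?_⟩
  rw [pairSums_three] at hprod
  simp only [Multiset.insert_eq_cons, Multiset.map_cons, Multiset.map_singleton,
    Multiset.prod_cons, Multiset.prod_singleton] at hprod
  rw [Complex.ofReal_mul, ← hprod, contDualHahnA, contDualHahnC]
  push_cast
  ring

theorem exists_of_contDualHahn {h : ℕ → ℂ} (hlim : Tendsto h atTop (𝓝 0)) (hne : ∃ k, h k ≠ 0)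
    {a b c : ℂ} (hadm : ContDualHahnAdmissible a b c)
    (hr : HankelRows (contDualHahnα a b c) (contDualHahnβ a b c) h) :
    ∃ t : ℝ, 0 < t ∧ ∃ κ : ℂ, ∀ k : ℕ, h k = κ * ((-1) ^ k / (k + t)) := by
  have hpos : ∀ n, 0 < contDualHahnα a b c n := by
    intro n
    obtain ⟨x, hx, hprod⟩ := contDualHahn_prod_pos hadm n
    exact sqrt_re_pos hx hprod
  have hsq : ∀ n : ℕ, (contDualHahnα a b c n : ℂ) ^ 2 =
      (n + 1) * ((n + (a + b)) * (n + (a + c)) * (n + (b + c))) := by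
    intro n
    obtain ⟨x, hx, hprod⟩ := contDualHahn_prod_pos hadm n
    rw [contDualHahnα, sq_sqrt_re hx hprod, contDualHahnA, contDualHahnC]
    push_cast
    ring
  obtain ⟨σ, hσ⟩ : ∃ σ : ℝ, a + b + c = σ := by
    refine ⟨(a + b + c).re, (Complex.conj_eq_iff_re.1 (Complex.conj_eq_iff_im.2 ?_)).symm⟩
    have := sum_im_eq_zero hadm.1
    simpa [Multiset.insert_eq_cons, add_assoc] using this
  have hβ : ∀ n : ℕ, contDualHahnβ a b c n =
      2 * n ^ 2 + (2 * σ - 1) * n + (a * b + a * c + b * c).re := by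
    intro n
    rw [contDualHahnβ, contDualHahnA, contDualHahnC]
    have : (n + a + b) * (n + a + c) + n * (n + b + c - 1) - a ^ 2 =
        ((2 * n ^ 2 + (2 * σ - 1) * n : ℝ) : ℂ) + (a * b + a * c + b * c) := by
      push_cast
      rw [← hσ]
      ring
    rw [this, Complex.add_re, Complex.ofReal_re]
  have hre := hadm.re_pos
  rw [pairSums_three] at hre
  simp only [Multiset.insert_eq_cons, Multiset.mem_cons, Multiset.mem_singleton] at hre
  have hpair := pairing_of_half (u := a + b) (v := a + c) (w := b + c) (by
    have := hr.exists_half_of_card hne hpos (c₂ := 2) (c₁ := 2 * σ - 1)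
      (c₀ := (a * b + a * c + b * c).re) (K := 0) (s := 1) one_pos
      (fun n _ => by rw [hβ, diagForm]; ring) (S := {1, a + b, a + c, b + c}) (T := 0) (k := 1)
      one_pos (j := 2) (by simp) (Or.inl ⟨rfl, two_ne_zero⟩) (fun n _ => by
        rw [hsq]
        simp [Multiset.insert_eq_cons, mul_assoc]) (fun n _ => by simp)
    simpa using this)
  obtain ⟨q, hq, hsum, hprod⟩ : ∃ q : ℂ, 0 < q.re ∧ 2 * (σ : ℂ) = 1 + 2 * q ∧
      ∀ n : ℕ, (n + (a + b)) * (n + (a + c)) * (n + (b + c)) = (n + 1) * ((n : ℂ) + q) ^ 2 := by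
    rcases hpair with ⟨h1, h2⟩ | ⟨h1, h2⟩ | ⟨h1, h2⟩
    · refine ⟨b + c, hre _ (by simp), ?_, fun n => by rw [h1, h2]; ring⟩
      rw [← hσ]
      linear_combination h1 + h2
    · refine ⟨b + c, hre _ (by simp), ?_, fun n => by rw [h1, h2]; ring⟩
      rw [← hσ]
      linear_combination h1 + h2
    · refine ⟨a + c, hre _ (by simp), ?_, fun n => by rw [h1, h2]; ring⟩
      rw [← hσ]
      linear_combination h1 + h2
  -- The double zero is real because the sum of the parameters is.
  obtain ⟨r, rfl⟩ : ∃ r : ℝ, q = r := ⟨σ - 1 / 2, by push_cast; linear_combination -hsum / 2⟩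
  have hσr : 2 * σ = 1 + 2 * r := by exact_mod_cast hsum
  rw [Complex.ofReal_re] at hq
  refine hr.exists_of_quadratic hpos hlim hne (γ := 1) (s := 1 + r)
    (c₀ := (a * b + a * c + b * c).re) one_pos (by linarith) (p := 1) (q := r)
    (by push_cast; rfl) (fun n _ => ?_) fun n _ => ?_
  · refine ofReal_eq_of_sq_eq (hpos n) ?_ ?_
    · have : (((1 : ℝ) : ℂ) * ((n + 1) * (n + r))) = ((n + 1) * (n + r) : ℝ) := by
        push_cast
        ring
      rw [this, Complex.ofReal_re]
      positivity
    · rw [hsq, hprod]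
      push_cast
      ring
  · rw [hβ]
    linear_combination (n : ℝ) * hσr

/-! ### Wilson -/

lemma WilsonAdmissible.re_pos {a b c d : ℂ} (h : WilsonAdmissible a b c d) :
    ∀ r ∈ pairSums {a, b, c, d}, 0 < r.re := by
  rcases h.2 with ⟨ha, hb, hc, hd⟩ | ⟨a', b', c', d', he, -, ha, hb, hc, hd⟩
  · intro r hr
    rw [pairSums_four] at hr
    simp only [Multiset.insert_eq_cons, Multiset.mem_cons, Multiset.mem_singleton] at hr
    rcases hr with rfl | rfl | rfl | rfl | rfl | rfl <;> rw [Complex.add_re] <;> linarith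
  · intro r hr
    rw [← he, pairSums_four] at hr
    rw [Complex.add_re] at hb hc hd
    simp only [Multiset.insert_eq_cons, Multiset.mem_cons, Multiset.mem_singleton] at hr
    rcases hr with rfl | rfl | rfl | rfl | rfl | rfl <;> rw [Complex.add_re] <;> linarith

lemma wilsonA_of_pos (a b c d : ℂ) {n : ℕ} (hn : 1 ≤ n) : wilsonA a b c d n =
    (n + a + b) * (n + a + c) * (n + a + d) * (n + a + b + c + d - 1) /
      ((2 * n + a + b + c + d - 1) * (2 * n + a + b + c + d)) := by
  obtain ⟨k, rfl⟩ := Nat.exists_eq_add_of_le' hn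
  rfl

lemma wilsonC_of_pos (a b c d : ℂ) {n : ℕ} (hn : 1 ≤ n) : wilsonC a b c d n =
    n * (n + b + c - 1) * (n + b + d - 1) * (n + c + d - 1) /
      ((2 * n + a + b + c + d - 2) * (2 * n + a + b + c + d - 1)) := by
  obtain ⟨k, rfl⟩ := Nat.exists_eq_add_of_le' hn
  rfl

/-- The partial fraction decomposition behind the diagonal of the Wilson matrix. -/
lemma wilson_partial_fraction {η e₀ e₁ e₂ e₃ : ℂ} (h0 : η ≠ 0) (h1 : 2 * η + 1 ≠ 0)
    (h2 : 2 * η - 1 ≠ 0) :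
    (η + 1 / 2 + e₁) * (η + 1 / 2 + e₂) * (η + 1 / 2 + e₃) * (η + 1 / 2 - e₀) /
        (2 * η * (2 * η + 1)) +
      (η - 1 / 2 + e₀) * (η - 1 / 2 - e₁) * (η - 1 / 2 - e₂) * (η - 1 / 2 - e₃) /
        ((2 * η - 1) * (2 * η)) =
    η ^ 2 / 2 + (3 / 8 + (e₁ + e₂ + e₃ - e₀) / 2 +
      (e₁ * e₂ + e₁ * e₃ + e₂ * e₃ - e₀ * (e₁ + e₂ + e₃)) / 2) +
      -2 * (e₀ * e₁ * e₂ * e₃) / ((2 * η - 1) * (2 * η + 1)) := by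
  obtain ⟨u, rfl⟩ : ∃ u, η = (u + 1) / 2 := ⟨2 * η - 1, by ring⟩
  rw [show 2 * ((u + 1) / 2) + 1 = u + 2 by ring] at *
  rw [show 2 * ((u + 1) / 2) - 1 = u by ring] at *
  rw [show 2 * ((u + 1) / 2) = u + 1 by ring]
  have h3 : u + 1 ≠ 0 := fun h => h0 (by rw [h, zero_div])
  field_simp
  ring

section

variable {a b c d : ℂ} {s : ℝ}

lemma exists_real_sum (h : ConjPaired {a, b, c, d}) : ∃ s : ℝ, a + b + c + d = s := by
  refine ⟨(a + b + c + d).re, (Complex.conj_eq_iff_re.1 (Complex.conj_eq_iff_im.2 ?_)).symm⟩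
  have := sum_im_eq_zero h
  simpa [Multiset.insert_eq_cons, add_assoc] using this

lemma wilson_sum_pos (hadm : WilsonAdmissible a b c d) (hs : a + b + c + d = s) : 0 < s := by
  have hre := hadm.re_pos
  rw [pairSums_four] at hre
  simp only [Multiset.insert_eq_cons, Multiset.mem_cons, Multiset.mem_singleton] at hre
  have h1 := hre (a + b) (by simp)
  have h2 := hre (c + d) (by simp)
  have h3 := congrArg Complex.re hs
  simp only [Complex.add_re, Complex.ofReal_re] at h1 h2 h3
  linarith

lemma wilson_prod_of_pos (hs : a + b + c + d = s) (h0 : 0 < s) {n : ℕ} (hn : 1 ≤ n) :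
    wilsonA a b c d n * wilsonC a b c d (n + 1) * (16 * ((n + (s - 1) / 2) * (n + (s + 1) / 2) *
      (n + s / 2) ^ 2)) = (n + 1) * (n + (s - 1)) * ((n + (a + b)) * (n + (a + c)) * (n + (a + d)) *
      (n + (b + c)) * (n + (b + d)) * (n + (c + d))) := by
  have h1n : (1 : ℝ) ≤ n := by exact_mod_cast hn
  have hd1 : 2 * (n : ℂ) + s - 1 ≠ 0 := by
    have : 2 * (n : ℝ) + s - 1 ≠ 0 := by linarith
    exact_mod_cast this
  have hd2 : 2 * (n : ℂ) + s ≠ 0 := by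
    have : 2 * (n : ℝ) + s ≠ 0 := by linarith
    exact_mod_cast this
  have hd3 : 2 * (n : ℂ) + s + 1 ≠ 0 := by
    have : 2 * (n : ℝ) + s + 1 ≠ 0 := by linarith
    exact_mod_cast this
  rw [wilsonA_of_pos _ _ _ _ hn, wilsonC_of_pos _ _ _ _ (by omega)]
  push_cast
  rw [show 2 * (n : ℂ) + a + b + c + d - 1 = 2 * n + s - 1 by rw [← hs]; ring,
    show 2 * (n : ℂ) + a + b + c + d = 2 * n + s by rw [← hs]; ring,
    show 2 * ((n : ℂ) + 1) + a + b + c + d - 2 = 2 * n + s by rw [← hs]; ring,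
    show 2 * ((n : ℂ) + 1) + a + b + c + d - 1 = 2 * n + s + 1 by rw [← hs]; ring,
    show (n : ℂ) + a + b + c + d - 1 = n + (s - 1) by rw [← hs]; ring]
  rw [div_mul_div_comm, div_mul_eq_mul_div, div_eq_iff
    (mul_ne_zero (mul_ne_zero hd1 hd2) (mul_ne_zero hd2 hd3)),
    show (n : ℂ) + a + b = n + (a + b) by ring, show (n : ℂ) + a + c = n + (a + c) by ring,
    show (n : ℂ) + a + d = n + (a + d) by ring, show (n : ℂ) + 1 + b + c - 1 = n + (b + c) by ring,
    show (n : ℂ) + 1 + b + d - 1 = n + (b + d) by ring,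
    show (n : ℂ) + 1 + c + d - 1 = n + (c + d) by ring,
    show (n : ℂ) + (s - 1) / 2 = (2 * n + s - 1) / 2 by ring,
    show (n : ℂ) + (s + 1) / 2 = (2 * n + s + 1) / 2 by ring,
    show (n : ℂ) + s / 2 = (2 * n + s) / 2 by ring]
  generalize (n : ℂ) + (a + b) = p₁, (n : ℂ) + (a + c) = p₂, (n : ℂ) + (a + d) = p₃,
    (n : ℂ) + (b + c) = p₄, (n : ℂ) + (b + d) = p₅, (n : ℂ) + (c + d) = p₆,
    (n : ℂ) + (s - 1) = p₇, (n : ℂ) + 1 = p₈, 2 * (n : ℂ) + s - 1 = d₁, 2 * (n : ℂ) + s + 1 = d₂,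
    2 * (n : ℂ) + s = d₃
  ring

lemma wilson_prod_pos (hadm : WilsonAdmissible a b c d) (n : ℕ) :
    ∃ x : ℝ, 0 < x ∧ wilsonA a b c d n * wilsonC a b c d (n + 1) = x := by
  obtain ⟨s, hs⟩ := exists_real_sum hadm.1
  have h0 := wilson_sum_pos hadm hs
  obtain ⟨x, hx, hprod⟩ := prod_map_natCast_add_pos (pairSums_map_star hadm.1) hadm.re_pos n
  rw [pairSums_four] at hprod
  simp only [Multiset.insert_eq_cons, Multiset.map_cons, Multiset.map_singleton,
    Multiset.prod_cons, Multiset.prod_singleton] at hprod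
  rcases Nat.eq_zero_or_pos n with rfl | hn
  -- At n = 0 the factor s − 1, possibly zero or negative, has been cancelled in A_0.
  · refine ⟨x / (s ^ 2 * (s + 1)), by positivity, ?_⟩
    have hs0 : (s : ℂ) ≠ 0 := Complex.ofReal_ne_zero.2 h0.ne'
    have hs1 : (s : ℂ) + 1 ≠ 0 := by
      have : s + 1 ≠ 0 := by linarith
      exact_mod_cast this
    push_cast
    rw [← hprod, wilsonC_of_pos _ _ _ _ le_rfl, wilsonA, hs]
    push_cast
    rw [show 2 * (1 : ℂ) + a + b + c + d - 2 = s by rw [← hs]; ring,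
      show 2 * (1 : ℂ) + a + b + c + d - 1 = s + 1 by rw [← hs]; ring, div_mul_div_comm,
      div_eq_div_iff (mul_ne_zero hs0 (mul_ne_zero hs0 hs1))
        (mul_ne_zero (pow_ne_zero 2 hs0) hs1), show 1 + b + c - 1 = b + c by ring,
      show 1 + b + d - 1 = b + d by ring, show 1 + c + d - 1 = c + d by ring]
    simp only [zero_add]
    generalize a + b = p₁, a + c = p₂, a + d = p₃, b + c = p₄, b + d = p₅, c + d = p₆
    ring
  · have h1n : (1 : ℝ) ≤ n := by exact_mod_cast hn
    have hden : 0 < 16 * (((n : ℝ) + (s - 1) / 2) * (n + (s + 1) / 2) * (n + s / 2) ^ 2) := by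
      have h1 : 0 < (n : ℝ) + (s - 1) / 2 := by linarith
      have h2 : 0 < (n : ℝ) + (s + 1) / 2 := by linarith
      have h3 : 0 < (n : ℝ) + s / 2 := by linarith
      positivity
    have hnum : 0 < ((n : ℝ) + 1) * (n + (s - 1)) * x := by
      have h2 : 0 < (n : ℝ) + (s - 1) := by linarith
      positivity
    refine ⟨_, div_pos hnum hden, ?_⟩
    have hden' := Complex.ofReal_ne_zero.2 hden.ne'
    push_cast at hden' ⊢
    rw [eq_div_iff hden', wilson_prod_of_pos hs h0 hn, ← hprod]
    generalize (n : ℂ) + (a + b) = p₁, (n : ℂ) + (a + c) = p₂, (n : ℂ) + (a + d) = p₃,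
      (n : ℂ) + (b + c) = p₄, (n : ℂ) + (b + d) = p₅, (n : ℂ) + (c + d) = p₆
    ring

/-- In the centred variable η = n + (s − 1)/2 the factors of A_n are η + 1/2 shifted by −e₀, e₁, e₂,
e₃, and those of C_n are η − 1/2 shifted oppositely, so `wilson_partial_fraction` applies. Only the
pole coefficient matters later; c₀ stays unspecified. -/
lemma wilsonβ_eq (hs : a + b + c + d = s) (h0 : 0 < s) : ∃ c₀ : ℝ, ∀ n : ℕ, 1 ≤ n →
    wilsonβ a b c d n = diagForm (1 / 2) ((s - 1) / 2) c₀
      (-2 * ((1 - s / 2) * ((a + b - c - d) / 2) * ((a + c - b - d) / 2) *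
        ((a + d - b - c) / 2))).re s n := by
  set e₀ : ℂ := 1 - s / 2 with he0
  set e₁ := (a + b - c - d) / 2 with he1
  set e₂ := (a + c - b - d) / 2 with he2
  set e₃ := (a + d - b - c) / 2 with he3
  refine ⟨((3 / 8 + (e₁ + e₂ + e₃ - e₀) / 2 +
      (e₁ * e₂ + e₁ * e₃ + e₂ * e₃ - e₀ * (e₁ + e₂ + e₃)) / 2) - a ^ 2 +
      (((s - 1) ^ 2 / 8 : ℝ) : ℂ)).re, fun n hn => ?_⟩
  have h1n : (1 : ℝ) ≤ n := by exact_mod_cast hn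
  set η : ℂ := n + (s - 1) / 2 with hη
  have hd0 : η ≠ 0 := by
    have : (n : ℝ) + (s - 1) / 2 ≠ 0 := by linarith
    rw [hη]
    exact_mod_cast this
  have hd1 : 2 * η + 1 ≠ 0 := by
    have : 2 * ((n : ℝ) + (s - 1) / 2) + 1 ≠ 0 := by linarith
    rw [hη]
    exact_mod_cast this
  have hd2 : 2 * η - 1 ≠ 0 := by
    have : 2 * ((n : ℝ) + (s - 1) / 2) - 1 ≠ 0 := by linarith
    rw [hη]
    exact_mod_cast this
  have hpf := wilson_partial_fraction (e₀ := e₀) (e₁ := e₁) (e₂ := e₂) (e₃ := e₃) hd0 hd1 hd2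
  have hAC : wilsonA a b c d n + wilsonC a b c d n - a ^ 2 =
      ((1 / 2 * n ^ 2 + (s - 1) / 2 * n : ℝ) : ℂ) +
      ((3 / 8 + (e₁ + e₂ + e₃ - e₀) / 2 +
      (e₁ * e₂ + e₁ * e₃ + e₂ * e₃ - e₀ * (e₁ + e₂ + e₃)) / 2) - a ^ 2 +
      (((s - 1) ^ 2 / 8 : ℝ) : ℂ)) +
      -2 * (e₀ * e₁ * e₂ * e₃) / (((2 * n + s - 2) * (2 * n + s) : ℝ) : ℂ) := by
    rw [wilsonA_of_pos _ _ _ _ hn, wilsonC_of_pos _ _ _ _ hn,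
      show (n : ℂ) + a + b = η + 1 / 2 + e₁ by rw [hη, he1, ← hs]; ring,
      show (n : ℂ) + a + c = η + 1 / 2 + e₂ by rw [hη, he2, ← hs]; ring,
      show (n : ℂ) + a + d = η + 1 / 2 + e₃ by rw [hη, he3, ← hs]; ring,
      show η + 1 / 2 + e₁ + c + d - 1 = η + 1 / 2 - e₀ by rw [hη, he0, he1, ← hs]; ring,
      show 2 * (n : ℂ) + a + b + c + d - 1 = 2 * η by rw [hη, ← hs]; ring,
      show 2 * (n : ℂ) + a + b + c + d - 2 = 2 * η - 1 by rw [hη, ← hs]; ring,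
      show 2 * (n : ℂ) + a + b + c + d = 2 * η + 1 by rw [hη, ← hs]; ring,
      show (n : ℂ) + b + c - 1 = η - 1 / 2 - e₃ by rw [hη, he3, ← hs]; ring,
      show (n : ℂ) + b + d - 1 = η - 1 / 2 - e₂ by rw [hη, he2, ← hs]; ring,
      show (n : ℂ) + c + d - 1 = η - 1 / 2 - e₁ by rw [hη, he1, ← hs]; ring,
      show (((2 * n + s - 2) * (2 * n + s) : ℝ) : ℂ) = (2 * η - 1) * (2 * η + 1) by
        rw [hη]; push_cast; ring]
    have hn' : (n : ℂ) = η - 1 / 2 + e₀ := by rw [hη, he0]; ring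
    have hs' : (s : ℂ) = 2 - 2 * e₀ := by rw [he0]; ring
    push_cast
    rw [hs', hn']
    linear_combination hpf
  rw [wilsonβ, hAC, Complex.add_re, Complex.add_re, Complex.ofReal_re, Complex.div_ofReal_re,
    diagForm]

theorem exists_of_wilson {h : ℕ → ℂ} (hlim : Tendsto h atTop (𝓝 0)) (hne : ∃ k, h k ≠ 0)
    (hadm : WilsonAdmissible a b c d)
    (hr : HankelRows (wilsonα a b c d) (wilsonβ a b c d) h) :
    ∃ t : ℝ, 0 < t ∧ ∃ κ : ℂ, ∀ k : ℕ, h k = κ * ((-1) ^ k / (k + t)) := by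
  obtain ⟨s, hs⟩ := exists_real_sum hadm.1
  have h0 := wilson_sum_pos hadm hs
  have hpos : ∀ n, 0 < wilsonα a b c d n := by
    intro n
    obtain ⟨x, hx, hprod⟩ := wilson_prod_pos hadm n
    exact sqrt_re_pos hx hprod
  have hsq : ∀ n : ℕ, 1 ≤ n → (wilsonα a b c d n : ℂ) ^ 2 *
      (16 * ((n + (s - 1) / 2) * (n + (s + 1) / 2) * (n + s / 2) ^ 2)) =
      (n + 1) * (n + (s - 1)) * ((n + (a + b)) * (n + (a + c)) * (n + (a + d)) *
      (n + (b + c)) * (n + (b + d)) * (n + (c + d))) := by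
    intro n hn
    obtain ⟨x, hx, hprod⟩ := wilson_prod_pos hadm n
    rw [wilsonα, sq_sqrt_re hx hprod, wilson_prod_of_pos hs h0 hn]
  have hden : ∀ n : ℕ, 1 ≤ n →
      ((n : ℂ) + (s - 1) / 2) * (n + (s + 1) / 2) * (n + s / 2) ^ 2 ≠ 0 := by
    intro n hn
    have h1n : (1 : ℝ) ≤ n := by exact_mod_cast hn
    have h1 : 0 < (n : ℝ) + (s - 1) / 2 := by linarith
    have h2 : 0 < (n : ℝ) + (s + 1) / 2 := by linarith
    have h3 : 0 < (n : ℝ) + s / 2 := by linarith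
    have : ((n : ℝ) + (s - 1) / 2) * (n + (s + 1) / 2) * (n + s / 2) ^ 2 ≠ 0 := by positivity
    exact_mod_cast this
  obtain ⟨c₀, hβ⟩ := wilsonβ_eq hs h0
  set e₀ : ℂ := 1 - s / 2 with he0
  set e₁ := (a + b - c - d) / 2 with he1
  set e₂ := (a + c - b - d) / 2 with he2
  set e₃ := (a + d - b - c) / 2 with he3
  obtain ⟨M, hM⟩ := hr.exists_half_of_card hne hpos h0 hβ
    (S := {1, (s : ℂ) - 1, a + b, a + c, a + d, b + c, b + d, c + d})
    (T := {((s : ℂ) - 1) / 2, ((s : ℂ) + 1) / 2, (s : ℂ) / 2, (s : ℂ) / 2}) (k := 1 / 16)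
    (by norm_num) (j := 2) (by simp) (Or.inl ⟨rfl, by norm_num⟩) (fun n hn => by
      simp only [Multiset.insert_eq_cons, Multiset.map_cons, Multiset.map_singleton,
        Multiset.prod_cons, Multiset.prod_singleton]
      push_cast
      have := hsq n hn
      generalize (n : ℂ) + (a + b) = p₁, (n : ℂ) + (a + c) = p₂, (n : ℂ) + (a + d) = p₃,
        (n : ℂ) + (b + c) = p₄, (n : ℂ) + (b + d) = p₅, (n : ℂ) + (c + d) = p₆,
        (n : ℂ) + (s - 1) = p₇, (n : ℂ) + 1 = p₈, (n : ℂ) + (s - 1) / 2 = d₁,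
        (n : ℂ) + (s + 1) / 2 = d₂, (n : ℂ) + s / 2 = d₃ at this ⊢
      linear_combination this / 16) (fun n hn => by
      simp only [Multiset.insert_eq_cons, Multiset.map_cons, Multiset.map_singleton,
        Multiset.prod_cons, Multiset.prod_singleton]
      convert hden n hn using 1
      ring)
  -- All twelve zeros and poles pair off around s/2: 1 with s − 1, each pair sum with the
  -- complementary one, (s + 1)/2 with (s − 1)/2, and s/2 with itself.
  have hL : (({e₀, e₁, e₂, e₃, 1 / 2, 0} : Multiset ℂ).map fun e => (s : ℂ) / 2 + e) +
      (({e₀, e₁, e₂, e₃, 1 / 2, 0} : Multiset ℂ).map fun e => (s : ℂ) / 2 - e) = 2 • M := by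
    rw [← hM]
    simp only [Multiset.insert_eq_cons, Multiset.map_cons, Multiset.map_singleton]
    rw [show (s : ℂ) / 2 + e₀ = 1 by rw [he0]; ring, show (s : ℂ) / 2 - e₀ = s - 1 by rw [he0]; ring,
      show (s : ℂ) / 2 + e₁ = a + b by rw [he1, ← hs]; ring,
      show (s : ℂ) / 2 - e₁ = c + d by rw [he1, ← hs]; ring,
      show (s : ℂ) / 2 + e₂ = a + c by rw [he2, ← hs]; ring,
      show (s : ℂ) / 2 - e₂ = b + d by rw [he2, ← hs]; ring,
      show (s : ℂ) / 2 + e₃ = a + d by rw [he3, ← hs]; ring,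
      show (s : ℂ) / 2 - e₃ = b + c by rw [he3, ← hs]; ring,
      show (s : ℂ) / 2 + 1 / 2 = (s + 1) / 2 by ring,
      show (s : ℂ) / 2 - 1 / 2 = (s - 1) / 2 by ring, add_zero, sub_zero]
    simp only [← Multiset.singleton_add]
    generalize a + b = p₁, a + c = p₂, a + d = p₃, b + c = p₄, b + d = p₅, c + d = p₆
    abel
  obtain ⟨E, hE, hfac⟩ := wilson_factors (E₀ := e₀ ^ 2) (E₁ := e₁ ^ 2) (E₂ := e₂ ^ 2)
    (E₃ := e₃ ^ 2) (fun W hW => by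
      have := even_count_sq hL W hW
      simp only [Multiset.insert_eq_cons, Multiset.map_cons, Multiset.map_singleton] at this
      norm_num at this
      simpa [Multiset.insert_eq_cons] using this)
  -- At w = 0 the factorisation says that some e_i vanishes, so the diagonal loses its pole.
  have hK : -2 * (e₀ * e₁ * e₂ * e₃) = 0 := by
    have := hfac 0
    have h2 : (e₀ * e₁ * e₂ * e₃) ^ 2 = 0 := by linear_combination this
    rw [pow_eq_zero_iff two_ne_zero] at h2
    rw [h2, mul_zero]
  have hre := hadm.re_pos
  rw [pairSums_four] at hre
  simp only [Multiset.insert_eq_cons, Multiset.mem_cons, Multiset.mem_singleton] at hre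
  obtain ⟨p, q, hp, hq, hpq, hpqE⟩ : ∃ p q : ℂ, 0 < p.re ∧ 0 < q.re ∧ p + q = s ∧
      ∀ x : ℂ, (x + p) * (x + q) = (x + s / 2) ^ 2 - E := by
    rcases hE with rfl | rfl | rfl
    · refine ⟨a + b, c + d, hre _ (by simp), hre _ (by simp), by rw [← hs]; ring, fun x => ?_⟩
      rw [he1, ← hs]
      ring
    · refine ⟨a + c, b + d, hre _ (by simp), hre _ (by simp), by rw [← hs]; ring, fun x => ?_⟩
      rw [he2, ← hs]
      ring
    · refine ⟨a + d, b + c, hre _ (by simp), hre _ (by simp), by rw [← hs]; ring, fun x => ?_⟩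
      rw [he3, ← hs]
      ring
  -- With w = (n + s/2)² the factors w(w − 1/4) cancel and α_n² = (w − E)²/16. Positive real parts
  -- of p and q select the root α_n = (n + p)(n + q)/4.
  refine hr.exists_of_quadratic hpos hlim hne (γ := 1 / 4) (s := s) (c₀ := c₀) (by norm_num) h0
    hpq (fun n hn => ?_) fun n hn => ?_
  · refine ofReal_eq_of_sq_eq (hpos n) ?_ ?_
    · rw [Complex.re_ofReal_mul]
      refine mul_pos (by norm_num) (mul_re_pos ?_ ?_ ?_)
      · rw [Complex.add_re, Complex.natCast_re]
        positivity
      · rw [Complex.add_re, Complex.natCast_re]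
        positivity
      · have := congrArg Complex.im hpq
        simpa using this
    · rw [hpqE]
      apply mul_right_cancel₀ (mul_ne_zero (by norm_num : (16 : ℂ) ≠ 0) (hden n hn))
      rw [hsq n hn]
      have := hfac ((n + s / 2) ^ 2)
      push_cast
      have e : ((n : ℂ) + 1) * (n + (s - 1)) * ((n + (a + b)) * (n + (a + c)) * (n + (a + d)) *
          (n + (b + c)) * (n + (b + d)) * (n + (c + d))) = ((n + s / 2) ^ 2 - e₀ ^ 2) *
          ((n + s / 2) ^ 2 - e₁ ^ 2) * ((n + s / 2) ^ 2 - e₂ ^ 2) * ((n + s / 2) ^ 2 - e₃ ^ 2) := by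
        rw [show ((n : ℂ) + s / 2) ^ 2 - e₀ ^ 2 = (n + 1) * (n + (s - 1)) by rw [he0]; ring,
          show ((n : ℂ) + s / 2) ^ 2 - e₁ ^ 2 = (n + (a + b)) * (n + (c + d)) by
            rw [he1, ← hs]; ring,
          show ((n : ℂ) + s / 2) ^ 2 - e₂ ^ 2 = (n + (a + c)) * (n + (b + d)) by
            rw [he2, ← hs]; ring,
          show ((n : ℂ) + s / 2) ^ 2 - e₃ ^ 2 = (n + (a + d)) * (n + (b + c)) by
            rw [he3, ← hs]; ring]
        generalize (n : ℂ) + (a + b) = p₁, (n : ℂ) + (a + c) = p₂, (n : ℂ) + (a + d) = p₃,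
          (n : ℂ) + (b + c) = p₄, (n : ℂ) + (b + d) = p₅, (n : ℂ) + (c + d) = p₆
        ring
      rw [e, this]
      ring
  · rw [hβ n hn, hK, diagForm]
    simp only [Complex.zero_re, zero_div, add_zero]
    ring

end

/-! ### Jacobi -/

lemma jacobiα_of_pos (p q : ℝ) {n : ℕ} (hn : 1 ≤ n) : jacobiα p q n =
    √(4 * (n + 1) * (n + p + 1) * (n + q + 1) * (n + p + q + 1) /
      ((2 * n + p + q + 1) * (2 * n + p + q + 2) ^ 2 * (2 * n + p + q + 3))) := by
  obtain ⟨k, rfl⟩ := Nat.exists_eq_add_of_le' hn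
  rfl

lemma jacobiβ_of_pos (p q : ℝ) {n : ℕ} (hn : 1 ≤ n) : jacobiβ p q n =
    (q ^ 2 - p ^ 2) / ((2 * n + p + q) * (2 * n + p + q + 2)) := by
  obtain ⟨k, rfl⟩ := Nat.exists_eq_add_of_le' hn
  rfl

lemma jacobiα_pos {p q : ℝ} (hp : -1 < p) (hq : -1 < q) (n : ℕ) : 0 < jacobiα p q n := by
  have hp' : 0 < p + 1 := by linarith
  have hq' : 0 < q + 1 := by linarith
  have h2 : 0 < p + q + 2 := by linarith
  have h3 : 0 < p + q + 3 := by linarith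
  rcases Nat.eq_zero_or_pos n with rfl | hn
  · rw [jacobiα]
    positivity
  · have h1n : (1 : ℝ) ≤ n := by exact_mod_cast hn
    rw [jacobiα_of_pos p q hn]
    have e1 : 0 < (n : ℝ) + p + 1 := by linarith
    have e2 : 0 < (n : ℝ) + q + 1 := by linarith
    have e3 : 0 < (n : ℝ) + p + q + 1 := by linarith
    have e4 : 0 < 2 * (n : ℝ) + p + q + 1 := by linarith
    have e5 : 0 < 2 * (n : ℝ) + p + q + 2 := by linarith
    have e6 : 0 < 2 * (n : ℝ) + p + q + 3 := by linarith
    positivity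

lemma jacobiα_sq {p q : ℝ} (hp : -1 < p) (hq : -1 < q) {n : ℕ} (hn : 1 ≤ n) :
    jacobiα p q n ^ 2 * ((n + (p + q + 1) / 2) * (n + (p + q + 3) / 2) * (n + (p + q + 2) / 2) ^ 2) =
      1 / 4 * ((n + 1) * (n + (p + q + 1)) * (n + (p + 1)) * (n + (q + 1))) := by
  have h1n : (1 : ℝ) ≤ n := by exact_mod_cast hn
  have e1 : 0 < (n : ℝ) + p + 1 := by linarith
  have e2 : 0 < (n : ℝ) + q + 1 := by linarith
  have e3 : 0 < (n : ℝ) + p + q + 1 := by linarith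
  have e4 : 0 < 2 * (n : ℝ) + p + q + 1 := by linarith
  have e5 : 0 < 2 * (n : ℝ) + p + q + 2 := by linarith
  have e6 : 0 < 2 * (n : ℝ) + p + q + 3 := by linarith
  rw [jacobiα_of_pos p q hn, Real.sq_sqrt (by positivity), div_mul_eq_mul_div,
    div_eq_iff (by positivity)]
  ring

/-- Only the four Chebyshev cases survive, and there `h` is geometric. -/
theorem geometric_of_jacobi {h : ℕ → ℂ} (hne : ∃ k, h k ≠ 0) {p q : ℝ} (hp : -1 < p) (hq : -1 < q)
    (hr : HankelRows (jacobiα p q) (jacobiβ p q) h) : ∃ r : ℂ, ∀ k, h (k + 1) = r * h k := by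
  have hs : 0 < p + q + 2 := by linarith
  have hden : ∀ n : ℕ, 1 ≤ n → 0 < ((n : ℝ) + (p + q + 1) / 2) * (n + (p + q + 3) / 2) *
      (n + (p + q + 2) / 2) ^ 2 := by
    intro n hn
    have h1n : (1 : ℝ) ≤ n := by exact_mod_cast hn
    have h1 : 0 < (n : ℝ) + (p + q + 1) / 2 := by linarith
    have h2 : 0 < (n : ℝ) + (p + q + 3) / 2 := by linarith
    have h3 : 0 < (n : ℝ) + (p + q + 2) / 2 := by linarith
    positivity
  have hβ : ∀ n : ℕ, 1 ≤ n →
      jacobiβ p q n = diagForm 0 0 0 (q ^ 2 - p ^ 2) (p + q + 2) n := by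
    intro n hn
    rw [jacobiβ_of_pos p q hn, diagForm,
      show 2 * (n : ℝ) + (p + q + 2) - 2 = 2 * n + p + q by ring,
      show 2 * (n : ℝ) + (p + q + 2) = 2 * n + p + q + 2 by ring]
    ring
  obtain ⟨M, hM⟩ := hr.exists_half_of_card hne (jacobiα_pos hp hq) hs hβ
    (S := {1, (p : ℂ) + q + 1, (p : ℂ) + 1, (q : ℂ) + 1})
    (T := {((p : ℂ) + q + 1) / 2, ((p : ℂ) + q + 3) / 2, ((p : ℂ) + q + 2) / 2,
      ((p : ℂ) + q + 2) / 2}) (k := 1 / 4)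
    (by norm_num) (j := 0) (by simp) (Or.inr (Or.inr ⟨rfl, rfl, rfl⟩)) (fun n hn => by
      have := congrArg (fun x : ℝ => (x : ℂ)) (jacobiα_sq hp hq hn)
      simp only [Multiset.insert_eq_cons, Multiset.map_cons, Multiset.map_singleton,
        Multiset.prod_cons, Multiset.prod_singleton]
      push_cast at this ⊢
      linear_combination this) (fun n hn => by
      have := Complex.ofReal_ne_zero.2 (hden n hn).ne'
      simp only [Multiset.insert_eq_cons, Multiset.map_cons, Multiset.map_singleton,
        Multiset.prod_cons, Multiset.prod_singleton]
      push_cast at this ⊢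
      convert this using 1
      ring)
  -- The centre of symmetry is (p + q + 2)/2.
  have hL : (({-((p : ℂ) + q) / 2, ((p : ℂ) - q) / 2, 1 / 2, 0} : Multiset ℂ).map
      fun e => ((p : ℂ) + q + 2) / 2 + e) +
      (({-((p : ℂ) + q) / 2, ((p : ℂ) - q) / 2, 1 / 2, 0} : Multiset ℂ).map
      fun e => ((p : ℂ) + q + 2) / 2 - e) = 2 • M := by
    rw [← hM]
    simp only [Multiset.insert_eq_cons, Multiset.map_cons, Multiset.map_singleton]
    rw [show ((p : ℂ) + q + 2) / 2 + -((p : ℂ) + q) / 2 = 1 by ring,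
      show ((p : ℂ) + q + 2) / 2 - -((p : ℂ) + q) / 2 = p + q + 1 by ring,
      show ((p : ℂ) + q + 2) / 2 + ((p : ℂ) - q) / 2 = p + 1 by ring,
      show ((p : ℂ) + q + 2) / 2 - ((p : ℂ) - q) / 2 = q + 1 by ring,
      show ((p : ℂ) + q + 2) / 2 + 1 / 2 = (p + q + 3) / 2 by ring,
      show ((p : ℂ) + q + 2) / 2 - 1 / 2 = (p + q + 1) / 2 by ring, add_zero, sub_zero]
    simp only [← Multiset.singleton_add]
    generalize (p : ℂ) + 1 = p₁, (q : ℂ) + 1 = p₂, ((p : ℂ) + q + 3) / 2 = p₃,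
      ((p : ℂ) + q + 1) / 2 = p₄, (p : ℂ) + q + 1 = p₅, ((p : ℂ) + q + 2) / 2 = p₆
    abel
  have hfac := jacobi_factors (E₀ := (-((p : ℂ) + q) / 2) ^ 2) (E₁ := (((p : ℂ) - q) / 2) ^ 2)
    (fun W hW => by
      have := even_count_sq hL W hW
      simp only [Multiset.insert_eq_cons, Multiset.map_cons, Multiset.map_singleton] at this ⊢
      rwa [show (1 / 2 : ℂ) ^ 2 = 1 / 4 by norm_num, show (0 : ℂ) ^ 2 = 0 by norm_num] at this)
  have hfac' : ((-(p + q) / 2) ^ 2 = 1 / 4 ∧ ((p - q) / 2) ^ 2 = 0) ∨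
      ((-(p + q) / 2) ^ 2 = 0 ∧ ((p - q) / 2) ^ 2 = 1 / 4) := by
    refine hfac.imp (fun h => ⟨?_, ?_⟩) (fun h => ⟨?_, ?_⟩)
    · exact Complex.ofReal_injective (by push_cast; exact h.1)
    · exact Complex.ofReal_injective (by push_cast; exact h.2)
    · exact Complex.ofReal_injective (by push_cast; exact h.1)
    · exact Complex.ofReal_injective (by push_cast; exact h.2)
  -- In each surviving case p = q or p = −q, which removes the pole of the diagonal.
  have hK : q ^ 2 - p ^ 2 = 0 := by
    have : (-(p + q) / 2) * ((p - q) / 2) = 0 := by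
      rcases hfac' with ⟨-, h⟩ | ⟨h, -⟩
      · rw [pow_eq_zero_iff two_ne_zero] at h
        rw [h, mul_zero]
      · rw [pow_eq_zero_iff two_ne_zero] at h
        rw [h, zero_mul]
    linear_combination 4 * this
  refine hr.geometric_of_const (jacobiα_pos hp hq) (γ := 1 / 2) (c₀ := 0) (fun n hn => ?_)
    fun n hn => ?_
  · have hsq : jacobiα p q n ^ 2 = (1 / 2) ^ 2 := by
      apply mul_right_cancel₀ (hden n hn).ne'
      rw [jacobiα_sq hp hq hn]
      rcases hfac' with ⟨h0, h1⟩ | ⟨h0, h1⟩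
      · linear_combination (-(((n : ℝ) + (p + q + 2) / 2) ^ 2 - ((p - q) / 2) ^ 2) * h0 -
          (((n : ℝ) + (p + q + 2) / 2) ^ 2 - 1 / 4) * h1) / 4
      · linear_combination (-(((n : ℝ) + (p + q + 2) / 2) ^ 2 - ((p - q) / 2) ^ 2) * h0 -
          (((n : ℝ) + (p + q + 2) / 2) ^ 2) * h1) / 4
    exact (pow_left_inj₀ (jacobiα_pos hp hq n).le (by norm_num) two_ne_zero).1 hsq
  · rw [hβ n hn, hK, diagForm]
    simp

/-! ### Continuous Hahn -/

lemma contHahnA_of_pos (a b c d : ℂ) {n : ℕ} (hn : 1 ≤ n) : contHahnA a b c d n =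
    -((n + a + b + c + d - 1) * (n + a + c) * (n + a + d) /
      ((2 * n + a + b + c + d - 1) * (2 * n + a + b + c + d))) := by
  obtain ⟨k, rfl⟩ := Nat.exists_eq_add_of_le' hn
  rfl

lemma contHahnC_of_pos (a b c d : ℂ) {n : ℕ} (hn : 1 ≤ n) : contHahnC a b c d n =
    n * (n + b + c - 1) * (n + b + d - 1) /
      ((2 * n + a + b + c + d - 2) * (2 * n + a + b + c + d - 1)) := by
  obtain ⟨k, rfl⟩ := Nat.exists_eq_add_of_le' hn
  rfl

/-- The partial fraction decomposition behind the diagonal of the continuous Hahn matrix. -/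
lemma contHahn_partial_fraction {η e₀ e₁ e₂ : ℂ} (h0 : η ≠ 0) (h1 : 2 * η + 1 ≠ 0)
    (h2 : 2 * η - 1 ≠ 0) :
    -((η + 1 / 2 - e₀) * (η + 1 / 2 + e₁) * (η + 1 / 2 + e₂) / (2 * η * (2 * η + 1))) +
      (η - 1 / 2 + e₀) * (η - 1 / 2 - e₂) * (η - 1 / 2 - e₁) / ((2 * η - 1) * (2 * η)) =
    -(1 - e₀ + e₁ + e₂) / 2 + 2 * (e₀ * e₁ * e₂) / ((2 * η - 1) * (2 * η + 1)) := by
  obtain ⟨u, rfl⟩ : ∃ u, η = (u + 1) / 2 := ⟨2 * η - 1, by ring⟩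
  rw [show 2 * ((u + 1) / 2) + 1 = u + 2 by ring] at *
  rw [show 2 * ((u + 1) / 2) - 1 = u by ring] at *
  rw [show 2 * ((u + 1) / 2) = u + 1 by ring]
  have h3 : u + 1 ≠ 0 := fun h => h0 (by rw [h, zero_div])
  field_simp
  ring

/-- The value of `α_n ^ 2` for `n ≥ 1`, where `a = x + iy`, `b = u + iv`, `m = x + u` and
`δ = y - v`. -/
lemma contHahn_prod_of_pos {a b c d : ℂ} {x u m δ : ℝ} (hm : m = x + u) (h0 : 0 < m)
    (hac : a + c = 2 * x) (hbd : b + d = 2 * u) (had : a + d = m + δ * Complex.I)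
    (hbc : b + c = m - δ * Complex.I) {n : ℕ} (hn : 1 ≤ n) :
    -(contHahnA a b c d n * contHahnC a b c d (n + 1)) * (16 * ((n + (2 * m - 1) / 2) *
      (n + (2 * m + 1) / 2) * (n + m) ^ 2)) = (n + 1) * (n + (2 * m - 1)) * (n + 2 * x) *
      (n + 2 * u) * ((n + m) ^ 2 + δ ^ 2) := by
  have h1n : (1 : ℝ) ≤ n := by exact_mod_cast hn
  have hsum : a + b + c + d = 2 * m := by rw [hm]; push_cast; linear_combination hac + hbd
  have hd1 : 2 * (n : ℂ) + 2 * m - 1 ≠ 0 := by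
    have : 2 * (n : ℝ) + 2 * m - 1 ≠ 0 := by linarith
    exact_mod_cast this
  have hd2 : 2 * (n : ℂ) + 2 * m ≠ 0 := by
    have : 2 * (n : ℝ) + 2 * m ≠ 0 := by linarith
    exact_mod_cast this
  have hd3 : 2 * (n : ℂ) + 2 * m + 1 ≠ 0 := by
    have : 2 * (n : ℝ) + 2 * m + 1 ≠ 0 := by linarith
    exact_mod_cast this
  rw [contHahnA_of_pos _ _ _ _ hn, contHahnC_of_pos _ _ _ _ (by omega)]
  push_cast
  rw [show 2 * (n : ℂ) + a + b + c + d - 1 = 2 * n + 2 * m - 1 by rw [← hsum]; ring,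
    show 2 * (n : ℂ) + a + b + c + d = 2 * n + 2 * m by rw [← hsum]; ring,
    show 2 * ((n : ℂ) + 1) + a + b + c + d - 2 = 2 * n + 2 * m by rw [← hsum]; ring,
    show 2 * ((n : ℂ) + 1) + a + b + c + d - 1 = 2 * n + 2 * m + 1 by rw [← hsum]; ring,
    show (n : ℂ) + a + b + c + d - 1 = n + (2 * m - 1) by rw [← hsum]; ring,
    show (n : ℂ) + a + c = n + 2 * x by rw [← hac]; ring,
    show (n : ℂ) + 1 + b + d - 1 = n + 2 * u by rw [← hbd]; ring,
    show (n : ℂ) + a + d = (n + m) + δ * Complex.I by linear_combination had,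
    show (n : ℂ) + 1 + b + c - 1 = (n + m) - δ * Complex.I by linear_combination hbc,
    show ((n : ℂ) + m) ^ 2 + δ ^ 2 = ((n + m) + δ * Complex.I) * ((n + m) - δ * Complex.I) by
      linear_combination (δ ^ 2 : ℂ) * Complex.I_sq,
    show (n : ℂ) + (2 * m - 1) / 2 = (2 * n + 2 * m - 1) / 2 by ring,
    show (n : ℂ) + (2 * m + 1) / 2 = (2 * n + 2 * m + 1) / 2 by ring]
  generalize (n : ℂ) + m + δ * Complex.I = p₁, (n : ℂ) + m - δ * Complex.I = p₂,
    (n : ℂ) + 2 * x = p₃, (n : ℂ) + 2 * u = p₄, (n : ℂ) + (2 * m - 1) = p₅, (n : ℂ) + 1 = p₆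
  rw [show (n : ℂ) + m = (2 * n + 2 * m) / 2 by ring]
  generalize 2 * (n : ℂ) + 2 * m - 1 = d₁ at *
  generalize 2 * (n : ℂ) + 2 * m + 1 = d₂ at *
  generalize 2 * (n : ℂ) + 2 * m = d₃ at *
  field_simp
  ring

lemma contHahn_prod_pos {a b c d : ℂ} {x u m δ : ℝ} (hm : m = x + u) (hx : 0 < x) (hu : 0 < u)
    (hac : a + c = 2 * x) (hbd : b + d = 2 * u) (had : a + d = m + δ * Complex.I)
    (hbc : b + c = m - δ * Complex.I) (n : ℕ) :
    ∃ r : ℝ, 0 < r ∧ -(contHahnA a b c d n * contHahnC a b c d (n + 1)) = r := by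
  have h0 : 0 < m := by rw [hm]; positivity
  rcases Nat.eq_zero_or_pos n with rfl | hn
  · refine ⟨2 * x * (2 * u) * (m ^ 2 + δ ^ 2) / ((2 * m) ^ 2 * (2 * m + 1)), by positivity, ?_⟩
    have hsum : a + b + c + d = 2 * m := by rw [hm]; push_cast; linear_combination hac + hbd
    have hs0 : (2 * m : ℂ) ≠ 0 := by exact_mod_cast (by positivity : 2 * m ≠ 0)
    have hs1 : (2 * m : ℂ) + 1 ≠ 0 := by exact_mod_cast (by positivity : 2 * m + 1 ≠ 0)
    rw [contHahnC_of_pos _ _ _ _ le_rfl, contHahnA, hsum, hac, had]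
    push_cast
    rw [show 2 * (1 : ℂ) + a + b + c + d - 2 = 2 * m by rw [← hsum]; ring,
      show 2 * (1 : ℂ) + a + b + c + d - 1 = 2 * m + 1 by rw [← hsum]; ring,
      show 1 + b + c - 1 = b + c by ring, show 1 + b + d - 1 = b + d by ring, hbc, hbd,
      show ((m : ℂ)) ^ 2 + δ ^ 2 = (m + δ * Complex.I) * (m - δ * Complex.I) by
        linear_combination (δ ^ 2 : ℂ) * Complex.I_sq]
    generalize (m : ℂ) + δ * Complex.I = p₁, (m : ℂ) - δ * Complex.I = p₂
    generalize 2 * (m : ℂ) + 1 = d₁ at *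
    generalize 2 * (m : ℂ) = d₂ at *
    field_simp
  · have h1n : (1 : ℝ) ≤ n := by exact_mod_cast hn
    have hden : 0 < 16 * (((n : ℝ) + (2 * m - 1) / 2) * (n + (2 * m + 1) / 2) * (n + m) ^ 2) := by
      have h1 : 0 < (n : ℝ) + (2 * m - 1) / 2 := by linarith
      have h2 : 0 < (n : ℝ) + (2 * m + 1) / 2 := by linarith
      positivity
    have hnum : 0 < ((n : ℝ) + 1) * (n + (2 * m - 1)) * (n + 2 * x) * (n + 2 * u) *
        ((n + m) ^ 2 + δ ^ 2) := by
      have h2 : 0 < (n : ℝ) + (2 * m - 1) := by linarith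
      positivity
    refine ⟨_, div_pos hnum hden, ?_⟩
    have hden' := Complex.ofReal_ne_zero.2 hden.ne'
    push_cast at hden' ⊢
    rw [eq_div_iff hden', contHahn_prod_of_pos hm h0 hac hbd had hbc hn]

lemma contHahnβ_eq {a b c d : ℂ} {x u m δ : ℝ} (hm : m = x + u) (h0 : 0 < m)
    (hac : a + c = 2 * x) (hbd : b + d = 2 * u) (had : a + d = m + δ * Complex.I)
    (hbc : b + c = m - δ * Complex.I) : ∃ c₀ : ℝ, ∀ n : ℕ, 1 ≤ n →
    contHahnβ a b c d n = diagForm 0 0 c₀ (-2 * ((1 - m) * (x - u) * δ)) (2 * m) n := by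
  have hsum : a + b + c + d = 2 * m := by rw [hm]; push_cast; linear_combination hac + hbd
  have hm' : (m : ℂ) = x + u := by exact_mod_cast hm
  set e₀ : ℂ := 1 - m with he0
  set e₁ : ℂ := x - u with he1
  set e₂ : ℂ := δ * Complex.I with he2
  refine ⟨(Complex.I * (-(1 - e₀ + e₁ + e₂) / 2 + a)).re, fun n hn => ?_⟩
  have h1n : (1 : ℝ) ≤ n := by exact_mod_cast hn
  set η : ℂ := n + (2 * m - 1) / 2 with hη
  have hd0 : η ≠ 0 := by
    have : (n : ℝ) + (2 * m - 1) / 2 ≠ 0 := by linarith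
    rw [hη]
    exact_mod_cast this
  have hd1 : 2 * η + 1 ≠ 0 := by
    have : 2 * ((n : ℝ) + (2 * m - 1) / 2) + 1 ≠ 0 := by linarith
    rw [hη]
    exact_mod_cast this
  have hd2 : 2 * η - 1 ≠ 0 := by
    have : 2 * ((n : ℝ) + (2 * m - 1) / 2) - 1 ≠ 0 := by linarith
    rw [hη]
    exact_mod_cast this
  have hpf := contHahn_partial_fraction (e₀ := e₀) (e₁ := e₁) (e₂ := e₂) hd0 hd1 hd2
  have hAC : Complex.I * (contHahnA a b c d n + contHahnC a b c d n + a) =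
      Complex.I * (-(1 - e₀ + e₁ + e₂) / 2 + a) +
      ((-2 * ((1 - m) * (x - u) * δ) / ((2 * n + 2 * m - 2) * (2 * n + 2 * m)) : ℝ) : ℂ) := by
    rw [contHahnA_of_pos _ _ _ _ hn, contHahnC_of_pos _ _ _ _ hn,
      show (n : ℂ) + a + b + c + d - 1 = η + 1 / 2 - e₀ by
        rw [hη, he0]; linear_combination hsum,
      show (n : ℂ) + a + c = η + 1 / 2 + e₁ by rw [hη, he1]; linear_combination hac - hm',
      show (n : ℂ) + a + d = η + 1 / 2 + e₂ by rw [hη]; linear_combination had,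
      show 2 * (n : ℂ) + a + b + c + d - 1 = 2 * η by rw [hη]; linear_combination hsum,
      show 2 * (n : ℂ) + a + b + c + d - 2 = 2 * η - 1 by rw [hη]; linear_combination hsum,
      show 2 * (n : ℂ) + a + b + c + d = 2 * η + 1 by rw [hη]; linear_combination hsum,
      show (n : ℂ) + b + c - 1 = η - 1 / 2 - e₂ by rw [hη]; linear_combination hbc,
      show (n : ℂ) + b + d - 1 = η - 1 / 2 - e₁ by
        rw [hη, he1]; linear_combination hbd - hm',
      show (n : ℂ) = η - 1 / 2 + e₀ by rw [hη, he0]; ring, hpf]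
    push_cast
    rw [show 2 * (n : ℂ) + 2 * (m : ℂ) - 2 = 2 * η - 1 by rw [hη]; ring,
      show 2 * (n : ℂ) + 2 * (m : ℂ) = 2 * η + 1 by rw [hη]; ring, ← he0, ← he1]
    have hI : Complex.I * e₂ = -δ := by rw [he2]; linear_combination (δ : ℂ) * Complex.I_sq
    linear_combination 2 * (e₀ * e₁) / ((2 * η - 1) * (2 * η + 1)) * hI
  rw [contHahnβ, hAC, Complex.add_re, Complex.ofReal_re, diagForm]
  ring

/-- No nonzero Hankel matrix with decaying entries commutes with a continuous Hahn matrix. -/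
theorem eq_zero_of_contHahn {h : ℕ → ℂ} (hlim : Tendsto h atTop (𝓝 0)) {a b c d : ℂ}
    (hadm : ContHahnAdmissible a b c d)
    (hr : HankelRows (contHahnα a b c d) (contHahnβ a b c d) h) : ∀ k, h k = 0 := by
  by_contra! hne
  obtain ⟨hc, hd, hx, hu⟩ := hadm
  obtain ⟨x, hxe⟩ : ∃ x, x = a.re := ⟨_, rfl⟩
  obtain ⟨u, hue⟩ : ∃ u, u = b.re := ⟨_, rfl⟩
  obtain ⟨m, hm⟩ : ∃ m, m = x + u := ⟨_, rfl⟩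
  obtain ⟨δ, hδ⟩ : ∃ δ, δ = a.im - b.im := ⟨_, rfl⟩
  rw [← hxe] at hx
  rw [← hue] at hu
  have h0 : 0 < m := by rw [hm]; positivity
  have hac : a + c = 2 * x := by
    rw [hc, hxe]
    exact Complex.ext (by simp; ring) (by simp)
  have hbd : b + d = 2 * u := by
    rw [hd, hue]
    exact Complex.ext (by simp; ring) (by simp)
  have had : a + d = m + δ * Complex.I := by
    rw [hd, hm, hδ, hxe, hue]
    exact Complex.ext (by simp) (by simp; ring)
  have hbc : b + c = m - δ * Complex.I := by
    rw [hc, hm, hδ, hxe, hue]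
    exact Complex.ext (by simp; ring) (by simp; ring)
  have hpos : ∀ n, 0 < contHahnα a b c d n := by
    intro n
    obtain ⟨r, hr, hprod⟩ := contHahn_prod_pos hm hx hu hac hbd had hbc n
    exact sqrt_re_pos hr hprod
  have hsq : ∀ n : ℕ, 1 ≤ n → contHahnα a b c d n ^ 2 * (16 * ((n + (2 * m - 1) / 2) *
      (n + (2 * m + 1) / 2) * (n + m) ^ 2)) = (n + 1) * (n + (2 * m - 1)) * (n + 2 * x) *
      (n + 2 * u) * ((n + m) ^ 2 + δ ^ 2) := by
    intro n hn
    obtain ⟨r, hr, hprod⟩ := contHahn_prod_pos hm hx hu hac hbd had hbc n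
    have := contHahn_prod_of_pos hm h0 hac hbd had hbc hn
    rw [← sq_sqrt_re hr hprod] at this
    exact_mod_cast this
  have hden : ∀ n : ℕ, 1 ≤ n →
      0 < ((n : ℝ) + (2 * m - 1) / 2) * (n + (2 * m + 1) / 2) * (n + m) ^ 2 := by
    intro n hn
    have h1n : (1 : ℝ) ≤ n := by exact_mod_cast hn
    have h1 : 0 < (n : ℝ) + (2 * m - 1) / 2 := by linarith
    have h2 : 0 < (n : ℝ) + (2 * m + 1) / 2 := by linarith
    positivity
  obtain ⟨c₀, hβ⟩ := contHahnβ_eq hm h0 hac hbd had hbc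
  have hm' : (m : ℂ) = x + u := by exact_mod_cast hm
  obtain ⟨M, hM⟩ := hr.exists_half_of_card hne hpos (by positivity) hβ
    (S := {1, 2 * (m : ℂ) - 1, 2 * (x : ℂ), 2 * (u : ℂ), m + δ * Complex.I, m - δ * Complex.I})
    (T := {(2 * (m : ℂ) - 1) / 2, (2 * (m : ℂ) + 1) / 2, (m : ℂ), (m : ℂ)}) (k := 1 / 16)
    (by norm_num) (j := 1) (by simp) (Or.inr (Or.inl ⟨rfl, rfl⟩)) (fun n hn => by
      have := congrArg (fun x : ℝ => (x : ℂ)) (hsq n hn)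
      simp only [Multiset.insert_eq_cons, Multiset.map_cons, Multiset.map_singleton,
        Multiset.prod_cons, Multiset.prod_singleton]
      push_cast at this ⊢
      rw [show ((n : ℂ) + (m + δ * Complex.I)) * (n + (m - δ * Complex.I)) =
        (n + m) ^ 2 + δ ^ 2 by linear_combination (-δ ^ 2 : ℂ) * Complex.I_sq]
      linear_combination this / 16) (fun n hn => by
      have := Complex.ofReal_ne_zero.2 (hden n hn).ne'
      simp only [Multiset.insert_eq_cons, Multiset.map_cons, Multiset.map_singleton,
        Multiset.prod_cons, Multiset.prod_singleton]
      push_cast at this ⊢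
      convert this using 1
      ring)
  -- The centre of symmetry is m, half the parameter sum.
  have hL : (({1 - (m : ℂ), (x : ℂ) - u, δ * Complex.I, 1 / 2, 0} : Multiset ℂ).map
      fun e => (m : ℂ) + e) +
      (({1 - (m : ℂ), (x : ℂ) - u, δ * Complex.I, 1 / 2, 0} : Multiset ℂ).map
      fun e => (m : ℂ) - e) = 2 • M := by
    rw [← hM]
    simp only [Multiset.insert_eq_cons, Multiset.map_cons, Multiset.map_singleton]
    rw [show (m : ℂ) + (1 - m) = 1 by ring, show (m : ℂ) - (1 - m) = 2 * m - 1 by ring,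
      show (m : ℂ) + (x - u) = 2 * x by rw [hm']; ring,
      show (m : ℂ) - (x - u) = 2 * u by rw [hm']; ring,
      show (m : ℂ) + 1 / 2 = (2 * m + 1) / 2 by ring,
      show (m : ℂ) - 1 / 2 = (2 * m - 1) / 2 by ring, add_zero, sub_zero]
    simp only [← Multiset.singleton_add]
    generalize (m : ℂ) + δ * Complex.I = p₁, (m : ℂ) - δ * Complex.I = p₂,
      (2 * (m : ℂ) + 1) / 2 = p₃, (2 * (m : ℂ) - 1) / 2 = p₄, 2 * (m : ℂ) - 1 = p₅,
      2 * (x : ℂ) = p₆, 2 * (u : ℂ) = p₇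
    abel
  have hfac := contHahn_factors (E₀ := (1 - (m : ℂ)) ^ 2) (E₁ := ((x : ℂ) - u) ^ 2)
    (E₂ := (δ * Complex.I) ^ 2) (fun W hW => by
      have := even_count_sq hL W hW
      simp only [Multiset.insert_eq_cons, Multiset.map_cons, Multiset.map_singleton] at this ⊢
      rwa [show (1 / 2 : ℂ) ^ 2 = 1 / 4 by norm_num, show (0 : ℂ) ^ 2 = 0 by norm_num] at this)
  rw [show (δ * Complex.I) ^ 2 = ((-δ ^ 2 : ℝ) : ℂ) by
    rw [mul_pow, Complex.I_sq]; push_cast; ring] at hfac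
  push_cast at hfac
  have hfac' : ((1 - m) ^ 2 = 1 / 4 ∧ (x - u) ^ 2 = -δ ^ 2) ∨
      ((x - u) ^ 2 = 1 / 4 ∧ (1 - m) ^ 2 = -δ ^ 2) ∨
      (-δ ^ 2 = 1 / 4 ∧ (1 - m) ^ 2 = (x - u) ^ 2) := by
    refine hfac.imp (fun h => ⟨?_, ?_⟩) (Or.imp (fun h => ⟨?_, ?_⟩) (fun h => ⟨?_, ?_⟩))
    · exact Complex.ofReal_injective (by push_cast; exact h.1)
    · exact Complex.ofReal_injective (by push_cast; exact h.2)
    · exact Complex.ofReal_injective (by push_cast; exact h.1)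
    · exact Complex.ofReal_injective (by push_cast; exact h.2)
    · exact Complex.ofReal_injective (by push_cast; exact h.1)
    · exact Complex.ofReal_injective (by push_cast; exact h.2)
  -- Since −δ² is nonpositive it cannot be 1/4, and a real square equal to it forces δ = 0. Then α_n
  -- = (n + m)/4 and the diagonal is constant for n ≥ 1.
  obtain ⟨hδ0, hprod⟩ : δ = 0 ∧ ∀ w : ℝ,
      (w - (1 - m) ^ 2) * (w - (x - u) ^ 2) = w * (w - 1 / 4) := by
    rcases hfac' with ⟨h1, h2⟩ | ⟨h1, h2⟩ | ⟨h1, h2⟩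
    · have h3 : δ ^ 2 = 0 := by nlinarith [sq_nonneg δ, sq_nonneg (x - u)]
      refine ⟨(pow_eq_zero_iff two_ne_zero).1 h3, fun w => ?_⟩
      rw [h1, h2, h3]
      ring
    · have h3 : δ ^ 2 = 0 := by nlinarith [sq_nonneg δ, sq_nonneg (1 - m)]
      refine ⟨(pow_eq_zero_iff two_ne_zero).1 h3, fun w => ?_⟩
      rw [h1, h2, h3]
      ring
    · nlinarith [sq_nonneg δ]
  obtain ⟨k, hk⟩ := hne
  refine hk (hr.eq_zero_of_affine_of_const hpos hlim (γ := 1 / 4) (p := m) (c₀ := c₀)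
    (by norm_num) (fun n hn => ?_) (fun n hn => ?_) k)
  · have hw : contHahnα a b c d n ^ 2 = (1 / 4 * ((n : ℝ) + m)) ^ 2 := by
      apply mul_right_cancel₀ (mul_ne_zero (by norm_num : (16 : ℝ) ≠ 0) (hden n hn).ne')
      rw [hsq n hn, hδ0]
      have := hprod ((n + m) ^ 2)
      rw [show ((n : ℝ) + m) ^ 2 - (1 - m) ^ 2 = (n + 1) * (n + (2 * m - 1)) by ring,
        show ((n : ℝ) + m) ^ 2 - (x - u) ^ 2 = (n + 2 * x) * (n + 2 * u) by rw [hm]; ring] at this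
      linear_combination ((n : ℝ) + m) ^ 2 * this
    exact (pow_left_inj₀ (hpos n).le (by positivity) two_ne_zero).1 hw
  · rw [hβ n hn, hδ0, diagForm]
    simp

/-! ### The Hilbert matrix -/

/-- The pair sums of 1/2, 1/2, t − 1/2 are 1, t, t, so α_n = (n + 1)(n + t). Every row is then a
multiple, by n + 1 or n − m, of one recurrence. -/
lemma hankelRows_contDualHahn {h : ℕ → ℂ} {t : ℝ} (ht : 0 < t)
    (hh : ∀ k : ℕ, ((k : ℂ) + t) * h k + 2 * (k + 1 + t) * h (k + 1) +
      (k + 2 + t) * h (k + 2) = 0) :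
    HankelRows (contDualHahnα (1 / 2) (1 / 2) ((t - 1 / 2 : ℝ) : ℂ))
      (contDualHahnβ (1 / 2) (1 / 2) ((t - 1 / 2 : ℝ) : ℂ)) h := by
  have hα : ∀ n : ℕ, contDualHahnα (1 / 2) (1 / 2) ((t - 1 / 2 : ℝ) : ℂ) n = (n + 1) * (n + t) := by
    intro n
    have : contDualHahnA (1 / 2) (1 / 2) ((t - 1 / 2 : ℝ) : ℂ) n *
        contDualHahnC (1 / 2) (1 / 2) ((t - 1 / 2 : ℝ) : ℂ) (n + 1) =
        ((((n + 1) * (n + t)) ^ 2 : ℝ) : ℂ) := by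
      rw [contDualHahnA, contDualHahnC]
      push_cast
      ring
    rw [contDualHahnα, this, Complex.ofReal_re, Real.sqrt_sq (by positivity)]
  have hβ : ∀ n : ℕ, contDualHahnβ (1 / 2) (1 / 2) ((t - 1 / 2 : ℝ) : ℂ) n =
      2 * n ^ 2 + 2 * t * n + (t - 1 / 4) := by
    intro n
    have : contDualHahnA (1 / 2) (1 / 2) ((t - 1 / 2 : ℝ) : ℂ) n +
        contDualHahnC (1 / 2) (1 / 2) ((t - 1 / 2 : ℝ) : ℂ) n - (1 / 2) ^ 2 =
        ((2 * n ^ 2 + 2 * t * n + (t - 1 / 4) : ℝ) : ℂ) := by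
      rw [contDualHahnA, contDualHahnC]
      push_cast
      ring
    rw [contDualHahnβ, this, Complex.ofReal_re]
  constructor
  · intro n
    rw [hα, hα, hα, hβ, hβ]
    push_cast
    linear_combination ((n : ℂ) + 1) * hh n
  · intro m n
    rw [hα, hα, hα, hα, hβ, hβ]
    have := hh (m + n + 1)
    push_cast at this ⊢
    rw [show m + n + 1 + 1 = m + n + 2 from rfl, show m + n + 1 + 2 = m + n + 3 from rfl] at this
    linear_combination ((n : ℂ) - m) * this

lemma contDualHahnAdmissible_of_pos {t : ℝ} (ht : 0 < t) :
    ContDualHahnAdmissible (1 / 2) (1 / 2) ((t - 1 / 2 : ℝ) : ℂ) := by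
  constructor
  · have h1 : star (1 / 2 : ℂ) = 1 / 2 := by
      rw [show (1 / 2 : ℂ) = ((1 / 2 : ℝ) : ℂ) by push_cast; rfl]
      exact Complex.conj_ofReal _
    have h2 : star ((t - 1 / 2 : ℝ) : ℂ) = ((t - 1 / 2 : ℝ) : ℂ) := Complex.conj_ofReal _
    rw [ConjPaired]
    simp only [Multiset.insert_eq_cons, Multiset.map_cons, Multiset.map_singleton, h1, h2]
  · have hh : (1 / 2 : ℂ).re = 1 / 2 := by
      rw [show (1 / 2 : ℂ) = ((1 / 2 : ℝ) : ℂ) by push_cast; rfl, Complex.ofReal_re]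
    rcases lt_or_ge (1 / 2) t with h | h
    · left
      rw [hh, Complex.ofReal_re]
      exact ⟨by norm_num, by norm_num, by linarith⟩
    -- For t ≤ 1/2 the nonpositive parameter t − 1/2 plays the role of a, and both sums with it
    -- equal t.
    · right
      refine ⟨((t - 1 / 2 : ℝ) : ℂ), 1 / 2, 1 / 2, ?_, Complex.ofReal_im _, ?_, ?_, ?_⟩
      · simp only [Multiset.insert_eq_cons, ← Multiset.singleton_add]
        generalize ((t - 1 / 2 : ℝ) : ℂ) = u
        abel
      · rw [Complex.ofReal_re]
        linarith
      · rw [Complex.add_re, Complex.ofReal_re, hh]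
        linarith
      · rw [Complex.add_re, Complex.ofReal_re, hh]
        linarith

lemma transformedHilbert_apply (t : ℝ) (m n : ℕ) :
    transformedHilbert t m n = (-1) ^ (m + n) / (((m + n : ℕ) : ℂ) + t) := by
  rw [transformedHilbert, Matrix.of_apply]
  push_cast
  rfl

lemma natCast_add_ofReal_ne_zero {t : ℝ} (ht : 0 < t) (k : ℕ) : (k : ℂ) + t ≠ 0 := by
  have : (k : ℝ) + t ≠ 0 := by positivity
  exact_mod_cast this

lemma hasL2Columns_smul_transformedHilbert {t : ℝ} (ht : 0 < t) (κ : ℂ) :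
    HasL2Columns (κ • transformedHilbert t) := by
  intro n
  have hs : Summable fun m : ℕ => ‖κ‖ ^ 2 * (1 / ((m : ℝ) + t) ^ 2) := by
    refine Summable.mul_left _ ?_
    have h1 : Summable fun m : ℕ => 1 / |(m : ℝ) + t| ^ (2 : ℝ) :=
      (Real.summable_one_div_nat_add_rpow t 2).2 (by norm_num)
    refine h1.congr fun m => ?_
    rw [Real.rpow_two, sq_abs]
  refine Summable.of_nonneg_of_le (fun m => by positivity) (fun m => ?_) hs
  rw [Matrix.smul_apply, transformedHilbert_apply, smul_eq_mul, norm_mul, mul_pow, norm_div,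
    norm_pow, norm_neg, norm_one, one_pow, div_pow, one_pow]
  have hn : ‖(((m + n : ℕ) : ℂ) + t)‖ = m + n + t := by
    rw [show (((m + n : ℕ) : ℂ) + t) = ((m + n + t : ℝ) : ℂ) by push_cast; rfl,
      Complex.norm_real, Real.norm_of_nonneg (by positivity)]
  rw [hn]
  gcongr
  linarith [(Nat.cast_nonneg n : (0 : ℝ) ≤ n)]

/-- A Cauchy matrix argument: clearing denominators in a vanishing combination of columns gives a
polynomial that vanishes at every natural number. Evaluating it at the pole −(i + t) isolates the
i-th coefficient. -/
lemma linearIndependent_col_transformedHilbert {t : ℝ} (ht : 0 < t) {κ : ℂ} (hκ : κ ≠ 0) :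
    LinearIndependent ℂ (κ • transformedHilbert t).col := by
  rw [linearIndependent_iff']
  intro s g hg i hi
  have hrow : ∀ m : ℕ, ∑ j ∈ s, g j * (κ * ((-1) ^ (m + j) / (((m + j : ℕ) : ℂ) + t))) = 0 := by
    intro m
    have := congrFun hg m
    simpa [Matrix.col_apply, transformedHilbert_apply] using this
  set P : ℂ[X] := ∑ j ∈ s, C (g j * (-1) ^ j) * ∏ l ∈ s.erase j, (X + C ((l : ℂ) + t)) with hP
  have hP0 : P = 0 := by
    refine eq_of_eval_natCast_eq 0 fun m _ => ?_
    rw [eval_zero, hP, eval_finsetSum]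
    simp only [eval_mul, eval_C, eval_prod, eval_add, eval_X]
    have hmul : (∏ l ∈ s, ((m : ℂ) + (l + t))) * (κ⁻¹ * (-1) ^ m) *
        ∑ j ∈ s, g j * (κ * ((-1) ^ (m + j) / (((m + j : ℕ) : ℂ) + t))) = 0 := by
      rw [hrow, mul_zero]
    rw [Finset.mul_sum] at hmul
    rw [← hmul]
    refine Finset.sum_congr rfl fun j hj => ?_
    rw [← Finset.mul_prod_erase s _ hj]
    have hne := natCast_add_ofReal_ne_zero ht (m + j)
    push_cast at hne ⊢
    rw [show (m : ℂ) + (j + t) = m + j + t by ring, pow_add]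
    have h1 : ((-1 : ℂ) ^ m) * (-1) ^ m = 1 := by rw [← mul_pow]; simp
    field_simp
    linear_combination (-(g j) * ∏ l ∈ s.erase j, ((m : ℂ) + (l + t))) * h1
  have heval := congrArg (eval (-((i : ℂ) + t))) hP0
  rw [eval_zero, hP, eval_finsetSum, Finset.sum_eq_single i] at heval
  · simp only [eval_mul, eval_C, eval_prod, eval_add, eval_X] at heval
    rcases mul_eq_zero.1 heval with h | h
    · exact (mul_eq_zero.1 h).resolve_right (pow_ne_zero _ (by norm_num))
    · exfalso
      obtain ⟨l, hl, hz⟩ := Finset.prod_eq_zero_iff.1 h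
      refine (Finset.mem_erase.1 hl).1 ?_
      have : (l : ℂ) = i := by linear_combination hz
      exact_mod_cast this
  · intro j hj hji
    rw [eval_mul, eval_prod]
    refine mul_eq_zero_of_right _ (Finset.prod_eq_zero (Finset.mem_erase.2 ⟨hji.symm, hi⟩) ?_)
    simp
  · exact fun h => absurd hi h

lemma eRank_smul_transformedHilbert {t : ℝ} (ht : 0 < t) {κ : ℂ} (hκ : κ ≠ 0) :
    (κ • transformedHilbert t).eRank = ⊤ := by
  rw [Matrix.eRank, Cardinal.toENat_eq_top, Matrix.cRank,
    rank_span (linearIndependent_col_transformedHilbert ht hκ)]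
  have := (linearIndependent_col_transformedHilbert ht hκ).injective
  rw [Cardinal.mk_range_eq _ this]
  exact Cardinal.aleph0_le_mk ℕ

lemma signConj_eq_iff {H : Matrix ℕ ℕ ℂ} {t : ℝ} {κ : ℂ} :
    signConj H = κ • hilbertMatrix t ↔ H = κ • transformedHilbert t := by
  have hsgn : ∀ m : ℕ, ((-1 : ℂ) ^ m) * (-1) ^ m = 1 := fun m => by rw [← mul_pow]; simp
  rw [← Matrix.ext_iff, ← Matrix.ext_iff]
  refine forall_congr' fun m => forall_congr' fun n => ?_
  simp only [signConj, hilbertMatrix, transformedHilbert, Matrix.smul_apply, Matrix.of_apply,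
    smul_eq_mul, pow_add]
  constructor <;> intro h
  · linear_combination (-1) ^ m * (-1) ^ n * h - H m n * (-1) ^ n * (-1) ^ n * hsgn m -
      H m n * hsgn n
  · rw [h]
    linear_combination κ / ((m : ℂ) + n + t) * ((-1) ^ n * (-1) ^ n * hsgn m + hsgn n)

end AskeyHankel

end

/-! ### The classification and its converse -/

open AskeyHankel in
theorem eq_smul_transformedHilbert_of_comm {H J : Matrix ℕ ℕ ℂ} (hH : IsHankel H)
    (hL : HasL2Columns H) (hrank : 1 < H.eRank) (hJ : IsAskeyJacobi J) (hc : mul H J = mul J H) :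
    ∃ t : ℝ, 0 < t ∧ ∃ κ : ℂ, H = κ • transformedHilbert t := by
  obtain ⟨h, hh⟩ := hH
  have hlim := tendsto_zero_of_hasL2Columns hh hL
  have hne : ∃ k, h k ≠ 0 := by
    by_contra! hcon
    exact hrank.not_ge (eRank_le_one_of_eq_zero hh hcon)
  have hconv : (∃ t : ℝ, 0 < t ∧ ∃ κ : ℂ, ∀ k : ℕ, h k = κ * ((-1) ^ k / (k + t))) →
      ∃ t : ℝ, 0 < t ∧ ∃ κ : ℂ, H = κ • transformedHilbert t := by
    rintro ⟨t, ht, κ, hκ⟩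
    refine ⟨t, ht, κ, Matrix.ext fun m n => ?_⟩
    rw [hh, hκ, Matrix.smul_apply, transformedHilbert_apply, smul_eq_mul]
  cases hJ with
  | wilson a b c d hadm =>
    exact hconv (exists_of_wilson hlim hne hadm ((mul_comm_iff_hankelRows hh _ _).1 hc))
  | contDualHahn a b c hadm =>
    exact hconv (exists_of_contDualHahn hlim hne hadm ((mul_comm_iff_hankelRows hh _ _).1 hc))
  | contHahn a b c d hadm =>
    obtain ⟨k, hk⟩ := hne
    exact absurd (eq_zero_of_contHahn hlim hadm ((mul_comm_iff_hankelRows hh _ _).1 hc) k) hk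
  | jacobi p q hp hq =>
    obtain ⟨r, hr⟩ := geometric_of_jacobi hne hp hq ((mul_comm_iff_hankelRows hh _ _).1 hc)
    exact absurd (eRank_le_one_of_geometric hh hr) hrank.not_ge
  | meixnerPollaczek l φ hl h0 hπ =>
    exact absurd (eRank_le_one_meixnerPollaczek hh hlim hl h0 hπ
      ((mul_comm_iff_hankelRows hh _ _).1 hc)) hrank.not_ge
  | meixner c b h0 h1 hb =>
    exact absurd (eRank_le_one_meixner hh hlim h0 h1 hb
      ((mul_comm_iff_hankelRows hh _ _).1 hc)) hrank.not_ge
  | laguerre p hp =>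
    exact absurd (eRank_le_one_laguerre hh hlim hp
      ((mul_comm_iff_hankelRows hh _ _).1 hc)) hrank.not_ge
  | charlier a ha =>
    obtain ⟨k, hk⟩ := hne
    exact absurd (eq_zero_charlier ha ((mul_comm_iff_hankelRows hh _ _).1 hc) k) hk
  | hermite =>
    obtain ⟨k, hk⟩ := hne
    exact absurd (eq_zero_hermite ((mul_comm_iff_hankelRows hh _ _).1 hc) k) hk

theorem mainTheorem2 :
    (∀ H J : Matrix ℕ ℕ ℂ,
      AskeyHankel.IsHankel H → AskeyHankel.HasL2Columns H → 1 < H.eRank →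
      AskeyHankel.IsAskeyJacobi J → AskeyHankel.mul H J = AskeyHankel.mul J H →
      ∃ t : ℝ, 0 < t ∧ ∃ κ : ℂ, H = κ • AskeyHankel.transformedHilbert t) ∧
    (∀ H : Matrix ℕ ℕ ℂ,
      (AskeyHankel.IsHankel H ∧ AskeyHankel.HasL2Columns H ∧ H.eRank = ⊤ ∧
        ∃ J, AskeyHankel.IsAskeyJacobi J ∧ AskeyHankel.mul H J = AskeyHankel.mul J H) ↔
      ∃ t : ℝ, 0 < t ∧ ∃ κ : ℂ, κ ≠ 0 ∧
        AskeyHankel.signConj H = κ • AskeyHankel.hilbertMatrix t) := by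
  open AskeyHankel in
  refine ⟨fun H J hH hL hr hJ hc => eq_smul_transformedHilbert_of_comm hH hL hr hJ hc,
    fun H => ⟨?_, ?_⟩⟩
  · rintro ⟨hH, hL, hr, J, hJ, hc⟩
    have hr1 : 1 < H.eRank := by
      rw [hr]
      exact ENat.natCast_lt_top 1
    obtain ⟨t, ht, κ, hκ⟩ := eq_smul_transformedHilbert_of_comm hH hL hr1 hJ hc
    refine ⟨t, ht, κ, ?_, signConj_eq_iff.2 hκ⟩
    -- A zero scalar would make `H` zero, contradicting its rank.
    rintro rfl
    rw [hκ, zero_smul] at hr1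
    exact hr1.not_ge (eRank_le_one_of_eq_zero (h := fun _ => 0) (fun _ _ => rfl) fun _ => rfl)
  · rintro ⟨t, ht, κ, hκ, hs⟩
    obtain rfl := signConj_eq_iff.1 hs
    obtain ⟨h, hdef⟩ : ∃ h : ℕ → ℂ, ∀ k : ℕ, h k = κ * ((-1) ^ k / ((k : ℂ) + t)) :=
      ⟨_, fun _ => rfl⟩
    have hh : ∀ m n, (κ • transformedHilbert t) m n = h (m + n) := by
      intro m n
      rw [hdef, Matrix.smul_apply, transformedHilbert_apply, smul_eq_mul]
    refine ⟨⟨_, hh⟩, hasL2Columns_smul_transformedHilbert ht κ,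
      eRank_smul_transformedHilbert ht hκ, _,
      IsAskeyJacobi.contDualHahn _ _ _ (contDualHahnAdmissible_of_pos ht),
      (mul_comm_iff_hankelRows hh _ _).2 (hankelRows_contDualHahn ht fun k => ?_)⟩
    have e0 := natCast_add_ofReal_ne_zero ht k
    have e1 := natCast_add_ofReal_ne_zero ht (k + 1)
    have e2 := natCast_add_ofReal_ne_zero ht (k + 2)
    rw [hdef, hdef, hdef]
    push_cast at e0 e1 e2 ⊢
    field_simp
    ring
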